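/- Let $k$ be a field, $n\ge 1$ and $d\ge 1$ integers, and let $m_i=m_0+id$ ($0\le i\le n$) be an arithmetic sequence of positive integers that are relatively prime and minimally generate the numerical semigroup $\sum_i m_i\mathbb N$. Write $m_0=an+b$ with positive integers $a,b$ and $b\in[1,n]$. Let $R=k[X_0,\dots,X_n]$ be graded by $\deg X_i=m_i$, and let $J\subset R$ be the defining ideal of the rational normal curve, i.e. the kernel of $R\to k[s,t]$, $X_i\mapsto s^{n-i}t^i$. Let $\mathbf E$ be the Eagon–Northcott complex of the matrix $\begin{pmatrix}X_0&\cdots&X_{n-1}\\X_1&\cdots&X_n\end{pmatrix}$ and $\mathbf K$ the Koszul complex of $X_0,\dots,X_{n-1}$; they are the minimal graded free resolutions of $R/J$ and $R/(X_0,\dots,X_{n-1})$. For $i\in[b,n]$ set $\Delta_i=X_n^aX_i-X_0^{a+d}X_{i-b}$, a nonzero homogeneous polynomial of degree $\delta_i=m_0(a+d+1)+(i-b)d$, and $I_i=J+(\Delta_b,\dots,\Delta_i)$. Let $\sigma(m,t)$ be the multiset of all sums of $t$ distinct integers in $[0,m-1]$, and $L(s,j)=\bigoplus_{r\in\sigma(n,s)}R(-[m_0(a+d+s+1)+jd+rd])$.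 One has $E_0=R$ and $E_s=\bigoplus_{j=1}^{s}\bigoplus_{r\in\sigma(n,s+1)}R(-[(s+1)m_0+jd+rd])$ for $s\ge1$ (so $E_s=0$ for $s\ge n$). For a map $\mu:\mathbf F\to\mathbf G$ of graded free complexes, $\operatorname{cone}(\mu)$ is the mapping cone, with modules $G_s\oplus F_{s-1}$; its minimized mapping cone $\operatorname{mincone}(\mu)$ is the minimal complex (boundary maps with entries in $(X_0,\dots,X_n)$) obtained from $\operatorname{cone}(\mu)$ by splitting off trivial direct summands $0\to R(-e)\xrightarrow{\ 1\ }R(-e)\to0$. Then for every $i\in[b,n]$ the ring $R/I_i$ is Cohen–Macaulay of codimension $n$ (i.e. $I_i$ has height $n$), and there are minimal graded free resolutions $\mathbf M_i$ of $R/I_i$ ($b\le i\le n$) such that: 1. $\mathbf M_b=\operatorname{cone}(\mathbf\Delta_b)=\operatorname{mincone}(\mathbf\Delta_b)$, where $\mathbf\Delta_b:\mathbf E(-\delta_b)\to\mathbf E$ is multiplication by $\Delta_b$; 2. for $i\in[b+1,n]$, multiplication by $\Delta_i$ on $R$ lifts to a degree-zero map of complexes $\mathbf\Delta_i:\mathbf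 K(-\delta_i)\to\mathbf M_{i-1}$, and $\mathbf M_i=\operatorname{mincone}(\mathbf\Delta_i)$, up to isomorphism, for every such lift; 3. $(\mathbf M_i)_0=R$, $\ (\mathbf M_i)_1=E_1\oplus\bigoplus_{j=0}^{i-b}R(-[m_0(a+d+1)+jd])$, $$(\mathbf M_i)_s=\begin{cases}E_s\oplus\bigoplus_{j=s-1}^{i-b}L(s-1,j)&\text{for } s\in[2,i-b+1],\\ E_s\oplus\bigoplus_{j=i-b+1}^{s-1}L(s,j)&\text{for } s\in[i-b+2,n],\end{cases}$$ and $(\mathbf M_i)_s=0$ for $s>n$. In particular $(\mathbf M_i)_n=L(n-1,n-1)$ if $i=n$ and $b=1$, and $(\mathbf M_i)_n=\bigoplus_{j=i-b+1}^{n-1}L(n,j)$ otherwise. -/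

import Mathlib

noncomputable section

open MvPolynomial

namespace ArithCurve

/-! ### Graded free complexes -/

/-- `p` is the entry of a degree-preserving map `R(-v) → R(-u)`: every monomial of `p` has
weighted degree `v - u` (in particular `p = 0` if `v < u`). -/
def IsDegZero {k : Type*} [CommRing k] {τ : Type} (w : τ → ℕ) (u v : ℕ)
    (p : MvPolynomial τ k) : Prop :=
  ∀ c : τ →₀ ℕ, coeff c p ≠ 0 → Finsupp.weight w c + u = v

section IsDegZero

variable {k : Type*} [CommRing k] {τ : Type} {w : τ → ℕ} {u v : ℕ}

lemma isDegZero_zero : IsDegZero w u v (0 : MvPolynomial τ k) := by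
  intro c hc
  simp at hc

lemma IsDegZero.add {p q : MvPolynomial τ k} (hp : IsDegZero w u v p)
    (hq : IsDegZero w u v q) : IsDegZero w u v (p + q) := by
  intro c hc
  by_cases h : coeff c p = 0
  · refine hq c fun h' => hc ?_
    rw [coeff_add, h, h', add_zero]
  · exact hp c h

lemma IsDegZero.neg {p : MvPolynomial τ k} (hp : IsDegZero w u v p) :
    IsDegZero w u v (-p) := by
  intro c hc
  exact hp c fun h => hc (by rw [coeff_neg, h, neg_zero])

lemma IsDegZero.sum {α : Type*} {s : Finset α} {f : α → MvPolynomial τ k}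
    (h : ∀ x ∈ s, IsDegZero w u v (f x)) : IsDegZero w u v (∑ x ∈ s, f x) := by
  classical
  induction s using Finset.induction_on with
  | empty => simpa using isDegZero_zero
  | insert x s hx ih =>
    rw [Finset.sum_insert hx]
    exact (h x (by simp)).add (ih fun y hy => h y (by simp [hy]))

lemma IsDegZero.sign_mul {p : MvPolynomial τ k} (hp : IsDegZero w u v p) (e : ℕ) :
    IsDegZero w u v ((-1) ^ e * p) := by
  rcases neg_one_pow_eq_or (MvPolynomial τ k) e with h | h <;> rw [h]
  · simpa using hp
  · simpa using hp.neg

lemma IsDegZero.of_hom {p : MvPolynomial τ k} {e : ℕ} (hp : IsWeightedHomogeneous w p e)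
    (h : e + u = v) : IsDegZero w u v p := by
  intro c hc
  rw [hp hc, h]

lemma isDegZero_one : IsDegZero w u u (1 : MvPolynomial τ k) :=
  .of_hom (isWeightedHomogeneous_one k w) (by simp)

end IsDegZero

/-- A complex `⋯ → F₂ → F₁ → F₀` of finitely generated graded free modules over the polynomial
ring `R = k[X_t : t ∈ τ]`, graded by `deg X_t = w t`, with chosen homogeneous bases:
`F_s = ⨁_{i ∈ ι s} R(-deg s i)`, and `d s` is the matrix of the boundary map
`F_{s+1} → F_s`, which is homogeneous of degree `0`. -/
structure GrComplex (k : Type*) [Field k] {τ : Type} (w : τ → ℕ) where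
  ι : ℕ → Type
  fin : ∀ s, Fintype (ι s)
  dec : ∀ s, DecidableEq (ι s)
  deg : ∀ s, ι s → ℕ
  d : ∀ s, Matrix (ι s) (ι (s + 1)) (MvPolynomial τ k)
  homog : ∀ s i j, IsDegZero w (deg s i) (deg (s + 1) j) (d s i j)
  d_mul_d : ∀ s, d s * d (s + 1) = 0

attribute [instance] GrComplex.fin GrComplex.dec

namespace GrComplex

variable {k : Type*} [Field k] {τ : Type} {w : τ → ℕ}

/-- The multiset of the degrees `e` of the summands `R(-e)` of `F_s`. -/
def degrees (F : GrComplex k w) (s : ℕ) : Multiset ℕ :=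
  (Finset.univ : Finset (F.ι s)).val.map (F.deg s)

/-- The shifted complex `F(-e)`. -/
def shift (F : GrComplex k w) (e : ℕ) : GrComplex k w where
  ι := F.ι
  fin := F.fin
  dec := F.dec
  deg s i := F.deg s i + e
  d := F.d
  homog s i j c hc := by rw [← F.homog s i j c hc, add_assoc]
  d_mul_d := F.d_mul_d

/-- A map of graded complexes (homogeneous of degree `0`). -/
structure Hom (F G : GrComplex k w) where
  f : ∀ s, Matrix (G.ι s) (F.ι s) (MvPolynomial τ k)
  homog : ∀ s i j, IsDegZero w (G.deg s i) (F.deg s j) (f s i j)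
  comm : ∀ s, f s * F.d s = G.d s * f (s + 1)

/-- The identity map. -/
def Hom.id (F : GrComplex k w) : Hom F F where
  f _ := 1
  homog s i j := by
    by_cases h : i = j
    · subst h
      simpa using isDegZero_one
    · rw [Matrix.one_apply_ne h]
      exact isDegZero_zero
  comm s := by simp

/-- Isomorphisms of graded complexes. -/
structure Iso (F G : GrComplex k w) where
  hom : Hom F G
  inv : Hom G F
  hom_inv : ∀ s, hom.f s * inv.f s = 1
  inv_hom : ∀ s, inv.f s * hom.f s = 1

/-- The direct sum of two graded complexes. -/
def directSum (F G : GrComplex k w) : GrComplex k w where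
  ι s := F.ι s ⊕ G.ι s
  fin s := inferInstance
  dec s := inferInstance
  deg s := Sum.elim (F.deg s) (G.deg s)
  d s := Matrix.fromBlocks (F.d s) 0 0 (G.d s)
  homog s i j := by
    rcases i with i | i <;> rcases j with j | j
    · exact F.homog s i j
    · exact isDegZero_zero
    · exact isDegZero_zero
    · exact G.homog s i j
  d_mul_d s := by
    simp [Matrix.fromBlocks_multiply, F.d_mul_d, G.d_mul_d]

section Cone

variable {F G : GrComplex k w} (μ : Hom F G)

/-- Basis of the `s`-th module `G_s ⊕ F_{s-1}` of the cone (with `F_{-1} = 0`). -/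
def coneι (F G : GrComplex k w) : ℕ → Type
  | 0 => G.ι 0
  | s + 1 => G.ι (s + 1) ⊕ F.ι s

instance coneFintype (F G : GrComplex k w) : ∀ s, Fintype (coneι F G s)
  | 0 => G.fin 0
  | s + 1 => inferInstanceAs (Fintype (G.ι (s + 1) ⊕ F.ι s))

instance coneDecEq (F G : GrComplex k w) : ∀ s, DecidableEq (coneι F G s)
  | 0 => G.dec 0
  | s + 1 => inferInstanceAs (DecidableEq (G.ι (s + 1) ⊕ F.ι s))

def coneDeg (F G : GrComplex k w) : ∀ s, coneι F G s → ℕ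
  | 0 => G.deg 0
  | s + 1 => Sum.elim (G.deg (s + 1)) (F.deg s)

/-- The boundary map `G_{s+1} ⊕ F_s → G_s ⊕ F_{s-1}` of the cone, with block matrix
`[∂_G, (-1)^{s+1} μ_s; 0, ∂_F]`. -/
def coneD : ∀ s, Matrix (coneι F G s) (coneι F G (s + 1)) (MvPolynomial τ k)
  | 0 => Matrix.fromCols (G.d 0) (-(μ.f 0))
  | s + 1 => Matrix.fromBlocks (G.d (s + 1)) ((-1 : MvPolynomial τ k) ^ (s + 2) • μ.f (s + 1))
      0 (F.d s)

/-- The mapping cone of a map of graded complexes. -/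
def cone : GrComplex k w where
  ι := coneι F G
  fin := coneFintype F G
  dec := coneDecEq F G
  deg := coneDeg F G
  d := coneD μ
  homog s i j := by
    cases s with
    | zero =>
      rcases j with j | j
      · exact G.homog 0 i j
      · exact (μ.homog 0 i j).neg
    | succ s =>
      rcases i with i | i <;> rcases j with j | j
      · exact G.homog (s + 1) i j
      · exact (μ.homog (s + 1) i j).sign_mul (s + 2)
      · exact isDegZero_zero
      · exact F.homog s i j
  d_mul_d s := by
    cases s with
    | zero =>
      change Matrix.fromCols (G.d 0) (-(μ.f 0)) * Matrix.fromBlocks (G.d 1)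
        ((-1 : MvPolynomial τ k) ^ 2 • μ.f 1) 0 (F.d 0) = 0
      rw [Matrix.fromCols_mul_fromBlocks]
      simp [G.d_mul_d, μ.comm]
    | succ s =>
      change Matrix.fromBlocks (G.d (s + 1)) ((-1 : MvPolynomial τ k) ^ (s + 2) • μ.f (s + 1))
        0 (F.d s) * Matrix.fromBlocks (G.d (s + 2))
        ((-1 : MvPolynomial τ k) ^ (s + 3) • μ.f (s + 2)) 0 (F.d (s + 1)) = 0
      rw [Matrix.fromBlocks_multiply]
      simp [G.d_mul_d, F.d_mul_d, μ.comm, pow_succ]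

end Cone

/-- A graded complex is minimal if its boundary maps have image in `𝔪 F`, where
`𝔪 = (X_t : t ∈ τ)`. -/
def IsMinimal (F : GrComplex k w) : Prop :=
  ∀ s i j, F.d s i j ∈ Ideal.span (Set.range (X : τ → MvPolynomial τ k))

/-- `F` is a graded free resolution of `R/I`, where `R = k[X_t : t ∈ τ]`: `F₀ = R`, the image of
`F₁ → R` is `I`, and `F` is exact in positive homological degrees. -/
structure IsResolution (F : GrComplex k w) (I : Ideal (MvPolynomial τ k)) : Prop where
  zero : ∃ x : F.ι 0, (∀ y, y = x) ∧ F.deg 0 x = 0 ∧ Ideal.span (Set.range (F.d 0 x)) = I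
  exact : ∀ s (v : F.ι (s + 1) → MvPolynomial τ k), (F.d s).mulVec v = 0 →
    ∃ u : F.ι (s + 2) → MvPolynomial τ k, (F.d (s + 1)).mulVec u = v

/-- `F` is a minimal graded free resolution of `R/I`. -/
def IsMinimalResolution (F : GrComplex k w) (I : Ideal (MvPolynomial τ k)) : Prop :=
  F.IsResolution I ∧ F.IsMinimal

/-- `M` is the minimized mapping cone of `μ`: it is minimal and is obtained from the cone of `μ` by
splitting off trivial summands `0 → R(-e) → R(-e) → 0` with identity map. A direct sum of such
trivial complexes is the cone of the identity of a complex `Z` with zero boundary maps. -/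
def IsMinCone {F G : GrComplex k w} (μ : Hom F G) (M : GrComplex k w) : Prop :=
  M.IsMinimal ∧ ∃ Z : GrComplex k w, (∀ s, Z.d s = 0) ∧
    Nonempty (Iso (cone μ) (directSum M (cone (Hom.id Z))))

/-- `μ : F → G` is induced by multiplication by `z` on `F₀ = R`, `G₀ = R`. -/
def Hom.IsInducedBy {F G : GrComplex k w} (μ : Hom F G) (z : MvPolynomial τ k) : Prop :=
  ∀ i j, μ.f 0 i j = z

end GrComplex

/-! ### Contractions on exterior powers -/

section Contraction

variable {A : Type*} [CommRing A] {n : ℕ}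

/-- Matrix entry at `(e_T, e_S)` of the contraction `⋀ Aⁿ → ⋀ Aⁿ` by `f`,
`e_S ↦ ∑_{j ∈ S} ± f_j e_{S ∖ j}`, with sign `(-1)^{#{i ∈ S, i < j}}`. -/
def contr (f : Fin n → A) (T S : Finset (Fin n)) : A :=
  ∑ j ∈ S, if T = S.erase j then (-1) ^ (S.filter (· < j)).card * f j else 0

lemma contr_add (f g : Fin n → A) (T S : Finset (Fin n)) :
    contr (fun j => f j + g j) T S = contr f T S + contr g T S := by
  unfold contr
  rw [← Finset.sum_add_distrib]
  refine Finset.sum_congr rfl fun j _ => ?_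
  split_ifs <;> ring

lemma contr_card {f : Fin n → A} {T S : Finset (Fin n)} (h : T.card + 1 ≠ S.card) :
    contr f T S = 0 := by
  unfold contr
  refine Finset.sum_eq_zero fun j hj => if_neg ?_
  rintro rfl
  exact h (Finset.card_erase_add_one hj)

lemma card_filter_erase {S : Finset (Fin n)} {i j : Fin n} (hi : i ∈ S) :
    (if i < j then 1 else 0) + ((S.erase i).filter (· < j)).card
      = (S.filter (· < j)).card := by
  rw [Finset.filter_erase]
  split_ifs with h
  · rw [add_comm]
    exact Finset.card_erase_add_one (by simp [hi, h])
  · rw [Finset.erase_eq_of_notMem (by simp [h]), zero_add]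

lemma contr_sq (f : Fin n → A) (U S : Finset (Fin n)) :
    ∑ T, contr f U T * contr f T S = 0 := by
  have h1 : ∀ T, contr f U T * contr f T S = ∑ j ∈ S, if T = S.erase j then
      contr f U (S.erase j) * ((-1) ^ (S.filter (· < j)).card * f j) else 0 := by
    intro T
    conv_lhs => rw [contr.eq_1 f T S, Finset.mul_sum]
    refine Finset.sum_congr rfl fun j _ => ?_
    split_ifs with h
    · rw [h]
    · simp
  simp only [h1]
  rw [Finset.sum_comm]
  simp only [Finset.sum_ite_eq', Finset.mem_univ, if_true, contr, Finset.sum_mul]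
  rw [Finset.sum_sigma']
  refine Finset.sum_involution (fun p _ => ⟨p.2, p.1⟩) ?_ ?_ ?_ ?_
  · rintro ⟨j, i⟩ h
    simp only [Finset.mem_sigma, Finset.mem_erase] at h
    obtain ⟨hj, hij, hi⟩ := h
    simp only
    rw [Finset.erase_right_comm (a := j)]
    by_cases hU : U = (S.erase i).erase j
    · rw [if_pos hU, if_pos hU]
      have a1 := card_filter_erase (j := i) hj
      have a2 := card_filter_erase (j := j) hi
      rcases lt_or_gt_of_ne hij with h | h
      · rw [if_neg (not_lt.2 h.le)] at a1
        rw [if_pos h] at a2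
        rw [← a1, ← a2]
        ring
      · rw [if_neg (not_lt.2 h.le)] at a2
        rw [if_pos h] at a1
        rw [← a1, ← a2]
        ring
    · rw [if_neg hU, if_neg hU]
      ring
  · rintro ⟨j, i⟩ h _ h'
    simp only [Finset.mem_sigma, Finset.mem_erase] at h
    simp only [Sigma.mk.injEq, heq_eq_eq] at h'
    exact h.2.1 h'.1
  · rintro ⟨j, i⟩ h
    simp only [Finset.mem_sigma, Finset.mem_erase] at h ⊢
    exact ⟨h.2.2, fun e => h.2.1 e.symm, h.1⟩
  · rintro ⟨j, i⟩ h
    rfl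

lemma contr_anticomm (f g : Fin n → A) (U S : Finset (Fin n)) :
    ∑ T, contr f U T * contr g T S + ∑ T, contr g U T * contr f T S = 0 := by
  have h := contr_sq (fun j => f j + g j) U S
  simp only [contr_add, add_mul, mul_add, Finset.sum_add_distrib, contr_sq] at h
  simpa [add_comm] using h

/-- Restriction of the sum over all `T` to the `T` of the right cardinality. -/
lemma sum_contr_subtype (f g : Fin n → A) (U S : Finset (Fin n)) (c : ℕ)
    (hS : S.card = c + 1) :
    ∑ T : {T : Finset (Fin n) // T.card = c}, contr f U T * contr g T S
      = ∑ T, contr f U T * contr g T S := by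
  rw [← Finset.sum_subtype (Finset.univ.filter fun T : Finset (Fin n) => T.card = c)
    (by simp) (fun T => contr f U T * contr g T S)]
  refine Finset.sum_subset (Finset.subset_univ _) fun T _ hT => ?_
  rw [contr_card (f := g), mul_zero]
  rw [hS]
  intro h
  exact hT (by simpa using h)

lemma contr_contr_pair (f g : Fin n → A) (S : Finset (Fin n)) (hS : S.card = 2) :
    ∑ T, contr f ∅ T * contr g T S
      = ∑ i ∈ S, ∑ j ∈ S, if i < j then g i * f j - g j * f i else 0 := by
  obtain ⟨i, j, hij, rfl⟩ : ∃ i j : Fin n, i < j ∧ S = {i, j} := by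
    obtain ⟨i, j, hne, rfl⟩ := Finset.card_eq_two.1 hS
    rcases lt_or_gt_of_ne hne with h | h
    · exact ⟨i, j, h, rfl⟩
    · exact ⟨j, i, h, Finset.pair_comm i j⟩
  have hne := hij.ne
  have h1 : ∀ x : Fin n, contr f ∅ {x} = f x := by
    intro x
    simp [contr, Finset.filter_singleton]
  have e1 : ({i, j} : Finset (Fin n)).erase i = {j} := by
    ext x; simp; grind
  have e2 : ({i, j} : Finset (Fin n)).erase j = {i} := by
    ext x; simp; grind
  have c1 : (({i, j} : Finset (Fin n)).filter (· < i)).card = 0 := by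
    rw [Finset.card_eq_zero, Finset.filter_eq_empty_iff]
    intro x hx; simp at hx; grind
  have c2 : (({i, j} : Finset (Fin n)).filter (· < j)).card = 1 := by
    rw [Finset.card_eq_one]
    refine ⟨i, ?_⟩
    ext x; simp; grind
  have h2 : ∀ T, contr g T {i, j} = (if T = {j} then g i else 0)
      + (if T = {i} then - g j else 0) := by
    intro T
    rw [contr, Finset.sum_pair hne, e1, e2, c1, c2]
    simp
  simp only [h2, mul_add, Finset.sum_add_distrib, mul_ite, mul_zero, Finset.sum_ite_eq',
    Finset.mem_univ, if_true, h1]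
  rw [Finset.sum_pair hne, Finset.sum_pair hne, Finset.sum_pair hne]
  simp [hij, not_lt.2 hij.le]
  ring

end Contraction

lemma minor_contr {A : Type*} [CommRing A] {n : ℕ} (f g h : Fin n → A) (hh : h = f ∨ h = g)
    (S : Finset (Fin n)) (hS : S.card = 3) :
    ∑ T : {T : Finset (Fin n) // T.card = 2},
      (∑ i ∈ T.1, ∑ j ∈ T.1, if i < j then g i * f j - g j * f i else 0) * contr h T.1 S = 0 := by
  have h1 : ∀ T : {T : Finset (Fin n) // T.card = 2},
      (∑ i ∈ T.1, ∑ j ∈ T.1, if i < j then g i * f j - g j * f i else 0) * contr h T.1 S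
        = ∑ V, contr f ∅ V * (contr g V T.1 * contr h T.1 S) := by
    intro T
    rw [← contr_contr_pair f g T.1 T.2, Finset.sum_mul]
    exact Finset.sum_congr rfl fun V _ => mul_assoc _ _ _
  simp only [h1]
  rw [Finset.sum_comm]
  simp only [← Finset.mul_sum]
  simp only [sum_contr_subtype g h _ S 2 hS]
  rcases hh with rfl | rfl
  · have h2 : ∀ V, ∑ T, contr g V T * contr h T S = - ∑ T, contr h V T * contr g T S :=
      fun V => eq_neg_of_add_eq_zero_left (contr_anticomm _ _ _ _)
    simp only [h2, mul_neg, Finset.sum_neg_distrib, Finset.mul_sum]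
    rw [Finset.sum_comm]
    simp only [← mul_assoc, ← Finset.sum_mul, contr_sq]
    simp
  · simp [contr_sq]

lemma enD_sum_zero {A : Type*} [CommRing A] {n : ℕ} (x y : Fin n → A) (S : Finset (Fin n))
    (hS : S.card = 3) (q : Fin 2) :
    ∑ c : {S : Finset (Fin n) // S.card = 2} × Fin 1,
      (∑ i ∈ c.1.1, ∑ j ∈ c.1.1, if i < j then x i * y j - x j * y i else 0) *
        ((if (c.2 : ℕ) = q then contr x c.1.1 S else 0) +
          (if (c.2 : ℕ) + 1 = q then contr y c.1.1 S else 0)) = 0 := by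
  have hx := minor_contr y x x (.inr rfl) S hS
  have hy := minor_contr y x y (.inl rfl) S hS
  rw [Fintype.sum_prod_type]
  simp only [Finset.univ_unique, Finset.sum_singleton, mul_add, Finset.sum_add_distrib]
  split_ifs <;> simp only [hx, hy, mul_zero, Finset.sum_const_zero, add_zero]

lemma enD_sum_succ {A : Type*} [CommRing A] {n : ℕ} (x y : Fin n → A) (s : ℕ)
    (U S : Finset (Fin n)) (hS : S.card = s + 4) (p : Fin (s + 1)) (q : Fin (s + 3)) :
    ∑ c : {S : Finset (Fin n) // S.card = s + 3} × Fin (s + 2),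
      ((if (p : ℕ) = c.2 then contr x U c.1.1 else 0) +
          (if (p : ℕ) + 1 = c.2 then contr y U c.1.1 else 0)) *
        ((if (c.2 : ℕ) = q then contr x c.1.1 S else 0) +
          (if (c.2 : ℕ) + 1 = q then contr y c.1.1 S else 0)) = 0 := by
  have hr : ∀ (u v : A) (f : Fin (s + 2) → A), ∑ r : Fin (s + 2),
      ((if (p : ℕ) = r then u else 0) + (if (p : ℕ) + 1 = r then v else 0)) * f r
        = u * f p.castSucc + v * f p.succ := by
    intro u v f
    have e1 : ∀ r : Fin (s + 2), ((p : ℕ) = r) ↔ (p.castSucc = r) := by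
      intro r; simp [Fin.ext_iff]
    have e2 : ∀ r : Fin (s + 2), ((p : ℕ) + 1 = r) ↔ (p.succ = r) := by
      intro r; simp [Fin.ext_iff]
    simp only [e1, e2, add_mul, ite_mul, zero_mul, Finset.sum_add_distrib,
      Finset.sum_ite_eq, Finset.mem_univ, if_true]
  have hC := fun f g : Fin n → A => sum_contr_subtype f g U S (s + 3) hS
  have hA := contr_anticomm x y U S
  rw [Fintype.sum_prod_type]
  rw [Finset.sum_congr rfl fun T _ => hr (contr x U T.1) (contr y U T.1) fun r =>
    (if (r : ℕ) = q then contr x T.1 S else 0) + (if (r : ℕ) + 1 = q then contr y T.1 S else 0)]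
  simp only [mul_add, mul_ite, mul_zero, Finset.sum_add_distrib, Fin.val_castSucc, Fin.val_succ]
  by_cases h0 : (p : ℕ) = q
  · have h1 : ¬ (p : ℕ) + 1 = q := by omega
    have h2 : ¬ (p : ℕ) + 1 + 1 = q := by omega
    simp only [if_pos h0, if_neg h1, if_neg h2, hC, contr_sq, Finset.sum_const_zero, add_zero]
  · by_cases h1 : (p : ℕ) + 1 = q
    · have h2 : ¬ (p : ℕ) + 1 + 1 = q := by omega
      simp only [if_neg h0, if_pos h1, if_neg h2, hC, Finset.sum_const_zero, zero_add, add_zero]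
      exact hA
    · by_cases h2 : (p : ℕ) + 1 + 1 = q
      · simp only [if_neg h0, if_neg h1, if_pos h2, hC, contr_sq, Finset.sum_const_zero, add_zero]
      · simp only [if_neg h0, if_neg h1, if_neg h2, Finset.sum_const_zero, add_zero]

lemma contr_isDegZero {k : Type*} [CommRing k] {τ : Type} {w : τ → ℕ} {n : ℕ}
    (f : Fin n → MvPolynomial τ k) (T S : Finset (Fin n)) (u v : ℕ)
    (h : ∀ j ∈ S, T = S.erase j → IsDegZero w u v (f j)) :
    IsDegZero w u v (contr f T S) := by
  unfold contr
  refine IsDegZero.sum fun j hj => ?_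
  split_ifs with hT
  · exact (h j hj hT).sign_mul _
  · exact isDegZero_zero

/-! ### The Koszul complex of `X_0, …, X_{n-1}` -/

/-- The Koszul complex `K` of `X_0, …, X_{n-1}` over `k[X_0, …, X_n]`, where `deg X_j = w j`:
`K_s = ⋀^s Rⁿ` with basis `e_S`, `|S| = s`, and `e_S ↦ ∑_{j ∈ S} ± X_j e_{S ∖ j}`. -/
def koszul (k : Type*) [Field k] {n : ℕ} (w : Fin (n + 1) → ℕ) : GrComplex k w where
  ι s := {S : Finset (Fin n) // S.card = s}
  fin s := inferInstance
  dec s := inferInstance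
  deg s S := ∑ j ∈ S.1, w j.castSucc
  d s := Matrix.of fun T S => contr (fun j => X j.castSucc) T.1 S.1
  homog s T S := by
    refine contr_isDegZero _ _ _ _ _ fun j hj hT => ?_
    refine .of_hom (isWeightedHomogeneous_X k w j.castSucc) ?_
    rw [hT]
    exact Finset.add_sum_erase _ (fun j : Fin n => w j.castSucc) hj
  d_mul_d s := by
    refine Matrix.ext fun T S => ?_
    rw [Matrix.mul_apply, Matrix.zero_apply]
    exact (sum_contr_subtype _ _ T.1 S.1 (s + 1) S.2).trans (contr_sq _ _ _)

/-! ### The Eagon–Northcott complex -/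

/-- The arithmetic sequence `m_i = m₀ + i d`, `0 ≤ i ≤ n`. -/
def arithSeq (n m₀ d : ℕ) (i : Fin (n + 1)) : ℕ := m₀ + i * d

/-- Basis of the Eagon–Northcott complex of a `2 × n` matrix: `E₀ = R`, and for `s ≥ 1` the
module `E_s = ⋀^{s+1} F ⊗ D_{s-1} G` has basis `e_S ⊗ g₁^{(s-1-q)} g₂^{(q)}` with
`|S| = s + 1` and `0 ≤ q ≤ s - 1`. -/
def enι (n : ℕ) : ℕ → Type
  | 0 => Unit
  | s + 1 => {S : Finset (Fin n) // S.card = s + 2} × Fin (s + 1)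

instance enFintype (n : ℕ) : ∀ s, Fintype (enι n s)
  | 0 => inferInstanceAs (Fintype Unit)
  | s + 1 => inferInstanceAs (Fintype ({S : Finset (Fin n) // S.card = s + 2} × Fin (s + 1)))

instance enDecEq (n : ℕ) : ∀ s, DecidableEq (enι n s)
  | 0 => inferInstanceAs (DecidableEq Unit)
  | s + 1 =>
    inferInstanceAs (DecidableEq ({S : Finset (Fin n) // S.card = s + 2} × Fin (s + 1)))

/-- Degrees of the basis elements: `e_j` has degree `m_j`, `g₁` has degree `0`, `g₂` has degree
`d`, and everything in positive homological degree is shifted by `d`. -/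
def enDeg (n m₀ d : ℕ) : ∀ s, enι n s → ℕ
  | 0 => fun _ => 0
  | _ + 1 => fun b => ∑ j ∈ b.1.1, arithSeq n m₀ d j.castSucc + (b.2 + 1) * d

/-- Boundary maps of the Eagon–Northcott complex of the matrix
`A = [X_0 ⋯ X_{n-1}; X_1 ⋯ X_n]`. The map `E₁ → E₀` sends `e_{i,j}`, `i < j`, to the minor
`X_i X_{j+1} - X_j X_{i+1}`, and for `s ≥ 1` the map `E_{s+1} → E_s` sends
`e_S ⊗ g₁^{(p)} g₂^{(q)}` to
`∑_{j ∈ S} ± e_{S ∖ j} ⊗ (X_j g₁^{(p-1)} g₂^{(q)} + X_{j+1} g₁^{(p)} g₂^{(q-1)})`. -/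
def enD (k : Type*) [Field k] (n : ℕ) :
    ∀ s, Matrix (enι n s) (enι n (s + 1)) (MvPolynomial (Fin (n + 1)) k)
  | 0 => Matrix.of fun _ b => ∑ i ∈ b.1.1, ∑ j ∈ b.1.1,
      if i < j then X i.castSucc * X j.succ - X j.castSucc * X i.succ else 0
  | _ + 1 => Matrix.of fun c b =>
      (if (c.2 : ℕ) = b.2 then contr (fun j => X j.castSucc) c.1.1 b.1.1 else 0) +
      (if (c.2 : ℕ) + 1 = b.2 then contr (fun j => X j.succ) c.1.1 b.1.1 else 0)

/-- The Eagon–Northcott complex of `A = [X_0 ⋯ X_{n-1}; X_1 ⋯ X_n]`, graded by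
`deg X_i = m₀ + i d`. -/
def eagonNorthcott (k : Type*) [Field k] (n m₀ d : ℕ) : GrComplex k (arithSeq n m₀ d) where
  ι := enι n
  fin := enFintype n
  dec := enDecEq n
  deg := enDeg n m₀ d
  d := enD k n
  homog s c b := by
    cases s with
    | zero =>
      obtain ⟨⟨S, hS⟩, q⟩ := b
      have hq : (q : ℕ) = 0 := Nat.lt_one_iff.1 q.2
      refine IsDegZero.sum fun i hi => IsDegZero.sum fun j hj => ?_
      split_ifs with hij
      · have hS' : S = {i, j} := by
          refine (Finset.eq_of_subset_of_card_le ?_ ?_).symm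
          · intro x hx
            simp only [Finset.mem_insert, Finset.mem_singleton] at hx
            rcases hx with rfl | rfl <;> assumption
          · rw [hS, Finset.card_pair hij.ne]
        have hd : enDeg n m₀ d (0 + 1) (⟨⟨S, hS⟩, q⟩ : enι n (0 + 1))
            = m₀ + i * d + (m₀ + j * d) + d := by
          simp only [enDeg, hq, arithSeq]
          rw [hS', Finset.sum_pair hij.ne]
          simp
        rw [sub_eq_add_neg]
        refine IsDegZero.add (.of_hom (IsWeightedHomogeneous.mul
          (isWeightedHomogeneous_X k _ _) (isWeightedHomogeneous_X k _ _)) ?_)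
          (IsDegZero.neg (.of_hom (IsWeightedHomogeneous.mul
          (isWeightedHomogeneous_X k _ _) (isWeightedHomogeneous_X k _ _)) ?_))
        · rw [hd]
          simp [enDeg, arithSeq]
          ring
        · rw [hd]
          simp [enDeg, arithSeq]
          ring
      · exact isDegZero_zero
    | succ s =>
      obtain ⟨⟨S, hS⟩, q⟩ := b
      obtain ⟨⟨T, hT⟩, p⟩ := c
      refine IsDegZero.add ?_ ?_
      · split_ifs with h
        · refine contr_isDegZero _ _ _ _ _ fun j hj hTj => ?_
          refine .of_hom (isWeightedHomogeneous_X k _ _) ?_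
          simp only at hTj h
          simp only [enDeg, h, hTj]
          have e := Finset.add_sum_erase S (fun j : Fin n => arithSeq n m₀ d j.castSucc) hj
          rw [← e]
          exact (add_assoc _ _ _).symm
        · exact isDegZero_zero
      · split_ifs with h
        · refine contr_isDegZero _ _ _ _ _ fun j hj hTj => ?_
          refine .of_hom (isWeightedHomogeneous_X k _ _) ?_
          simp only at hTj h
          simp only [enDeg, ← h, hTj]
          rw [← Finset.add_sum_erase _ (fun j : Fin n => arithSeq n m₀ d j.castSucc) hj]
          simp [arithSeq]
          ring
        · exact isDegZero_zero
  d_mul_d s := by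
    cases s with
    | zero =>
      refine Matrix.ext fun c b => ?_
      rw [Matrix.mul_apply, Matrix.zero_apply]
      exact enD_sum_zero (fun j => X j.castSucc) (fun j => X j.succ) b.1.1 b.1.2 b.2
    | succ s =>
      refine Matrix.ext fun c b => ?_
      rw [Matrix.mul_apply, Matrix.zero_apply]
      exact enD_sum_succ (fun j => X j.castSucc) (fun j => X j.succ) s c.1.1 b.1.1 b.1.2 c.2 b.2

/-! ### The ideals -/

/-- The variable `X_j` for a natural number `j ≤ n`. -/
def xvar (k : Type*) [Field k] (n j : ℕ) : MvPolynomial (Fin (n + 1)) k := X (Fin.ofNat (n + 1) j)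

/-- The defining ideal of the rational normal curve of degree `n` in `ℙⁿ`: the kernel of
`k[X_0, …, X_n] → k[s, t]`, `X_i ↦ s^{n-i} t^i`. -/
def rncIdeal (k : Type*) [Field k] (n : ℕ) : Ideal (MvPolynomial (Fin (n + 1)) k) :=
  RingHom.ker (aeval (R := k) (fun i : Fin (n + 1) =>
    (X 0 ^ (n - (i : ℕ)) * X 1 ^ (i : ℕ) : MvPolynomial (Fin 2) k)))

/-- `Δ_i = X_n^a X_i - X_0^{a+d} X_{i-b}`, for `b ≤ i ≤ n`. -/
def Delta (k : Type*) [Field k] (n a b d i : ℕ) : MvPolynomial (Fin (n + 1)) k :=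
  xvar k n n ^ a * xvar k n i - xvar k n 0 ^ (a + d) * xvar k n (i - b)

/-- `I_i = J + (Δ_b, …, Δ_i)`. -/
def idealI (k : Type*) [Field k] (n a b d i : ℕ) : Ideal (MvPolynomial (Fin (n + 1)) k) :=
  rncIdeal k n ⊔ Ideal.span (Delta k n a b d '' Set.Icc b i)

/-- A ring is Cohen–Macaulay if it is Noetherian and each localization at a maximal ideal has a
regular sequence in its maximal ideal whose length is its Krull dimension. -/
def IsCohenMacaulay (A : Type*) [CommRing A] : Prop :=
  IsNoetherianRing A ∧ ∀ (p : Ideal A) [p.IsMaximal],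
    ∃ rs : List (Localization.AtPrime p),
      (∀ r ∈ rs, r ∈ IsLocalRing.maximalIdeal (Localization.AtPrime p)) ∧
      RingTheory.Sequence.IsRegular (Localization.AtPrime p) rs ∧
      (rs.length : WithBot ℕ∞) = ringKrullDim (Localization.AtPrime p)

/-! ### Degrees of the free modules -/

/-- `σ(m, t)`: the multiset of all sums of `t` distinct nonnegative integers smaller than `m`. -/
def sigma (m t : ℕ) : Multiset ℕ :=
  ((Finset.range m).powersetCard t).val.map fun S => ∑ r ∈ S, r

/-- The degrees in `E_s = ⨁_{k=1}^{s} ⨁_{r ∈ σ(n, s+1)} R(-((s+1) m₀ + k d + r d))`, `s ≥ 1`. -/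
def degE (n m₀ d s : ℕ) : Multiset ℕ :=
  ∑ k ∈ Finset.Icc 1 s, (sigma n (s + 1)).map fun r => (s + 1) * m₀ + k * d + r * d

/-- The degrees in `L(s, k) = ⨁_{r ∈ σ(n, s)} R(-[m₀ (a+d+s+1) + k d + r d])`. -/
def degL (n m₀ a d s k : ℕ) : Multiset ℕ :=
  (sigma n s).map fun r => m₀ * (a + d + s + 1) + k * d + r * d

/-- `δ_i = m₀ (a+d+1) + (i-b) d`, for `i ≥ b`. -/
def delta (m₀ a b d i : ℕ) : ℕ := m₀ * (a + d + 1) + (i - b) * d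

end ArithCurve

end

/-! Under the parametrization X_i ↦ s^{n-i} t^i, whose kernel is J, the polynomial Δ_i becomes
s^{n-i} t^{i-b} h with one and the same h = t^{m₀} - s^{m₀+nd} (`rncMap_Delta`). Put c = i - b. Up
to the nonzero factor s^{n-i} h, the ideal I_i/J is therefore the R/J-submodule of k[s,t] generated
by the monomials of degree c. For c = 0 this is R/J, resolved by E. For c > 0 it is resolved by the
member with index c of the family of complexes to which the Eagon–Northcott and Buchsbaum–Rim
complexes belong (`enFamily`, `exists_famD_zero_eq`).

Hence R/I_i is resolved by the cone of a map from that complex, shifted by δ_b, to E. For c > 0 the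
map sends the generators to ±Δ_j, that is, to X_n^a times a row of variables minus X_0^{a+d} times
another such row. Lifting the two rows separately and combining the lifts keeps the coefficients
X_n^a and X_0^{a+d} in all entries, so the cone is already minimal and its degrees can be read off
(`exists_isMinimalResolution_of_lt`; for c = 0, `isMinimalResolution_cone_scalarHom`). These cones
are the M_i.

The description by minimized cones then needs no bookkeeping of cancellations. Since I_{i-1} : Δ_i =
(X_0, …, X_{n-1}), the cone of every lift K(-δ_i) → M_{i-1} of Δ_i resolves R/I_i
(`isResolution_cone_of_isInducedBy`), and every graded resolution is the minimal one plus a trivial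
complex (`IsResolution.exists_splitting`).

Exactness of all these complexes rests on two properties of the contractions by the rows x and y,
collected in `ExactPair`: contraction by x is exact in positive degrees, and in degrees at least two
the kernel of the composite of both is the sum of their images. The second is proved by induction on
the number of columns (`exists_contrMap_add_eq`); the obstruction in degree one vanishes because the
minors of the first m columns generate the kernel of a parametrization
(`mem_minorIdeal_of_curveMap_eq_zero`).

For the Cohen–Macaulay property, I_i is the preimage of the principal ideal (s^{n-i} h)
(`mem_idealI_of_dvd`). So nonzero polynomials in X_n are nonzerodivisors modulo I_i, and every
maximal ideal contains one. Primes over I_i strictly contain the prime J of height at least n - 1,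
so R/I_i has dimension one. -/

section

open MvPolynomial

namespace ArithCurve

/-! ### Homogeneous matrices: graded solutions of linear systems, and inverses. -/

section DegPart

variable {k : Type*} [CommRing k] {τ : Type} {w : τ → ℕ} {u v e : ℕ}

lemma IsDegZero.mul {p q : MvPolynomial τ k} (hp : IsDegZero w u v p) (hq : IsDegZero w v e q) :
    IsDegZero w u e (p * q) := by
  classical
  intro c hc
  rw [coeff_mul] at hc
  obtain ⟨x, hx, hne⟩ := Finset.exists_ne_zero_of_sum_ne_zero hc
  have h1 := hp x.1 (left_ne_zero_of_mul hne)
  have h2 := hq x.2 (right_ne_zero_of_mul hne)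
  rw [← Finset.HasAntidiagonal.mem_antidiagonal.1 hx, map_add]
  omega

lemma IsDegZero.sub {p q : MvPolynomial τ k} (hp : IsDegZero w u v p) (hq : IsDegZero w u v q) :
    IsDegZero w u v (p - q) := by
  rw [sub_eq_add_neg]
  exact hp.add hq.neg

/-- The part of `p` that is a degree-preserving map `R(-v) → R(-u)`. -/
noncomputable def degPart (w : τ → ℕ) (u v : ℕ) (p : MvPolynomial τ k) : MvPolynomial τ k :=
  -- The guard is needed because `v - u` is truncated: for `v < u` the component of degree 0 would
  -- survive.
  if u ≤ v then weightedHomogeneousComponent w (v - u) p else 0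

lemma coeff_degPart (p : MvPolynomial τ k) (c : τ →₀ ℕ) :
    coeff c (degPart w u v p) = if Finsupp.weight w c + u = v then coeff c p else 0 := by
  unfold degPart
  split_ifs with h1 h2 h2
  · rw [coeff_weightedHomogeneousComponent, if_pos (by omega)]
  · rw [coeff_weightedHomogeneousComponent, if_neg (by omega)]
  · omega
  · simp

lemma isDegZero_degPart (p : MvPolynomial τ k) : IsDegZero w u v (degPart w u v p) := by
  intro c hc
  by_contra h
  exact hc (by rw [coeff_degPart, if_neg h])

lemma IsDegZero.degPart_eq {p : MvPolynomial τ k} (hp : IsDegZero w u v p) :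
    degPart w u v p = p := by
  ext c
  rw [coeff_degPart]
  split_ifs with h
  · rfl
  · by_contra h'
    exact h (hp c (Ne.symm h'))

lemma degPart_sum {α : Type*} (s : Finset α) (f : α → MvPolynomial τ k) :
    degPart w u v (∑ x ∈ s, f x) = ∑ x ∈ s, degPart w u v (f x) := by
  ext c
  rw [coeff_degPart, coeff_sum, coeff_sum]
  simp only [coeff_degPart]
  split_ifs <;> simp

/-- Multiplication by `p` shifts degrees by a fixed amount, hence commutes with taking graded
pieces. This turns an arbitrary solution of a graded linear system into a graded one. -/
lemma IsDegZero.degPart_mul {p : MvPolynomial τ k} (hp : IsDegZero w u v p)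
    (q : MvPolynomial τ k) : degPart w u e (p * q) = p * degPart w v e q := by
  classical
  ext c
  rw [coeff_degPart, coeff_mul, coeff_mul]
  simp only [coeff_degPart]
  have key : ∀ x ∈ Finset.HasAntidiagonal.antidiagonal c, coeff x.1 p ≠ 0 →
      (Finsupp.weight w c + u = e ↔ Finsupp.weight w x.2 + v = e) := by
    intro x hx hne
    have h1 := hp x.1 hne
    rw [← Finset.HasAntidiagonal.mem_antidiagonal.1 hx, map_add]
    omega
  split_ifs with h
  · refine Finset.sum_congr rfl fun x hx => ?_
    by_cases hne : coeff x.1 p = 0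
    · simp [hne]
    · rw [if_pos ((key x hx hne).1 h)]
  · refine (Finset.sum_eq_zero fun x hx => ?_).symm
    by_cases hne : coeff x.1 p = 0
    · simp [hne]
    · rw [if_neg fun h' => h ((key x hx hne).2 h'), mul_zero]

/-- A homogeneous vector in the image of a homogeneous matrix is the image of a homogeneous
vector. -/
lemma exists_homogeneous_mulVec {I J : Type*} [Fintype J] {A : Matrix I J (MvPolynomial τ k)}
    {u : I → ℕ} {v : J → ℕ} (hA : ∀ i j, IsDegZero w (u i) (v j) (A i j))
    {b : I → MvPolynomial τ k} (hb : ∀ i, IsDegZero w (u i) e (b i))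
    (h : ∃ z, A.mulVec z = b) :
    ∃ z, (∀ j, IsDegZero w (v j) e (z j)) ∧ A.mulVec z = b := by
  obtain ⟨z, rfl⟩ := h
  refine ⟨fun j => degPart w (v j) e (z j), fun j => isDegZero_degPart _, ?_⟩
  ext1 i
  rw [← (hb i).degPart_eq, Matrix.mulVec, dotProduct, Matrix.mulVec, dotProduct, degPart_sum]
  exact Finset.sum_congr rfl fun j _ => ((hA i j).degPart_mul _).symm

/-- The matrix version of `exists_homogeneous_mulVec`. -/
lemma exists_homogeneous_mul {I J L : Type*} [Fintype J] {A : Matrix I J (MvPolynomial τ k)}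
    {u : I → ℕ} {v : J → ℕ} {e : L → ℕ} (hA : ∀ i j, IsDegZero w (u i) (v j) (A i j))
    {B : Matrix I L (MvPolynomial τ k)} (hB : ∀ i l, IsDegZero w (u i) (e l) (B i l))
    (h : ∀ l, ∃ z, A.mulVec z = fun i => B i l) :
    ∃ Z : Matrix J L (MvPolynomial τ k),
      (∀ j l, IsDegZero w (v j) (e l) (Z j l)) ∧ A * Z = B := by
  choose z hz hz' using fun l => exists_homogeneous_mulVec hA (fun i => hB i l) (h l)
  refine ⟨Matrix.of fun j l => z l j, fun j l => hz l j, ?_⟩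
  ext1 i l
  exact congrFun (hz' l) i

lemma exists_mul_eq {A I J L : Type*} [CommRing A] [Fintype J] {P : Matrix I J A}
    {B : Matrix I L A} (h : ∀ l, ∃ z, P.mulVec z = fun i => B i l) :
    ∃ Z : Matrix J L A, P * Z = B := by
  choose z hz using h
  refine ⟨Matrix.of fun j l => z l j, ?_⟩
  ext1 i l
  exact congrFun (hz l) i

lemma isDegZero_matrix_mul {I J L : Type*} [Fintype J] {A : Matrix I J (MvPolynomial τ k)}
    {B : Matrix J L (MvPolynomial τ k)} {u : I → ℕ} {v : J → ℕ} {e : L → ℕ}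
    (hA : ∀ i j, IsDegZero w (u i) (v j) (A i j)) (hB : ∀ i l, IsDegZero w (v i) (e l) (B i l))
    (i : I) (l : L) : IsDegZero w (u i) (e l) ((A * B) i l) := by
  rw [Matrix.mul_apply]
  exact IsDegZero.sum fun j _ => (hA i j).mul (hB j l)

lemma isDegZero_matrix_one {I : Type*} [DecidableEq I] {u : I → ℕ} (i j : I) :
    IsDegZero w (u i) (u j) ((1 : Matrix I I (MvPolynomial τ k)) i j) := by
  by_cases h : i = j
  · subst h
    simpa using isDegZero_one
  · rw [Matrix.one_apply_ne h]
    exact isDegZero_zero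

/-- A homogeneous matrix without constant terms is a contraction for the degree, so that `1 - N`
has a homogeneous inverse. -/
lemma exists_inverse_one_sub {I : Type*} [Fintype I] [DecidableEq I] (hw : ∀ t, 0 < w t)
    {N : Matrix I I (MvPolynomial τ k)} {u : I → ℕ}
    (hN : ∀ i j, IsDegZero w (u i) (u j) (N i j)) (h0 : ∀ i j, constantCoeff (N i j) = 0) :
    ∃ Q : Matrix I I (MvPolynomial τ k), (∀ i j, IsDegZero w (u i) (u j) (Q i j)) ∧
      (1 - N) * Q = 1 ∧ Q * (1 - N) = 1 := by
  have hhom : ∀ t i j, IsDegZero w (u i) (u j) ((N ^ t) i j) := by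
    intro t
    induction t with
    | zero => intro i j; rw [pow_zero]; exact isDegZero_matrix_one i j
    | succ t ih => rw [pow_succ]; exact isDegZero_matrix_mul ih hN
  -- A monomial other than 1 has positive weight, so nonzero entries strictly raise the degree.
  have hlt : ∀ i j, N i j ≠ 0 → u i < u j := by
    intro i j hne
    obtain ⟨c, hc⟩ := exists_coeff_ne_zero hne
    have h1 := hN i j c hc
    have hc0 : c ≠ 0 := by
      rintro rfl
      exact hc (h0 i j)
    obtain ⟨t, ht⟩ := Finsupp.ne_iff.1 hc0
    have h2 := Finsupp.le_weight w (s := t) (Nat.pos_iff_ne_zero.1 (hw t)) c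
    simp only [Finsupp.coe_zero, Pi.zero_apply] at ht
    omega
  have hpow : ∀ t i j, (N ^ t) i j ≠ 0 → u i + t ≤ u j := by
    intro t
    induction t with
    | zero =>
      intro i j h
      rw [pow_zero, Matrix.one_apply] at h
      split_ifs at h with h'
      · simp [h']
      · simp at h
    | succ t ih =>
      intro i j h
      rw [pow_succ, Matrix.mul_apply] at h
      obtain ⟨l, _, hl⟩ := Finset.exists_ne_zero_of_sum_ne_zero h
      have := ih i l (left_ne_zero_of_mul hl)
      have := hlt l j (right_ne_zero_of_mul hl)
      omega
  -- Nonzero entries of `N ^ t` raise the degree by at least `t`, and no degree exceeds `K - 1`. So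
  -- `N` is nilpotent and the inverse is a finite geometric series.
  set K := Finset.univ.sup u + 1 with hK
  have hnil : N ^ K = 0 := by
    ext1 i j
    by_contra h
    have h1 := hpow K i j h
    have h2 : u j ≤ Finset.univ.sup u := Finset.le_sup (Finset.mem_univ j)
    omega
  refine ⟨∑ t ∈ Finset.range K, N ^ t, fun i j => ?_, ?_, ?_⟩
  · rw [Matrix.sum_apply]
    exact IsDegZero.sum fun t _ => hhom t i j
  · rw [mul_neg_geom_sum, hnil, sub_zero]
  · rw [geom_sum_mul_neg, hnil, sub_zero]

/-- A homogeneous matrix whose constant part is invertible has a homogeneous inverse. -/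
lemma exists_inverse_of_constantCoeff {I J : Type*} [Fintype I] [DecidableEq I] [Fintype J]
    [DecidableEq J] (hw : ∀ t, 0 < w t) {P : Matrix I J (MvPolynomial τ k)} {u : I → ℕ}
    {v : J → ℕ} (hP : ∀ i j, IsDegZero w (u i) (v j) (P i j)) {Q₀ : Matrix J I k}
    (h1 : P.map constantCoeff * Q₀ = 1) (h2 : Q₀ * P.map constantCoeff = 1) :
    ∃ Q : Matrix J I (MvPolynomial τ k), (∀ j i, IsDegZero w (v j) (u i) (Q j i)) ∧
      P * Q = 1 ∧ Q * P = 1 := by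
  have hdeg : ∀ i j, constantCoeff (P i j) ≠ 0 → u i = v j := by
    intro i j h
    have := hP i j 0 h
    simpa using this
  -- `Q₀` need not respect degrees. Deleting its entries between different degrees does no harm,
  -- since the constant part of `P` has none there.
  set Q₁ : Matrix J I k := Matrix.of fun j i => if v j = u i then Q₀ j i else 0 with hQ₁
  have h1' : P.map constantCoeff * Q₁ = 1 := by
    ext1 i i'
    by_cases hii : u i = u i'
    · rw [← h1, Matrix.mul_apply, Matrix.mul_apply]
      refine Finset.sum_congr rfl fun j _ => ?_
      by_cases h : constantCoeff (P i j) = 0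
      · simp [h]
      · rw [hQ₁, Matrix.of_apply, if_pos ((hdeg i j h).symm.trans hii)]
    · rw [Matrix.one_apply_ne fun h => hii (by rw [h]), Matrix.mul_apply]
      refine Finset.sum_eq_zero fun j _ => ?_
      by_cases h : constantCoeff (P i j) = 0
      · simp [h]
      · rw [hQ₁, Matrix.of_apply, if_neg fun h' => hii ((hdeg i j h).trans h'), mul_zero]
  have h2' : Q₁ * P.map constantCoeff = 1 := by
    have : Q₁ = Q₀ := by
      rw [← Matrix.one_mul Q₁, ← h2, Matrix.mul_assoc, h1', Matrix.mul_one]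
    rw [this, h2]
  set Q₂ : Matrix J I (MvPolynomial τ k) := Q₁.map C with hQ₂
  have hQ₂h : ∀ j i, IsDegZero w (v j) (u i) (Q₂ j i) := by
    intro j i
    simp only [hQ₂, Matrix.map_apply, hQ₁, Matrix.of_apply]
    split_ifs with h
    · exact .of_hom (isWeightedHomogeneous_C w _) (by omega)
    · simpa using isDegZero_zero
  have hc : Q₂.map (constantCoeff (R := k)) = Q₁ := by
    ext1 j i
    simp [hQ₂]
  -- `P * Q₂` and `Q₂ * P` differ from 1 by matrices without constant terms, hence are invertible.
  -- They give a right and a left inverse of `P`, which agree.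
  obtain ⟨A, hA, hA1, -⟩ := exists_inverse_one_sub hw (N := 1 - P * Q₂) (u := u)
    (fun i j => (isDegZero_matrix_one i j).sub (isDegZero_matrix_mul hP hQ₂h i j)) (by
      intro i j
      have := congrFun (congrFun (Matrix.map_mul (L := P) (M := Q₂) (f := constantCoeff)) i) j
      rw [hc, h1', Matrix.map_apply] at this
      rw [Matrix.sub_apply, map_sub, this, Matrix.one_apply, Matrix.one_apply]
      split_ifs <;> simp)
  obtain ⟨B, hB, -, hB1⟩ := exists_inverse_one_sub hw (N := 1 - Q₂ * P) (u := v)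
    (fun i j => (isDegZero_matrix_one i j).sub (isDegZero_matrix_mul hQ₂h hP i j)) (by
      intro i j
      have := congrFun (congrFun (Matrix.map_mul (L := Q₂) (M := P) (f := constantCoeff)) i) j
      rw [hc, h2', Matrix.map_apply] at this
      rw [Matrix.sub_apply, map_sub, this, Matrix.one_apply, Matrix.one_apply]
      split_ifs <;> simp)
  rw [sub_sub_cancel] at hA1 hB1
  have hBA : B * Q₂ = Q₂ * A := by
    calc B * Q₂ = B * Q₂ * (P * Q₂ * A) := by rw [hA1, Matrix.mul_one]
      _ = (B * (Q₂ * P)) * (Q₂ * A) := by simp only [Matrix.mul_assoc]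
      _ = Q₂ * A := by rw [hB1, Matrix.one_mul]
  refine ⟨Q₂ * A, isDegZero_matrix_mul hQ₂h hA, ?_, ?_⟩
  · rw [← Matrix.mul_assoc, hA1]
  · rw [← hBA, Matrix.mul_assoc, hB1]

end DegPart

/-! ### Lifting of maps, homotopies, and exactness of cones. -/

namespace GrComplex

variable {k : Type*} [Field k] {τ : Type} {w : τ → ℕ}

/-- Exactness in positive homological degrees. -/
def IsExact (F : GrComplex k w) : Prop :=
  ∀ s (v : F.ι (s + 1) → MvPolynomial τ k), (F.d s).mulVec v = 0 →
    ∃ u : F.ι (s + 2) → MvPolynomial τ k, (F.d (s + 1)).mulVec u = v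

lemma IsExact.exists_col {G : GrComplex k w} (hG : G.IsExact) {L : Type*} {s : ℕ}
    {B : Matrix (G.ι (s + 1)) L (MvPolynomial τ k)} (hB : G.d s * B = 0) (l : L) :
    ∃ z, (G.d (s + 1)).mulVec z = fun i => B i l := by
  refine hG s _ ?_
  ext1 i
  exact congrFun (congrFun hB i) l

/-- Lifting of a map on the modules in homological degree `0` to a map of complexes. -/
lemma exists_hom {F G : GrComplex k w} (hG : G.IsExact)
    (f₀ : Matrix (G.ι 0) (F.ι 0) (MvPolynomial τ k))
    (hf₀ : ∀ i j, IsDegZero w (G.deg 0 i) (F.deg 0 j) (f₀ i j))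
    (h : ∀ l, ∃ z, (G.d 0).mulVec z = fun i => (f₀ * F.d 0) i l) :
    ∃ μ : Hom F G, μ.f 0 = f₀ := by
  -- A stage of the recursion carries the solvability of the equation that defines the next
  -- component.
  let St (s : ℕ) : Type _ := {f : Matrix (G.ι s) (F.ι s) (MvPolynomial τ k) //
    (∀ i j, IsDegZero w (G.deg s i) (F.deg s j) (f i j)) ∧
    ∀ l, ∃ z, (G.d s).mulVec z = fun i => (f * F.d s) i l}
  have step : ∀ s (f : St s), ∃ g : St (s + 1), f.1 * F.d s = G.d s * g.1 := by
    intro s f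
    obtain ⟨g, hg, hfg⟩ := exists_homogeneous_mul (G.homog s)
      (isDegZero_matrix_mul f.2.1 (F.homog s)) f.2.2
    refine ⟨⟨g, hg, hG.exists_col ?_⟩, hfg.symm⟩
    rw [← Matrix.mul_assoc, hfg, Matrix.mul_assoc, F.d_mul_d, Matrix.mul_zero]
  choose nxt hnxt using step
  let seq : ∀ s, St s := fun s => Nat.rec ⟨f₀, hf₀, h⟩ nxt s
  exact ⟨⟨fun s => (seq s).1, fun s => (seq s).2.1, fun s => hnxt s (seq s)⟩, rfl⟩

/-- A chain map to an exact complex that vanishes in degree `0` is null-homotopic. -/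
lemma exists_homotopy {F G : GrComplex k w} (hG : G.IsExact)
    (f : ∀ s, Matrix (G.ι s) (F.ι s) (MvPolynomial τ k))
    (hf : ∀ s, f s * F.d s = G.d s * f (s + 1)) (h0 : f 0 = 0) :
    ∃ h : ∀ s, Matrix (G.ι (s + 1)) (F.ι s) (MvPolynomial τ k),
      h 0 = 0 ∧ ∀ s, f (s + 1) = G.d (s + 1) * h (s + 1) + h s * F.d s := by
  -- The invariant says that the part of `f` not yet accounted for consists of cycles of `G`, hence
  -- of boundaries.
  let St (s : ℕ) : Type _ := {h : Matrix (G.ι (s + 1)) (F.ι s) (MvPolynomial τ k) //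
    G.d s * (f (s + 1) - h * F.d s) = 0}
  have step : ∀ s (h : St s), ∃ g : St (s + 1), f (s + 1) = G.d (s + 1) * g.1 + h.1 * F.d s := by
    intro s h
    obtain ⟨g, hg⟩ := exists_mul_eq (hG.exists_col h.2)
    refine ⟨⟨g, ?_⟩, by rw [hg]; abel⟩
    rw [Matrix.mul_sub, ← Matrix.mul_assoc, hg, ← hf, Matrix.sub_mul, Matrix.mul_assoc h.1,
      F.d_mul_d, Matrix.mul_zero, sub_zero, sub_self]
  choose nxt hnxt using step
  let seq : ∀ s, St s := fun s => Nat.rec ⟨0, by simp [← hf, h0]⟩ nxt s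
  exact ⟨fun s => (seq s).1, rfl, fun s => hnxt s (seq s)⟩

/-- The boundary map of a cone, on vectors. -/
lemma coneD_succ_mulVec {F G : GrComplex k w} (μ : Hom F G) (s : ℕ)
    (v : G.ι (s + 2) → MvPolynomial τ k) (u : F.ι (s + 1) → MvPolynomial τ k) :
    Matrix.mulVec (coneD μ (s + 1)) (Sum.elim v u) =
      Sum.elim ((G.d (s + 1)).mulVec v + ((-1) ^ (s + 2) : MvPolynomial τ k) •
        (μ.f (s + 1)).mulVec u) ((F.d s).mulVec u) := by
  refine (Matrix.fromBlocks_mulVec _ _ _ _ _).trans ?_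
  simp [Matrix.smul_mulVec]

lemma coneD_zero_mulVec {F G : GrComplex k w} (μ : Hom F G)
    (v : G.ι 1 → MvPolynomial τ k) (u : F.ι 0 → MvPolynomial τ k) :
    Matrix.mulVec (coneD μ 0) (Sum.elim v u) = (G.d 0).mulVec v - (μ.f 0).mulVec u := by
  have h : (G.d 0).mulVec v + (-(μ.f 0)).mulVec u = (G.d 0).mulVec v - (μ.f 0).mulVec u := by
    rw [Matrix.neg_mulVec, sub_eq_add_neg]
  exact (Matrix.fromCols_mulVec _ _ _).trans h

lemma Hom.comm_mulVec {F G : GrComplex k w} (μ : Hom F G) (s : ℕ)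
    (u : F.ι (s + 1) → MvPolynomial τ k) :
    (μ.f s).mulVec ((F.d s).mulVec u) = (G.d s).mulVec ((μ.f (s + 1)).mulVec u) := by
  rw [Matrix.mulVec_mulVec, Matrix.mulVec_mulVec, μ.comm]

/-- The cone of a map that is injective on homology in degree `0` is exact. -/
lemma isExact_cone {F G : GrComplex k w} (μ : Hom F G) (hF : F.IsExact) (hG : G.IsExact)
    (hinj : ∀ u v, (μ.f 0).mulVec u = (G.d 0).mulVec v → ∃ z, (F.d 0).mulVec z = u) :
    (cone μ).IsExact := by
  intro s
  -- Once `u` is the boundary of `z`, adding a signed multiple of `μ z` makes `v` a cycle of the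
  -- exact complex `G`. The cases below differ only in the origin of `z`: injectivity on homology in
  -- degree 0, or exactness of `F`.
  have key : ∀ (v : G.ι (s + 1) → MvPolynomial τ k) (u : F.ι s → MvPolynomial τ k)
      (z : F.ι (s + 1) → MvPolynomial τ k), (F.d s).mulVec z = u →
      (G.d s).mulVec v + ((-1) ^ (s + 1) : MvPolynomial τ k) • (μ.f s).mulVec u = 0 →
      ∃ y, Matrix.mulVec (coneD μ (s + 1)) y = (Sum.elim v u : coneι F G (s + 1) → _) := by
    intro v u z hz hv
    obtain ⟨y, hy⟩ := hG s (v + ((-1) ^ (s + 1) : MvPolynomial τ k) • (μ.f (s + 1)).mulVec z) (by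
      rw [Matrix.mulVec_add, Matrix.mulVec_smul, ← μ.comm_mulVec, hz, hv])
    refine ⟨Sum.elim y z, ?_⟩
    rw [coneD_succ_mulVec, hz, hy, pow_succ _ (s + 1)]
    congr 1
    simp
  cases s with
  | zero =>
    intro v hv
    obtain ⟨v, u, rfl⟩ : ∃ (a : G.ι 1 → MvPolynomial τ k) (b : F.ι 0 → MvPolynomial τ k),
        v = (Sum.elim a b : coneι F G 1 → _) :=
      ⟨v ∘ Sum.inl, v ∘ Sum.inr, (Sum.elim_comp_inl_inr v).symm⟩
    have hv' : (G.d 0).mulVec v - (μ.f 0).mulVec u = 0 := (coneD_zero_mulVec μ v u).symm.trans hv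
    obtain ⟨z, hz⟩ := hinj u v (sub_eq_zero.1 hv').symm
    exact key v u z hz (by simpa [sub_eq_add_neg] using hv')
  | succ s =>
    intro v hv
    obtain ⟨v, u, rfl⟩ : ∃ (a : G.ι (s + 2) → MvPolynomial τ k)
        (b : F.ι (s + 1) → MvPolynomial τ k), v = (Sum.elim a b : coneι F G (s + 2) → _) :=
      ⟨v ∘ Sum.inl, v ∘ Sum.inr, (Sum.elim_comp_inl_inr v).symm⟩
    have hv' := (coneD_succ_mulVec μ s v u).symm.trans hv
    have h1 := congrArg (fun g => g ∘ Sum.inl) hv'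
    have h2 := congrArg (fun g => g ∘ Sum.inr) hv'
    obtain ⟨z, hz⟩ := hF s u h2
    exact key v u z hz h1

end GrComplex

/-! ### Reduction modulo the variables, and comparison of resolutions. -/

namespace GrComplex

variable {k : Type*} [Field k] {τ : Type} {w : τ → ℕ}

/-- Minimality thus means that the boundary maps vanish after reduction modulo the variables, where
linear algebra over `k` is available. -/
lemma mem_span_X_iff {p : MvPolynomial τ k} :
    p ∈ Ideal.span (Set.range (X : τ → MvPolynomial τ k)) ↔ constantCoeff p = 0 := by
  constructor
  · intro h
    have hle : Ideal.span (Set.range (X : τ → MvPolynomial τ k)) ≤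
        RingHom.ker (constantCoeff : MvPolynomial τ k →+* k) := by
      rw [Ideal.span_le]
      rintro _ ⟨t, rfl⟩
      simp
    exact hle h
  · intro h
    rw [← Set.image_univ, mem_ideal_span_X_image]
    intro c hc
    have hc0 : c ≠ 0 := by
      rintro rfl
      exact (mem_support_iff.1 hc) h
    obtain ⟨t, ht⟩ := Finsupp.ne_iff.1 hc0
    exact ⟨t, Set.mem_univ _, ht⟩

/-- The constant part of the boundary map. -/
noncomputable def constD (F : GrComplex k w) (s : ℕ) : Matrix (F.ι s) (F.ι (s + 1)) k :=
  (F.d s).map constantCoeff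

lemma constD_mul_constD (F : GrComplex k w) (s : ℕ) : F.constD s * F.constD (s + 1) = 0 := by
  rw [constD, constD, ← Matrix.map_mul, F.d_mul_d]
  ext1 i j
  simp

lemma IsMinimal.constD_eq_zero {F : GrComplex k w} (hF : F.IsMinimal) (s : ℕ) :
    F.constD s = 0 := by
  ext1 i j
  exact mem_span_X_iff.1 (hF s i j)

/-- Basis elements of `F_{s+1}` whose images form a basis of the image of the constant part of the
boundary map. -/
lemma exists_pivots (F : GrComplex k w) (s : ℕ) :
    ∃ (κ : Type) (_ : Fintype κ) (_ : DecidableEq κ) (a : κ → F.ι (s + 1)),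
      (∀ z : F.ι (s + 1) → k, ∃ y : κ → k,
        (F.constD s).mulVec z = ((F.constD s).submatrix id a).mulVec y) ∧
      ∀ y : κ → k, ((F.constD s).submatrix id a).mulVec y = 0 → y = 0 := by
  obtain ⟨κ, a, ha, hsp, hli⟩ := exists_linearIndependent' k (F.constD s).col
  let : Fintype κ := Fintype.ofInjective a ha
  refine ⟨κ, inferInstance, Classical.decEq κ, a, fun z => ?_, fun y hy => ?_⟩
  · have h1 : (F.constD s).mulVec z ∈ Submodule.span k (Set.range (F.constD s).col) := by
      rw [← Matrix.range_mulVecLin]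
      exact ⟨z, rfl⟩
    have h2 : Submodule.span k (Set.range ((F.constD s).col ∘ a)) =
        LinearMap.range ((F.constD s).submatrix id a).mulVecLin :=
      (Matrix.range_mulVecLin _).symm
    rw [← hsp, h2] at h1
    obtain ⟨y, hy⟩ := h1
    exact ⟨y, hy.symm⟩
  · have h2 : LinearIndependent k ((F.constD s).submatrix id a).col := hli
    rw [← Matrix.mulVec_injective_iff] at h2
    exact h2 (by rw [hy, Matrix.mulVec_zero])

lemma IsResolution.isExact {F : GrComplex k w} {I : Ideal (MvPolynomial τ k)}
    (hF : F.IsResolution I) : F.IsExact := hF.exact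

/-- Two resolutions of `R/I` are linked by a map of complexes lifting the identity. -/
lemma IsResolution.exists_hom {F G : GrComplex k w} {I : Ideal (MvPolynomial τ k)}
    (hF : F.IsResolution I) (hG : G.IsResolution I) : ∃ μ : Hom F G, ∀ i j, μ.f 0 i j = 1 := by
  obtain ⟨x, hx, hx0, hxI⟩ := hF.zero
  obtain ⟨y, hy, hy0, hyI⟩ := hG.zero
  obtain ⟨μ, hμ⟩ := GrComplex.exists_hom (F := F) hG.isExact (Matrix.of fun _ _ => 1) (by
      intro i j
      rw [hx j, hy i, hx0, hy0]
      exact isDegZero_one) (by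
      intro l
      have h1 : F.d 0 x l ∈ I := by
        rw [← hxI]
        exact Ideal.subset_span ⟨l, rfl⟩
      rw [← hyI, Ideal.mem_span_range_iff_exists_fun] at h1
      obtain ⟨z, hz⟩ := h1
      refine ⟨z, ?_⟩
      ext1 i
      have hu : (Finset.univ : Finset (F.ι 0)) = {x} :=
        Finset.eq_singleton_iff_unique_mem.2 ⟨Finset.mem_univ _, fun j _ => hx j⟩
      rw [hy i, Matrix.mul_apply, hu, Finset.sum_singleton, Matrix.of_apply, one_mul, ← hz]
      exact Finset.sum_congr rfl fun j _ => mul_comm _ _)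
  exact ⟨μ, fun i j => by rw [hμ]; rfl⟩

/-- Composition of two maps of complexes lifting the identity is homotopic to the identity. -/
lemma IsResolution.exists_homotopy {F G : GrComplex k w} {I : Ideal (MvPolynomial τ k)}
    (hF : F.IsResolution I) (hG : G.IsResolution I) {α : Hom F G} {β : Hom G F}
    (hα : ∀ i j, α.f 0 i j = 1) (hβ : ∀ i j, β.f 0 i j = 1) :
    ∃ h : ∀ s, Matrix (F.ι (s + 1)) (F.ι s) (MvPolynomial τ k), β.f 0 * α.f 0 = 1 ∧
      h 0 = 0 ∧ ∀ s, β.f (s + 1) * α.f (s + 1) = 1 + F.d (s + 1) * h (s + 1) + h s * F.d s := by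
  obtain ⟨x, hx, -⟩ := hF.zero
  obtain ⟨y, hy, -⟩ := hG.zero
  have h1 : β.f 0 * α.f 0 = 1 := by
    ext1 i j
    have hu : (Finset.univ : Finset (G.ι 0)) = {y} :=
      Finset.eq_singleton_iff_unique_mem.2 ⟨Finset.mem_univ _, fun j _ => hy j⟩
    rw [Matrix.mul_apply, hu, Finset.sum_singleton, hα, hβ, hx i, hx j, Matrix.one_apply_eq,
      one_mul]
  obtain ⟨h, hh0, hh⟩ := GrComplex.exists_homotopy (F := F) hF.isExact
    (fun s => β.f s * α.f s - 1) (fun s => by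
      rw [Matrix.sub_mul, Matrix.mul_sub, Matrix.mul_assoc, α.comm, ← Matrix.mul_assoc, β.comm,
        Matrix.mul_assoc, Matrix.one_mul, Matrix.mul_one]) (by rw [h1, sub_self])
  refine ⟨h, h1, hh0, fun s => ?_⟩
  rw [add_assoc, ← hh s]
  abel

/-- The inverse of a homogeneous map of complexes with bijective constant parts. -/
lemma exists_iso {F G : GrComplex k w} (hw : ∀ t, 0 < w t) (μ : Hom F G)
    (h : ∀ s, Function.Bijective ((μ.f s).map constantCoeff).mulVec) : Nonempty (Iso G F) := by
  -- This is a graded Nakayama lemma: a homogeneous matrix that is invertible modulo the variables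
  -- is invertible. Compatibility of the inverses with the boundary maps is then formal.
  have key : ∀ s, ∃ Q : Matrix (F.ι s) (G.ι s) (MvPolynomial τ k),
      (∀ j i, IsDegZero w (F.deg s j) (G.deg s i) (Q j i)) ∧ μ.f s * Q = 1 ∧ Q * μ.f s = 1 := by
    intro s
    let e := LinearEquiv.ofBijective ((μ.f s).map constantCoeff).mulVecLin (h s)
    have he : LinearMap.toMatrix' e.toLinearMap = (μ.f s).map constantCoeff :=
      LinearMap.toMatrix'_toLin' _
    refine exists_inverse_of_constantCoeff hw (μ.homog s)
      (Q₀ := LinearMap.toMatrix' e.symm.toLinearMap) ?_ ?_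
    · rw [← he, ← LinearMap.toMatrix'_comp]
      simp
    · rw [← he, ← LinearMap.toMatrix'_comp]
      simp
  choose Q hQ hμQ hQμ using key
  refine ⟨⟨⟨Q, hQ, fun s => ?_⟩, μ, hQμ, hμQ⟩⟩
  calc Q s * G.d s = Q s * G.d s * (μ.f (s + 1) * Q (s + 1)) := by rw [hμQ, Matrix.mul_one]
    _ = Q s * (G.d s * μ.f (s + 1)) * Q (s + 1) := by simp only [Matrix.mul_assoc]
    _ = (Q s * μ.f s) * (F.d s * Q (s + 1)) := by rw [← μ.comm]; simp only [Matrix.mul_assoc]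
    _ = F.d s * Q (s + 1) := by rw [hQμ, Matrix.one_mul]

end GrComplex

/-! ### Splitting a graded resolution into the minimal one and a trivial complex. -/

namespace GrComplex

variable {k : Type*} [Field k] {τ : Type} {w : τ → ℕ}

section Splitting

variable {F M : GrComplex k w} {κ : ℕ → Type} [∀ s, Fintype (κ s)] [∀ s, DecidableEq (κ s)]

/-- The complex with zero boundary maps spanned by chosen basis elements of `F_{s+1}`. -/
noncomputable def pivotComplex (a : ∀ s, κ s → F.ι (s + 1)) : GrComplex k w where
  ι := κ
  fin := inferInstance
  dec := inferInstance
  deg s i := F.deg (s + 1) (a s i)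
  d _ := 0
  homog _ _ _ := isDegZero_zero
  d_mul_d _ := by simp

/-- The components of the map `M ⊕ cone(id) → F` given by a map `M → F` and chosen basis elements
of `F`. -/
noncomputable def splittingMap (α : Hom M F) (a : ∀ s, κ s → F.ι (s + 1)) :
    ∀ s, Matrix (F.ι s) ((directSum M (cone (Hom.id (pivotComplex a)))).ι s) (MvPolynomial τ k)
  | 0 => Matrix.fromCols (α.f 0) ((F.d 0).submatrix id (a 0))
  -- The source of a trivial summand goes to the chosen basis element, its target to the boundary of
  -- that element; the sign compensates the sign in the boundary map of the cone.
  | s + 1 => Matrix.fromCols (α.f (s + 1)) (Matrix.fromCols ((F.d (s + 1)).submatrix id (a (s + 1)))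
      ((-1 : MvPolynomial τ k) ^ (s + 1) • (1 : Matrix _ _ _).submatrix id (a s)))

lemma mul_submatrix_one {A I J L : Type*} [CommRing A] [Fintype J] [DecidableEq J]
    (P : Matrix I J A) (a : L → J) : P * (1 : Matrix J J A).submatrix id a = P.submatrix id a := by
  ext1 i l
  simp [Matrix.mul_apply, Matrix.one_apply]

/-- The map `M ⊕ cone(id) → F` given by a map `M → F` and chosen basis elements of `F`. -/
noncomputable def splittingHom (α : Hom M F) (a : ∀ s, κ s → F.ι (s + 1)) :
    Hom (directSum M (cone (Hom.id (pivotComplex a)))) F where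
  f := splittingMap α a
  homog s i j := by
    cases s with
    | zero =>
      rcases j with j | j
      · exact α.homog 0 i j
      · exact F.homog 0 i (a 0 j)
    | succ s =>
      rcases j with j | j | j
      · exact α.homog (s + 1) i j
      · exact F.homog (s + 1) i (a (s + 1) j)
      · exact (isDegZero_matrix_one i (a s j)).sign_mul (s + 1)
  comm s := by
    have hsub : ∀ s, F.d s * (F.d (s + 1)).submatrix id (a (s + 1)) = 0 := fun s => by
      rw [← mul_submatrix_one, ← Matrix.mul_assoc, F.d_mul_d, Matrix.zero_mul]
    cases s with
    | zero =>
      have h : Matrix.fromCols (α.f 0) ((F.d 0).submatrix id (a 0)) *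
          Matrix.fromBlocks (M.d 0) 0 0 (Matrix.fromCols (0 : Matrix (κ 0) (κ 1) _)
            (-(1 : Matrix (κ 0) (κ 0) (MvPolynomial τ k)))) =
          F.d 0 * Matrix.fromCols (α.f 1) (Matrix.fromCols ((F.d 1).submatrix id (a 1))
            ((-1 : MvPolynomial τ k) ^ 1 • (1 : Matrix _ _ _).submatrix id (a 0))) := by
        rw [Matrix.fromCols_mul_fromBlocks, Matrix.mul_fromCols, Matrix.mul_fromCols,
          Matrix.mul_fromCols, α.comm, hsub, Matrix.mul_smul, mul_submatrix_one]
        simp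
      exact h
    | succ s =>
      have h : Matrix.fromCols (α.f (s + 1)) (Matrix.fromCols
            ((F.d (s + 1)).submatrix id (a (s + 1)))
            ((-1 : MvPolynomial τ k) ^ (s + 1) • (1 : Matrix _ _ _).submatrix id (a s))) *
          Matrix.fromBlocks (M.d (s + 1)) 0 0 (Matrix.fromBlocks
            (0 : Matrix (κ (s + 1)) (κ (s + 2)) _)
            ((-1 : MvPolynomial τ k) ^ (s + 2) • (1 : Matrix (κ (s + 1)) (κ (s + 1)) _))
            (0 : Matrix (κ s) (κ (s + 2)) _) (0 : Matrix (κ s) (κ (s + 1)) _)) =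
          F.d (s + 1) * Matrix.fromCols (α.f (s + 2)) (Matrix.fromCols
            ((F.d (s + 2)).submatrix id (a (s + 2)))
            ((-1 : MvPolynomial τ k) ^ (s + 2) • (1 : Matrix _ _ _).submatrix id (a (s + 1)))) := by
        rw [Matrix.fromCols_mul_fromBlocks, Matrix.mul_fromCols, Matrix.mul_fromCols,
          Matrix.fromCols_mul_fromBlocks, α.comm, hsub, Matrix.mul_smul (F.d (s + 1)),
          mul_submatrix_one]
        simp
      exact h

lemma map_constantCoeff_mul {I J L : Type*} [Fintype J] (P : Matrix I J (MvPolynomial τ k))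
    (Q : Matrix J L (MvPolynomial τ k)) :
    (P * Q).map constantCoeff = P.map constantCoeff * Q.map constantCoeff :=
  Matrix.map_mul

lemma map_constantCoeff_one {I : Type*} [DecidableEq I] :
    (1 : Matrix I I (MvPolynomial τ k)).map constantCoeff = (1 : Matrix I I k) :=
  Matrix.map_one _ (map_zero _) (map_one _)

/-- A graded resolution is the direct sum of a minimal one and a trivial complex. -/
theorem IsResolution.exists_splitting {I : Ideal (MvPolynomial τ k)} (hw : ∀ t, 0 < w t)
    (hF : F.IsResolution I) (hM : M.IsMinimalResolution I) :
    ∃ Z : GrComplex k w, (∀ s, Z.d s = 0) ∧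
      Nonempty (Iso F (directSum M (cone (Hom.id Z)))) := by
  obtain ⟨α, hα⟩ := hM.1.exists_hom hF
  obtain ⟨β, hβ⟩ := hF.exists_hom hM.1
  obtain ⟨g, hg0, -, hg⟩ := hM.1.exists_homotopy hF hα hβ
  obtain ⟨h, hh0, -, hh⟩ := hF.exists_homotopy hM.1 hβ hα
  choose κ hκ hκ' a hsp hli using F.exists_pivots
  refine ⟨pivotComplex a, fun _ => rfl, exists_iso hw (splittingHom α a) ?_⟩
  let A := fun s => (α.f s).map (constantCoeff (R := k) (σ := τ))
  let B := fun s => (β.f s).map (constantCoeff (R := k) (σ := τ))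
  -- Modulo the variables the boundary map of `M` is zero. So `A` has values in cycles, `B` kills
  -- boundaries, and the homotopies give `B A = 1` and, on cycles, `A B = 1` up to boundaries.
  have hDA : ∀ s v, (F.constD s).mulVec ((A (s + 1)).mulVec v) = 0 := by
    intro s v
    rw [Matrix.mulVec_mulVec, constD, ← map_constantCoeff_mul, ← α.comm, map_constantCoeff_mul]
    rw [show (M.d s).map constantCoeff = 0 from hM.2.constD_eq_zero s]
    simp
  have hBD : ∀ s v, (B s).mulVec ((F.constD s).mulVec v) = 0 := by
    intro s v
    rw [Matrix.mulVec_mulVec, constD, ← map_constantCoeff_mul, β.comm, map_constantCoeff_mul]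
    rw [show (M.d s).map constantCoeff = 0 from hM.2.constD_eq_zero s]
    simp
  have hBA : ∀ s v, (B s).mulVec ((A s).mulVec v) = v := by
    intro s v
    rw [Matrix.mulVec_mulVec, ← map_constantCoeff_mul]
    cases s with
    | zero => rw [hg0, map_constantCoeff_one, Matrix.one_mulVec]
    | succ s =>
      rw [hg, Matrix.map_add _ (map_add _), Matrix.map_add _ (map_add _), map_constantCoeff_mul,
        map_constantCoeff_mul, map_constantCoeff_one,
        show (M.d s).map constantCoeff = 0 from hM.2.constD_eq_zero s,
        show (M.d (s + 1)).map constantCoeff = 0 from hM.2.constD_eq_zero (s + 1)]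
      simp
  have hsub : ∀ s (y : κ s → k), ((F.constD s).submatrix id (a s)).mulVec y =
      (F.constD s).mulVec (((1 : Matrix _ _ k).submatrix id (a s)).mulVec y) := by
    intro s y
    rw [Matrix.mulVec_mulVec, mul_submatrix_one]
  intro s
  cases s with
  | zero =>
    have heq : ∀ (v : M.ι 0 → k) (y : κ 0 → k),
        Matrix.mulVec ((splittingMap α a 0).map constantCoeff) (Sum.elim v y) =
          (A 0).mulVec v + ((F.constD 0).submatrix id (a 0)).mulVec y := by
      intro v y
      refine Eq.trans ?_ (Matrix.fromCols_mulVec_sumElim _ _ _ _)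
      congr 1
      ext1 i j
      rcases j with j | j <;> rfl
    constructor
    · change Function.Injective (Matrix.mulVecLin _)
      rw [injective_iff_map_eq_zero]
      intro x hx
      obtain ⟨v, y, rfl⟩ : ∃ (v : M.ι 0 → k) (y : κ 0 → k), x = Sum.elim v y :=
        ⟨x ∘ Sum.inl, x ∘ Sum.inr, (Sum.elim_comp_inl_inr x).symm⟩
      have h1 := (heq v y).symm.trans hx
      have h2 := congrArg (B 0).mulVec h1
      rw [Matrix.mulVec_add, hBA, hsub, hBD, Matrix.mulVec_zero, add_zero] at h2
      rw [h2, Matrix.mulVec_zero, zero_add] at h1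
      rw [h2, hli 0 y h1]
      ext1 (j | j) <;> rfl
    · intro x
      refine ⟨Sum.elim ((B 0).mulVec x) (0 : κ 0 → k), (heq _ _).trans ?_⟩
      rw [Matrix.mulVec_zero, add_zero, Matrix.mulVec_mulVec, ← map_constantCoeff_mul, hh0,
        map_constantCoeff_one, Matrix.one_mulVec]
  | succ s =>
    have heq : ∀ (v : M.ι (s + 1) → k) (y : κ (s + 1) → k) (z : κ s → k),
        Matrix.mulVec ((splittingMap α a (s + 1)).map constantCoeff) (Sum.elim v (Sum.elim y z)) =
          (A (s + 1)).mulVec v + (((F.constD (s + 1)).submatrix id (a (s + 1))).mulVec y +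
            (-1 : k) ^ (s + 1) • ((1 : Matrix _ _ k).submatrix id (a s)).mulVec z) := by
      intro v y z
      rw [← Matrix.smul_mulVec]
      refine Eq.trans ?_ (congrArg _ (Matrix.fromCols_mulVec_sumElim _ _ _ _))
      refine Eq.trans ?_ (Matrix.fromCols_mulVec_sumElim _ _ _ _)
      congr 1
      ext1 i j
      rcases j with j | j | j
      · rfl
      · rfl
      · change constantCoeff ((-1 : MvPolynomial τ k) ^ (s + 1) *
          (1 : Matrix _ _ (MvPolynomial τ k)) i (a s j)) =
          (-1 : k) ^ (s + 1) * (1 : Matrix _ _ k) i (a s j)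
        rw [map_mul, map_pow, map_neg, map_one, Matrix.one_apply, Matrix.one_apply]
        split_ifs <;> simp
    have hDsub : ∀ y : κ (s + 1) → k, (F.constD s).mulVec
        (((F.constD (s + 1)).submatrix id (a (s + 1))).mulVec y) = 0 := by
      intro y
      rw [hsub, Matrix.mulVec_mulVec, constD_mul_constD, Matrix.zero_mulVec]
    have hsign : (-1 : k) ^ (s + 1) * (-1 : k) ^ (s + 1) = 1 := by
      rw [← mul_pow]; simp
    constructor
    · change Function.Injective (Matrix.mulVecLin _)
      rw [injective_iff_map_eq_zero]
      intro x hx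
      obtain ⟨v, y, z, rfl⟩ : ∃ (v : M.ι (s + 1) → k) (y : κ (s + 1) → k) (z : κ s → k),
          x = Sum.elim v (Sum.elim y z) :=
        ⟨x ∘ Sum.inl, x ∘ Sum.inr ∘ Sum.inl, x ∘ Sum.inr ∘ Sum.inr, by
          ext1 (j | j | j) <;> rfl⟩
      have h1 := (heq v y z).symm.trans hx
      -- The boundary map kills everything but the `z` part, so `z = 0` by independence of the
      -- pivots. Then `B` isolates `v`, and independence in the next degree gives `y = 0`.
      have h3 := congrArg (F.constD s).mulVec h1
      rw [Matrix.mulVec_add, hDA, Matrix.mulVec_add, hDsub, Matrix.mulVec_smul, ← hsub,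
        Matrix.mulVec_zero, zero_add, zero_add] at h3
      have hz : z = 0 := by
        refine hli s z ?_
        rw [← one_smul k (Matrix.mulVec _ z), ← hsign, mul_smul, h3, smul_zero]
      rw [hz, Matrix.mulVec_zero, smul_zero, add_zero] at h1
      have h2 := congrArg (B (s + 1)).mulVec h1
      rw [Matrix.mulVec_add, hBA, hsub, hBD, Matrix.mulVec_zero, add_zero] at h2
      rw [h2, Matrix.mulVec_zero, zero_add] at h1
      rw [h2, hli _ y h1, hz]
      ext1 (j | j | j) <;> rfl
    · intro x
      -- Subtracting the pivots with coefficients `z` turns `x` into a cycle; `y` then corrects the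
      -- boundary by which `A B` differs from the identity on this cycle.
      obtain ⟨z, hz⟩ := hsp s x
      obtain ⟨y, hy⟩ := hsp (s + 1) (-(((h (s + 1)).map constantCoeff).mulVec
        (x - ((1 : Matrix _ _ k).submatrix id (a s)).mulVec z)))
      refine ⟨Sum.elim ((B (s + 1)).mulVec (x - ((1 : Matrix _ _ k).submatrix id (a s)).mulVec z))
        (Sum.elim y ((-1 : k) ^ (s + 1) • z)), (heq _ _ _).trans ?_⟩
      have hcyc : (F.constD s).mulVec
          (x - ((1 : Matrix _ _ k).submatrix id (a s)).mulVec z) = 0 := by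
        rw [Matrix.mulVec_sub, hz, hsub, sub_self]
      rw [← hy, Matrix.mulVec_smul, smul_smul, hsign, one_smul]
      have hAB : ∀ x', (F.constD s).mulVec x' = 0 → (A (s + 1)).mulVec ((B (s + 1)).mulVec x') =
          x' + (F.constD (s + 1)).mulVec (((h (s + 1)).map constantCoeff).mulVec x') := by
        intro x' hx'
        rw [Matrix.mulVec_mulVec, ← map_constantCoeff_mul, hh, Matrix.map_add _ (map_add _),
          Matrix.map_add _ (map_add _), map_constantCoeff_mul, map_constantCoeff_mul,
          map_constantCoeff_one, Matrix.add_mulVec, Matrix.add_mulVec, Matrix.one_mulVec,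
          ← Matrix.mulVec_mulVec, ← Matrix.mulVec_mulVec]
        rw [show ((F.d s).map constantCoeff).mulVec x' = 0 from hx', Matrix.mulVec_zero, add_zero]
        rfl
      rw [hAB _ hcyc, Matrix.mulVec_neg]
      abel

end Splitting

end GrComplex

/-! ### Contractions on exterior forms, and separation of the last basis vector. -/

section Forms

variable {A : Type*} [CommRing A] {m : ℕ}

/-- Contraction by `f` on the exterior algebra of `Aᵐ`, whose elements are written as functions on
the set of basis elements `e_S`. -/
def contrMap (f : Fin m → A) : (Finset (Fin m) → A) →ₗ[A] (Finset (Fin m) → A) :=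
  Matrix.mulVecLin (Matrix.of fun T S => contr f T S)

lemma contrMap_apply (f : Fin m → A) (ω : Finset (Fin m) → A) (T : Finset (Fin m)) :
    contrMap f ω T = ∑ S, contr f T S * ω S := rfl

lemma contrMap_contrMap_apply (f g : Fin m → A) (ω : Finset (Fin m) → A) (T : Finset (Fin m)) :
    contrMap f (contrMap g ω) T = ∑ S, (∑ U, contr f T U * contr g U S) * ω S := by
  simp only [contrMap_apply, Finset.mul_sum, Finset.sum_mul]
  rw [Finset.sum_comm]
  simp only [mul_assoc]

lemma contrMap_sq (f : Fin m → A) (ω : Finset (Fin m) → A) : contrMap f (contrMap f ω) = 0 := by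
  ext1 T
  simp [contrMap_contrMap_apply, contr_sq]

lemma contrMap_anticomm (f g : Fin m → A) (ω : Finset (Fin m) → A) :
    contrMap f (contrMap g ω) = -contrMap g (contrMap f ω) := by
  ext1 T
  rw [Pi.neg_apply, eq_neg_iff_add_eq_zero, contrMap_contrMap_apply, contrMap_contrMap_apply,
    ← Finset.sum_add_distrib]
  refine Finset.sum_eq_zero fun S _ => ?_
  rw [← add_mul, contr_anticomm, zero_mul]

/-- `ω` is homogeneous of degree `p` in the exterior algebra. -/
def IsForm (p : ℕ) (ω : Finset (Fin m) → A) : Prop := ∀ S, S.card ≠ p → ω S = 0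

lemma isForm_zero {p : ℕ} : IsForm p (0 : Finset (Fin m) → A) := fun _ _ => rfl

lemma IsForm.add {p : ℕ} {ω η : Finset (Fin m) → A} (h : IsForm p ω) (h' : IsForm p η) :
    IsForm p (ω + η) := fun S hS => by rw [Pi.add_apply, h S hS, h' S hS, add_zero]

lemma IsForm.neg {p : ℕ} {ω : Finset (Fin m) → A} (h : IsForm p ω) : IsForm p (-ω) :=
  fun S hS => by rw [Pi.neg_apply, h S hS, neg_zero]

lemma IsForm.sub {p : ℕ} {ω η : Finset (Fin m) → A} (h : IsForm p ω) (h' : IsForm p η) :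
    IsForm p (ω - η) := fun S hS => by rw [Pi.sub_apply, h S hS, h' S hS, sub_zero]

lemma IsForm.smul {p : ℕ} {ω : Finset (Fin m) → A} (c : A) (h : IsForm p ω) : IsForm p (c • ω) :=
  fun S hS => by rw [Pi.smul_apply, h S hS, smul_zero]

lemma IsForm.contrMap {p : ℕ} {ω : Finset (Fin m) → A} (h : IsForm (p + 1) ω) (f : Fin m → A) :
    IsForm p (contrMap f ω) := by
  intro T hT
  rw [contrMap_apply]
  refine Finset.sum_eq_zero fun S _ => ?_
  by_cases hS : S.card = p + 1
  · rw [contr_card (by omega), zero_mul]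
  · rw [h S hS, mul_zero]

lemma IsForm.eq_zero_of_lt {p : ℕ} {ω : Finset (Fin m) → A} (h : IsForm p ω) (hp : m < p) :
    ω = 0 := by
  ext1 S
  refine h S fun hS => ?_
  have := S.card_le_univ
  rw [Fintype.card_fin] at this
  omega

lemma contr_empty_singleton (f : Fin m → A) (T : Finset (Fin m)) (j : Fin m) :
    contr f T {j} = if T = ∅ then f j else 0 := by
  simp [contr, Finset.filter_singleton]

/-- The image of contraction in degree `0`. -/
lemma IsForm.mem_span_iff {ω : Finset (Fin m) → A} (h : IsForm 0 ω) (f : Fin m → A) :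
    ω ∅ ∈ Ideal.span (Set.range f) ↔ ∃ γ, IsForm 1 γ ∧ ArithCurve.contrMap f γ = ω := by
  rw [Ideal.mem_span_range_iff_exists_fun]
  constructor
  · rintro ⟨c, hc⟩
    refine ⟨fun S => ∑ j, if S = {j} then c j else 0, fun S hS => ?_, ?_⟩
    · refine Finset.sum_eq_zero fun j _ => if_neg ?_
      rintro rfl
      simp at hS
    · ext1 T
      rw [contrMap_apply]
      simp only [Finset.mul_sum, mul_ite, mul_zero]
      rw [Finset.sum_comm]
      simp only [Finset.sum_ite_eq', Finset.mem_univ, if_true, contr_empty_singleton]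
      by_cases hT : T = ∅
      · subst hT
        rw [← hc]
        simp [mul_comm]
      · rw [h T (by simpa using hT)]
        simp [hT]
  · rintro ⟨γ, hγ, rfl⟩
    refine ⟨fun j => γ {j}, ?_⟩
    rw [contrMap_apply]
    symm
    have hinj : Function.Injective fun j : Fin m => ({j} : Finset (Fin m)) :=
      Finset.singleton_injective
    rw [← Finset.sum_subset (Finset.subset_univ (Finset.univ.map ⟨_, hinj⟩)), Finset.sum_map]
    · refine Finset.sum_congr rfl fun j _ => ?_
      simp [contr_empty_singleton, mul_comm]
    · intro S _ hS
      rw [hγ S, mul_zero]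
      intro hc
      obtain ⟨j, rfl⟩ := Finset.card_eq_one.1 hc
      exact hS (by simp)

/-- The component of `ω` without the last basis vector. -/
def formLo (ω : Finset (Fin (m + 1)) → A) (S : Finset (Fin m)) : A := ω (S.map Fin.castSuccEmb)

/-- The component of `ω` with the last basis vector. -/
def formHi (ω : Finset (Fin (m + 1)) → A) (S : Finset (Fin m)) : A :=
  ω (insert (Fin.last m) (S.map Fin.castSuccEmb))

lemma last_notMem_map (S : Finset (Fin m)) : Fin.last m ∉ S.map Fin.castSuccEmb := by
  simp [Fin.castSucc_ne_last]

lemma eq_map_or_insert (S : Finset (Fin (m + 1))) :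
    (∃ T : Finset (Fin m), S = T.map Fin.castSuccEmb) ∨
      ∃ T : Finset (Fin m), S = insert (Fin.last m) (T.map Fin.castSuccEmb) := by
  have h : ∀ S : Finset (Fin (m + 1)), Fin.last m ∉ S →
      S = (Finset.univ.filter fun i : Fin m => i.castSucc ∈ S).map Fin.castSuccEmb := by
    intro S hS
    ext i
    refine Fin.lastCases ?_ (fun j => ?_) i
    · exact iff_of_false hS (last_notMem_map _)
    · simp
  by_cases hS : Fin.last m ∈ S
  · refine .inr ⟨Finset.univ.filter fun i : Fin m => i.castSucc ∈ S.erase (Fin.last m), ?_⟩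
    rw [← h _ (Finset.notMem_erase _ _), Finset.insert_erase hS]
  · exact .inl ⟨_, h S hS⟩

lemma form_ext {A : Type*} {ω η : Finset (Fin (m + 1)) → A} (h1 : formLo ω = formLo η)
    (h2 : formHi ω = formHi η) : ω = η := by
  ext1 S
  rcases eq_map_or_insert S with ⟨T, rfl⟩ | ⟨T, rfl⟩
  · exact congrFun h1 T
  · exact congrFun h2 T

lemma insert_map_injective : Function.Injective fun T : Finset (Fin m) =>
    insert (Fin.last m) (T.map Fin.castSuccEmb) := by
  intro T T' h
  have := congrArg (fun S => S.erase (Fin.last m)) h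
  simp only [Finset.erase_insert (last_notMem_map _)] at this
  exact Finset.map_injective _ this

/-- A form is determined by its two components, which are arbitrary. -/
lemma exists_form {A : Type*} (α β : Finset (Fin m) → A) :
    ∃ ω : Finset (Fin (m + 1)) → A, formLo ω = α ∧ formHi ω = β := by
  refine ⟨fun S => if Fin.last m ∈ S then β (Finset.univ.filter fun i : Fin m => i.castSucc ∈ S)
    else α (Finset.univ.filter fun i : Fin m => i.castSucc ∈ S), ?_, ?_⟩
  · ext1 S
    rw [formLo, if_neg (last_notMem_map S)]
    congr 1
    ext i
    simp
  · ext1 S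
    rw [formHi, if_pos (Finset.mem_insert_self _ _)]
    congr 1
    ext i
    simp [Fin.castSucc_ne_last]

lemma isForm_succ_iff {p : ℕ} {ω : Finset (Fin (m + 1)) → A} :
    IsForm (p + 1) ω ↔ IsForm (p + 1) (formLo ω) ∧ IsForm p (formHi ω) := by
  constructor
  · intro h
    refine ⟨fun S hS => h _ (by simpa using hS), fun S hS => h _ ?_⟩
    rw [Finset.card_insert_of_notMem (last_notMem_map S), Finset.card_map]
    omega
  · rintro ⟨h1, h2⟩ S hS
    rcases eq_map_or_insert S with ⟨T, rfl⟩ | ⟨T, rfl⟩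
    · exact h1 T (by simpa using hS)
    · refine h2 T ?_
      rw [Finset.card_insert_of_notMem (last_notMem_map T), Finset.card_map] at hS
      omega

lemma sum_finset_succ (g : Finset (Fin (m + 1)) → A) :
    ∑ S, g S = ∑ T : Finset (Fin m), g (T.map Fin.castSuccEmb) +
      ∑ T : Finset (Fin m), g (insert (Fin.last m) (T.map Fin.castSuccEmb)) := by
  rw [← Finset.sum_filter_add_sum_filter_not Finset.univ (fun S => Fin.last m ∉ S)]
  congr 1
  · symm
    refine Finset.sum_bij (fun T _ => T.map Fin.castSuccEmb) (by simp)
      (fun T _ T' _ h => Finset.map_injective _ h) ?_ (by simp)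
    intro S hS
    rcases eq_map_or_insert S with ⟨T, rfl⟩ | ⟨T, rfl⟩
    · exact ⟨T, Finset.mem_univ _, rfl⟩
    · simp at hS
  · symm
    refine Finset.sum_bij (fun T _ => insert (Fin.last m) (T.map Fin.castSuccEmb)) (by simp)
      (fun T _ T' _ h => insert_map_injective h) ?_ (by simp)
    intro S hS
    rcases eq_map_or_insert S with ⟨T, rfl⟩ | ⟨T, rfl⟩
    · simp at hS
    · exact ⟨T, Finset.mem_univ _, rfl⟩

lemma filter_lt_map_castSucc (S : Finset (Fin m)) (j : Fin m) :
    ((S.map Fin.castSuccEmb).filter (· < Fin.castSuccEmb j)).card = (S.filter (· < j)).card := by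
  rw [Finset.filter_map, Finset.card_map]
  rfl

lemma contr_map_map (f : Fin (m + 1) → A) (T S : Finset (Fin m)) :
    contr f (T.map Fin.castSuccEmb) (S.map Fin.castSuccEmb) =
      contr (fun j => f j.castSucc) T S := by
  unfold contr
  rw [Finset.sum_map]
  refine Finset.sum_congr rfl fun j _ => ?_
  rw [← Finset.map_erase]
  rw [filter_lt_map_castSucc]
  simp only [Finset.map_inj, Fin.castSuccEmb_apply]

lemma contr_insert_map (f : Fin (m + 1) → A) (T S : Finset (Fin m)) :
    contr f (insert (Fin.last m) (T.map Fin.castSuccEmb)) (S.map Fin.castSuccEmb) = 0 := by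
  unfold contr
  refine Finset.sum_eq_zero fun j _ => if_neg fun h => last_notMem_map S ?_
  exact Finset.mem_of_mem_erase (h ▸ Finset.mem_insert_self _ _)

lemma contr_map_insert (f : Fin (m + 1) → A) (T S : Finset (Fin m)) :
    contr f (T.map Fin.castSuccEmb) (insert (Fin.last m) (S.map Fin.castSuccEmb)) =
      if T = S then (-1) ^ S.card * f (Fin.last m) else 0 := by
  unfold contr
  rw [Finset.sum_insert (last_notMem_map S), Finset.erase_insert (last_notMem_map S),
    Finset.sum_eq_zero, add_zero]
  · rw [Finset.filter_insert, if_neg (lt_irrefl _), Finset.filter_true_of_mem, Finset.card_map]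
    · simp only [Finset.map_inj]
    · intro i hi
      simp only [Finset.mem_map, Fin.castSuccEmb_apply] at hi
      obtain ⟨i, _, rfl⟩ := hi
      exact Fin.castSucc_lt_last i
  · intro j hj
    refine if_neg fun h => last_notMem_map T ?_
    rw [h]
    refine Finset.mem_erase.2 ⟨?_, Finset.mem_insert_self _ _⟩
    rintro rfl
    exact last_notMem_map S hj

lemma contr_insert_insert (f : Fin (m + 1) → A) (T S : Finset (Fin m)) :
    contr f (insert (Fin.last m) (T.map Fin.castSuccEmb))
      (insert (Fin.last m) (S.map Fin.castSuccEmb)) = contr (fun j => f j.castSucc) T S := by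
  unfold contr
  rw [Finset.sum_insert (last_notMem_map S), Finset.erase_insert (last_notMem_map S), if_neg,
    zero_add, Finset.sum_map]
  · refine Finset.sum_congr rfl fun j _ => ?_
    rw [Finset.erase_insert_of_ne (by simp [Fin.ext_iff]; omega), ← Finset.map_erase,
      Finset.filter_insert, if_neg (Fin.le_last _).not_gt, filter_lt_map_castSucc]
    have : ∀ U, insert (Fin.last m) (T.map Fin.castSuccEmb) =
        insert (Fin.last m) (U.map Fin.castSuccEmb) ↔ T = U :=
      fun U => ⟨fun h => insert_map_injective h, fun h => by rw [h]⟩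
    simp only [this, Fin.castSuccEmb_apply]
  · intro h
    exact last_notMem_map S (h ▸ Finset.mem_insert_self _ _)

/-- The last vector comes after all others, so its presence changes no sign when another vector is
removed. -/
lemma formHi_contrMap (f : Fin (m + 1) → A) (ω : Finset (Fin (m + 1)) → A) :
    formHi (contrMap f ω) = contrMap (fun j => f j.castSucc) (formHi ω) := by
  ext1 T
  rw [formHi, contrMap_apply, sum_finset_succ]
  simp only [contr_insert_map, contr_insert_insert, zero_mul, Finset.sum_const_zero, zero_add]
  rfl

/-- Removing the last vector passes `p` others, whence the sign. Together with `formHi_contrMap`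
this exhibits the Koszul complex of `m + 1` elements as a cone, which drives both inductions on the
number of columns. -/
lemma formLo_contrMap (f : Fin (m + 1) → A) {ω : Finset (Fin (m + 1)) → A} {p : ℕ}
    (h : IsForm p (formHi ω)) :
    formLo (contrMap f ω) = contrMap (fun j => f j.castSucc) (formLo ω) +
      ((-1) ^ p * f (Fin.last m)) • formHi ω := by
  ext1 T
  rw [formLo, contrMap_apply, sum_finset_succ]
  simp only [contr_map_map, contr_map_insert, ite_mul, zero_mul, Finset.sum_ite_eq,
    Finset.mem_univ, if_true]
  rw [Pi.add_apply, Pi.smul_apply, smul_eq_mul]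
  congr 1
  by_cases hT : T.card = p
  · rw [hT]; rfl
  · rw [h T hT, show ω _ = formHi ω T from rfl, h T hT, mul_zero, mul_zero]

end Forms

/-! ### Exactness of contractions by induction on the number of columns. -/

section Exactness

/-- The first `m` terms of a sequence. -/
def initSeq {A : Type*} (f : ℕ → A) (m : ℕ) : Fin m → A := fun j => f j

lemma initSeq_castSucc {A : Type*} (f : ℕ → A) (m : ℕ) :
    (fun j : Fin m => initSeq f (m + 1) j.castSucc) = initSeq f m := rfl

lemma initSeq_last {A : Type*} (f : ℕ → A) (m : ℕ) : initSeq f (m + 1) (Fin.last m) = f m := rfl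

variable {A : Type*} [CommRing A]

/-- The Koszul complex of a regular sequence is exact in positive degrees. -/
theorem exists_contrMap_eq (f : ℕ → A) {m : ℕ}
    (hreg : ∀ j < m, ∀ β, f j * β ∈ Ideal.span (Set.range (initSeq f j)) →
      β ∈ Ideal.span (Set.range (initSeq f j)))
    {p : ℕ} {ω : Finset (Fin m) → A} (hω : IsForm (p + 1) ω) (h0 : contrMap (initSeq f m) ω = 0) :
    ∃ η, IsForm (p + 2) η ∧ contrMap (initSeq f m) η = ω := by
  induction m generalizing p with
  | zero => exact ⟨0, isForm_zero, by rw [map_zero, hω.eq_zero_of_lt (by omega)]⟩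
  | succ m ih =>
    have ih' := fun {p} {ω} => ih (fun j hj => hreg j (by omega)) (p := p) (ω := ω)
    obtain ⟨hlo, hhi⟩ := isForm_succ_iff.1 hω
    have h1 : contrMap (initSeq f m) (formHi ω) = 0 := by
      rw [← initSeq_castSucc, ← formHi_contrMap, h0]; rfl
    have h2 : contrMap (initSeq f m) (formLo ω) + ((-1) ^ p * f m) • formHi ω = 0 := by
      rw [← initSeq_castSucc, ← initSeq_last f m, ← formLo_contrMap _ hhi, h0]; rfl
    -- The component with the last vector is a cycle. In positive degree it bounds by induction; in
    -- degree 0 regularity of `f m` modulo the earlier elements is used.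
    obtain ⟨γ, hγ, hγ'⟩ : ∃ γ, IsForm (p + 1) γ ∧ contrMap (initSeq f m) γ = formHi ω := by
      cases p with
      | zero =>
        rw [← hhi.mem_span_iff]
        refine hreg m (by omega) _ ?_
        have h3 : f m * formHi ω ∅ = contrMap (initSeq f m) (-formLo ω) ∅ := by
          have := congrFun h2 ∅
          simp only [Pi.add_apply, Pi.smul_apply, pow_zero, one_mul, Pi.zero_apply,
            smul_eq_mul] at this
          rw [map_neg, Pi.neg_apply]
          exact (neg_eq_of_add_eq_zero_right this).symm
        rw [h3]
        exact ((hlo.neg.contrMap _).mem_span_iff _).2 ⟨_, hlo.neg, rfl⟩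
      | succ p => exact ih' hhi h1
    -- With `γ` as upper component, what remains of the lower component is a cycle on `m` columns.
    -- The exponent is `p + 1` because `γ` has degree `p + 1`.
    obtain ⟨δ, hδ, hδ'⟩ := ih' (ω := formLo ω - ((-1) ^ (p + 1) * f m) • γ)
      (hlo.sub (hγ.smul _)) (by
        rw [map_sub, map_smul, hγ', ← h2, pow_succ]
        module)
    obtain ⟨η, hη1, hη2⟩ := exists_form δ γ
    refine ⟨η, isForm_succ_iff.2 ⟨hη1 ▸ hδ, hη2 ▸ hγ⟩, form_ext ?_ ?_⟩
    · rw [formLo_contrMap (p := p + 1) _ (hη2 ▸ hγ), initSeq_castSucc, initSeq_last, hη1, hη2, hδ']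
      abel
    · rw [formHi_contrMap, initSeq_castSucc, hη2, hγ']

/-- A form of degree at least two killed by the product of the contractions by `x` and `y` is a sum
of images of these contractions, provided that this holds for the obstructions in degree one. -/
theorem exists_contrMap_add_eq (x y : ℕ → A) {m : ℕ}
    (hreg : ∀ j < m, ∀ α β : Finset (Fin j) → A, IsForm 2 α → IsForm 1 β →
      contrMap (initSeq y j) (contrMap (initSeq x j) α) +
        (y j • contrMap (initSeq x j) β - x j • contrMap (initSeq y j) β) = 0 →
      ∃ γ δ, IsForm 2 γ ∧ IsForm 2 δ ∧
        contrMap (initSeq x j) γ + contrMap (initSeq y j) δ = β)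
    {p : ℕ} {ω : Finset (Fin m) → A} (hω : IsForm (p + 2) ω)
    (h0 : contrMap (initSeq y m) (contrMap (initSeq x m) ω) = 0) :
    ∃ γ δ, IsForm (p + 3) γ ∧ IsForm (p + 3) δ ∧
      contrMap (initSeq x m) γ + contrMap (initSeq y m) δ = ω := by
  induction m generalizing p with
  | zero =>
    exact ⟨0, 0, isForm_zero, isForm_zero,
      by rw [map_zero, map_zero, add_zero, hω.eq_zero_of_lt (by omega)]⟩
  | succ m ih =>
    have ih' := fun {p} {ω} => ih (fun j hj => hreg j (by omega)) (p := p) (ω := ω)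
    obtain ⟨hlo, hhi⟩ := isForm_succ_iff.1 hω
    have h1 : contrMap (initSeq y m) (contrMap (initSeq x m) (formHi ω)) = 0 := by
      rw [← initSeq_castSucc y, ← initSeq_castSucc x, ← formHi_contrMap, ← formHi_contrMap, h0]
      rfl
    have hX : formHi (contrMap (initSeq x (m + 1)) ω) = contrMap (initSeq x m) (formHi ω) := by
      rw [formHi_contrMap, initSeq_castSucc]
    have h2 : contrMap (initSeq y m) (contrMap (initSeq x m) (formLo ω)) +
        (-1 : A) ^ p • (y m • contrMap (initSeq x m) (formHi ω) -
          x m • contrMap (initSeq y m) (formHi ω)) = 0 := by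
      have h3 : formLo (contrMap (initSeq y (m + 1)) (contrMap (initSeq x (m + 1)) ω)) = 0 := by
        rw [h0]; rfl
      rw [formLo_contrMap (p := p) _ (hX ▸ hhi.contrMap _), formLo_contrMap _ hhi, hX,
        initSeq_castSucc, initSeq_castSucc, initSeq_last, initSeq_last, map_add, map_smul] at h3
      rw [← h3, pow_succ]
      module
    -- The upper component has degree `p + 1`. The induction hypothesis requires degree at least
    -- two, so degree one is exactly where `hreg` enters.
    obtain ⟨γ, δ, hγ, hδ, hγδ⟩ : ∃ γ δ, IsForm (p + 2) γ ∧ IsForm (p + 2) δ ∧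
        contrMap (initSeq x m) γ + contrMap (initSeq y m) δ = formHi ω := by
      cases p with
      | zero => exact hreg m (by omega) _ _ hlo hhi (by simpa using h2)
      | succ p => exact ih' hhi h1
    -- The subtracted term is the contribution of the upper components `γ`, `δ` to the lower one.
    -- Substituting their relation into `h2` shows that the rest is killed by the composite
    -- contraction.
    obtain ⟨γ₀, δ₀, hγ₀, hδ₀, hγδ₀⟩ := ih'
      (ω := formLo ω - (-1 : A) ^ p • (x m • γ + y m • δ))
      (hlo.sub (((hγ.smul _).add (hδ.smul _)).smul _)) (by
        rw [← hγδ] at h2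
        simp only [map_add, map_sub, map_smul, contrMap_sq, contrMap_anticomm (initSeq y m)
          (initSeq x m)] at h2 ⊢
        rw [← h2]
        module)
    obtain ⟨γ', hγ1, hγ2⟩ := exists_form γ₀ γ
    obtain ⟨δ', hδ1, hδ2⟩ := exists_form δ₀ δ
    refine ⟨γ', δ', isForm_succ_iff.2 ⟨hγ1 ▸ hγ₀, hγ2 ▸ hγ⟩,
      isForm_succ_iff.2 ⟨hδ1 ▸ hδ₀, hδ2 ▸ hδ⟩, form_ext ?_ ?_⟩
    · change formLo (contrMap (initSeq x (m + 1)) γ') + formLo (contrMap (initSeq y (m + 1)) δ') = _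
      rw [formLo_contrMap (p := p + 2) _ (hγ2 ▸ hγ), formLo_contrMap (p := p + 2) _ (hδ2 ▸ hδ),
        initSeq_castSucc, initSeq_castSucc, initSeq_last, initSeq_last, hγ1, hγ2, hδ1, hδ2,
        ← sub_eq_zero, ← sub_eq_zero.2 hγδ₀, pow_add]
      module
    · change formHi (contrMap (initSeq x (m + 1)) γ') + formHi (contrMap (initSeq y (m + 1)) δ') = _
      rw [formHi_contrMap, formHi_contrMap, initSeq_castSucc, initSeq_castSucc, hγ2, hδ2, hγδ]

end Exactness

/-! ### Exactness of the symmetric and divided power strands. -/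

section Strands

variable {A : Type*} [CommRing A] {n : ℕ}

/-- Exactness of the strands `⋀^p ⊗ Sym` for a notion `Z r` of cycles `(ω_0, …, ω_r)` that is
stable under removing the first component. -/
lemma exists_strand_eq (x y : Fin n → A) {p : ℕ} (Z : ℕ → (ℕ → Finset (Fin n) → A) → Prop)
    (h0 : ∀ ω, Z 0 ω → ∃ β, IsForm (p + 2) β ∧ contrMap y (contrMap x β) = ω 0)
    (hs : ∀ r ω, Z (r + 1) ω → ∃ η, IsForm (p + 1) η ∧ contrMap x η = ω 0 ∧
      Z r (fun q => if q = 0 then ω 1 - contrMap y η else ω (q + 1)))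
    (r : ℕ) (ω : ℕ → Finset (Fin n) → A) (hω : Z (r + 1) ω) :
    ∃ η : ℕ → Finset (Fin n) → A, (∀ q, IsForm (p + 1) (η q)) ∧ contrMap x (η 0) = ω 0 ∧
      (∀ q < r, contrMap x (η (q + 1)) + contrMap y (η q) = ω (q + 1)) ∧
      contrMap y (η r) = ω (r + 1) := by
  induction r generalizing ω with
  | zero =>
    obtain ⟨η, hη, hη0, hZ⟩ := hs 0 ω hω
    obtain ⟨β, hβ, hβ'⟩ := h0 _ hZ
    -- Adding `contrMap x β` does not affect the first equation, since contraction by `x` squares to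
    -- zero, and it repairs the last one.
    refine ⟨fun _ => η + contrMap x β, fun _ => hη.add (hβ.contrMap _), ?_, by simp, ?_⟩
    · rw [map_add, contrMap_sq, add_zero, hη0]
    · rw [map_add, hβ', if_pos rfl]
      abel
  | succ r ih =>
    obtain ⟨η, hη, hη0, hZ⟩ := hs (r + 1) ω hω
    obtain ⟨θ, hθ, hθ0, hθs, hθl⟩ := ih _ hZ
    refine ⟨fun q => Nat.casesOn q η θ, fun q => ?_, hη0, fun q hq => ?_, ?_⟩
    · cases q with
      | zero => exact hη
      | succ q => exact hθ q
    · cases q with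
      | zero =>
        change contrMap x (θ 0) + contrMap y η = _
        rw [hθ0, if_pos rfl]
        abel
      | succ q =>
        change contrMap x (θ (q + 1)) + contrMap y (θ q) = _
        rw [hθs q (by omega), if_neg (by omega)]
    · change contrMap y (θ r) = _
      rw [hθl, if_neg (by omega)]

/-- The contractions by `x` and `y` have the exactness properties that hold for the rows of a
sufficiently general matrix. -/
structure ExactPair (x y : Fin n → A) : Prop where
  left : ∀ {p : ℕ} {ω : Finset (Fin n) → A}, IsForm (p + 1) ω → contrMap x ω = 0 →
    ∃ η, IsForm (p + 2) η ∧ contrMap x η = ω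
  both : ∀ {p : ℕ} {ω : Finset (Fin n) → A}, IsForm (p + 2) ω → contrMap y (contrMap x ω) = 0 →
    ∃ γ δ, IsForm (p + 3) γ ∧ IsForm (p + 3) δ ∧ contrMap x γ + contrMap y δ = ω

/-- Exactness at `⋀^{p+1} ⊗ Sym_0`. -/
lemma ExactPair.exists_eq {x y : Fin n → A} (h : ExactPair x y) {p : ℕ} {ω : Finset (Fin n) → A}
    (hω : IsForm (p + 1) ω) (hx : contrMap x ω = 0) (hy : contrMap y ω = 0) :
    ∃ β, IsForm (p + 3) β ∧ contrMap y (contrMap x β) = ω := by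
  obtain ⟨η, hη, rfl⟩ := h.left hω hx
  obtain ⟨γ, δ, hγ, hδ, rfl⟩ := h.both hη hy
  -- Writing x and y for the contractions: ω = xη and yxη = 0, so η = xγ + yδ and ω = xyδ = -yxδ.
  refine ⟨-δ, hδ.neg, ?_⟩
  rw [map_add, contrMap_sq, zero_add, map_neg, map_neg, contrMap_anticomm x y]

/-- Exactness at `⋀^{p+1} ⊗ Sym_{r+1}`. -/
lemma ExactPair.exists_symm_eq {x y : Fin n → A} (h : ExactPair x y) {p r : ℕ}
    {ω : ℕ → Finset (Fin n) → A} (hω : ∀ q ≤ r + 1, IsForm (p + 1) (ω q))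
    (hx : contrMap x (ω 0) = 0)
    (hs : ∀ q < r + 1, contrMap x (ω (q + 1)) + contrMap y (ω q) = 0)
    (hy : contrMap y (ω (r + 1)) = 0) :
    ∃ η : ℕ → Finset (Fin n) → A, (∀ q, IsForm (p + 2) (η q)) ∧ contrMap x (η 0) = ω 0 ∧
      (∀ q < r, contrMap x (η (q + 1)) + contrMap y (η q) = ω (q + 1)) ∧
      contrMap y (η r) = ω (r + 1) := by
  refine exists_strand_eq x y (p := p + 1) (fun r ω => (∀ q ≤ r, IsForm (p + 1) (ω q)) ∧
    contrMap x (ω 0) = 0 ∧ (∀ q < r, contrMap x (ω (q + 1)) + contrMap y (ω q) = 0) ∧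
    contrMap y (ω r) = 0) ?_ ?_ r ω ⟨hω, hx, hs, hy⟩
  · rintro ω ⟨h1, h2, -, h3⟩
    exact h.exists_eq (h1 0 le_rfl) h2 h3
  · rintro r ω ⟨h1, h2, h3, h4⟩
    obtain ⟨η, hη, hη'⟩ := h.left (h1 0 (by omega)) h2
    refine ⟨η, hη, hη', fun q hq => ?_, ?_, fun q hq => ?_, ?_⟩
    · dsimp only
      split_ifs
      · exact (h1 1 (by omega)).sub (hη.contrMap y)
      · exact h1 _ (by omega)
    · dsimp only
      rw [if_pos rfl, map_sub, contrMap_anticomm, hη', sub_neg_eq_add]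
      exact h3 0 (by omega)
    · dsimp only
      rw [if_neg (by omega)]
      split_ifs with hq0
      · rw [map_sub, contrMap_sq, sub_zero, hq0]
        exact h3 1 (by omega)
      · exact h3 (q + 1) (by omega)
    · dsimp only
      split_ifs with hr
      · rw [map_sub, contrMap_sq, sub_zero]
        simpa [hr] using h4
      · exact h4

/-- Exactness at `⋀^{p+2} ⊗ D_r`. -/
lemma ExactPair.exists_div_eq {x y : Fin n → A} (h : ExactPair x y) {p r : ℕ}
    {ω : ℕ → Finset (Fin n) → A} (hω : ∀ q ≤ r, IsForm (p + 2) (ω q))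
    (hs : ∀ q < r, contrMap x (ω q) + contrMap y (ω (q + 1)) = 0)
    (h0 : r = 0 → contrMap y (contrMap x (ω 0)) = 0) :
    ∃ η : ℕ → Finset (Fin n) → A, (∀ q, IsForm (p + 3) (η q)) ∧
      ∀ q ≤ r, contrMap x (η q) + contrMap y (η (q + 1)) = ω q := by
  induction r generalizing ω with
  | zero =>
    obtain ⟨γ, δ, hγ, hδ, hγδ⟩ := h.both (hω 0 le_rfl) (h0 rfl)
    refine ⟨fun q => if q = 0 then γ else δ, fun q => ?_, fun q hq => ?_⟩
    · dsimp only
      split_ifs <;> assumption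
    · obtain rfl : q = 0 := by omega
      simpa using hγδ
  | succ r ih =>
    -- The tail is solved before the first component. If the tail has only one component, the
    -- condition it needs comes from contracting the first cycle equation by `x`.
    obtain ⟨θ, hθ, hθ'⟩ := ih (ω := fun q => ω (q + 1)) (fun q hq => hω _ (by omega))
      (fun q hq => hs _ (by omega)) (fun hr => by
        subst hr
        have := congrArg (contrMap x) (hs 0 (by omega))
        rw [map_add, contrMap_sq, zero_add, map_zero, contrMap_anticomm, neg_eq_zero] at this
        exact this)
    -- The first equation then asks for a preimage under `x`. Its right-hand side is killed by `x`
    -- because of the first equation of the tail and the first cycle condition.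
    obtain ⟨ζ, hζ, hζ'⟩ := h.left (ω := ω 0 - contrMap y (θ 0))
      ((hω 0 (by omega)).sub ((hθ 0).contrMap y)) (by
        have h1 := congrArg (contrMap y) (hθ' 0 (by omega))
        rw [map_add, contrMap_sq, add_zero] at h1
        rw [map_sub, contrMap_anticomm x y, sub_neg_eq_add, h1]
        exact hs 0 (by omega))
    refine ⟨fun q => Nat.casesOn q ζ θ, fun q => ?_, fun q hq => ?_⟩
    · cases q with
      | zero => exact hζ
      | succ q => exact hθ q
    · cases q with
      | zero =>
        change contrMap x ζ + contrMap y (θ 0) = _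
        rw [hζ']
        abel
      | succ q => exact hθ' q (by omega)

/-- Forms with coefficients indexed by `q < N`, from their coordinates. -/
def toForm {p N : ℕ} (v : {S : Finset (Fin n) // S.card = p} × Fin N → A) (q : ℕ)
    (S : Finset (Fin n)) : A :=
  if h : S.card = p ∧ q < N then v (⟨S, h.1⟩, ⟨q, h.2⟩) else 0

lemma isForm_toForm {p N : ℕ} (v : {S : Finset (Fin n) // S.card = p} × Fin N → A) (q : ℕ) :
    IsForm p (toForm v q) := fun _ hS => dif_neg fun h => hS h.1

lemma toForm_of_le {p N : ℕ} (v : {S : Finset (Fin n) // S.card = p} × Fin N → A) {q : ℕ}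
    (hq : N ≤ q) : toForm v q = 0 := by
  ext1 S
  exact dif_neg fun h => by omega

lemma toForm_apply {p N : ℕ} (v : {S : Finset (Fin n) // S.card = p} × Fin N → A)
    (b : {S : Finset (Fin n) // S.card = p} × Fin N) : toForm v b.2 b.1.1 = v b :=
  dif_pos ⟨b.1.2, b.2.2⟩

lemma toForm_eq {p N : ℕ} {η : ℕ → Finset (Fin n) → A} {q : ℕ} (h : IsForm p (η q))
    (hq : q < N) :
    toForm (fun b : {S : Finset (Fin n) // S.card = p} × Fin N => η b.2 b.1.1) q = η q := by
  ext1 S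
  unfold toForm
  split_ifs with h'
  · rfl
  · exact (h S fun hS => h' ⟨hS, hq⟩).symm

lemma toForm_eq_zero_iff {p N : ℕ} {v : {S : Finset (Fin n) // S.card = p} × Fin N → A} :
    v = 0 ↔ ∀ q < N, toForm v q = 0 := by
  constructor
  · rintro rfl q hq
    ext1 S
    unfold toForm
    split_ifs <;> rfl
  · intro h
    ext1 b
    rw [← toForm_apply v b, h b.2 b.2.2]
    rfl

/-- The sum over the coordinates `(S, q)` with a fixed value of `q`, in terms of contractions. -/
lemma sum_ite_contr_mul (f : Fin n → A) {p N : ℕ}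
    (v : {S : Finset (Fin n) // S.card = p} × Fin N → A) (e : ℕ) (T : Finset (Fin n)) :
    ∑ b : {S : Finset (Fin n) // S.card = p} × Fin N,
      (if (b.2 : ℕ) = e then contr f T b.1.1 else 0) * v b = contrMap f (toForm v e) T := by
  rw [Fintype.sum_prod_type, contrMap_apply]
  have h1 : ∀ S : Finset (Fin n), S ∉ Finset.univ.filter
      (fun S : Finset (Fin n) => S.card = p) → contr f T S * toForm v e S = 0 := by
    intro S hS
    rw [isForm_toForm v e S (by simpa using hS), mul_zero]
  rw [← Finset.sum_subset (Finset.subset_univ _) (fun S _ hS => h1 S hS),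
    Finset.sum_subtype (p := fun S : Finset (Fin n) => S.card = p) _ (by simp)]
  refine Finset.sum_congr rfl fun S _ => ?_
  simp only [ite_mul, zero_mul]
  by_cases he : e < N
  · have h2 : ∀ q : Fin N, (q : ℕ) = e ↔ q = ⟨e, he⟩ := fun q => by rw [Fin.ext_iff]
    simp only [h2, Finset.sum_ite_eq', Finset.mem_univ, if_true]
    rw [toForm, dif_pos ⟨S.2, he⟩]
  · rw [toForm_of_le v (by omega), Pi.zero_apply, mul_zero]
    exact Finset.sum_eq_zero fun q _ => if_neg (by have := q.2; omega)

end Strands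

/-! ### The strands in coordinates. -/

section StrandMatrices

variable {A : Type*} [CommRing A] {n : ℕ}

/-- The matrix of `⋀^{p'} ⊗ Sym_{N'-1} → ⋀^p ⊗ Sym_{N-1}`. -/
def symMat (x y : Fin n → A) (p N p' N' : ℕ) :
    Matrix ({S : Finset (Fin n) // S.card = p} × Fin N)
      ({S : Finset (Fin n) // S.card = p'} × Fin N') A :=
  Matrix.of fun t b => (if (b.2 : ℕ) = t.2 then contr x t.1.1 b.1.1 else 0) +
    (if (b.2 : ℕ) + 1 = t.2 then contr y t.1.1 b.1.1 else 0)

/-- The matrix of `⋀^{p'} ⊗ D_{N'-1} → ⋀^p ⊗ D_{N-1}`. -/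
def divMat (x y : Fin n → A) (p N p' N' : ℕ) :
    Matrix ({S : Finset (Fin n) // S.card = p} × Fin N)
      ({S : Finset (Fin n) // S.card = p'} × Fin N') A :=
  Matrix.of fun t b => (if (b.2 : ℕ) = t.2 then contr x t.1.1 b.1.1 else 0) +
    (if (b.2 : ℕ) = t.2 + 1 then contr y t.1.1 b.1.1 else 0)

/-- The matrix of `⋀^{p'} ⊗ D_0 → ⋀^p ⊗ Sym_0`. -/
def spliceMat (x y : Fin n → A) (p N p' N' : ℕ) :
    Matrix ({S : Finset (Fin n) // S.card = p} × Fin N)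
      ({S : Finset (Fin n) // S.card = p'} × Fin N') A :=
  Matrix.of fun t b => ∑ V, contr y t.1.1 V * contr x V b.1.1

variable {x y : Fin n → A} {p N p' N' p'' N'' : ℕ}

lemma toForm_mulVec_eq {M : Matrix ({S : Finset (Fin n) // S.card = p} × Fin N)
      ({S : Finset (Fin n) // S.card = p'} × Fin N') A}
    {v : {S : Finset (Fin n) // S.card = p'} × Fin N' → A} {q : ℕ} (hq : q < N)
    {ω : Finset (Fin n) → A} (hω : IsForm p ω)
    (h : ∀ T : {S : Finset (Fin n) // S.card = p}, M.mulVec v (T, ⟨q, hq⟩) = ω T.1) :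
    toForm (M.mulVec v) q = ω := by
  ext1 T
  by_cases hT : T.card = p
  · rw [toForm, dif_pos ⟨hT, hq⟩]
    exact h ⟨T, hT⟩
  · rw [isForm_toForm _ _ T hT, hω T hT]

/-- Here and below the sizes are linked by equations instead of being substituted, because in
`enFamily` they are the case distinctions `famCard` and `famRank`. -/
lemma toForm_symMat_zero (hp : p' = p + 1) (hN : 0 < N)
    (v : {S : Finset (Fin n) // S.card = p'} × Fin N' → A) :
    toForm ((symMat x y p N p' N').mulVec v) 0 = contrMap x (toForm v 0) := by
  subst hp
  refine toForm_mulVec_eq hN ((isForm_toForm v 0).contrMap x) fun T => ?_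
  rw [← sum_ite_contr_mul, Matrix.mulVec, dotProduct]
  refine Finset.sum_congr rfl fun b _ => ?_
  simp [symMat]

lemma toForm_symMat_succ (hp : p' = p + 1) (hN : N = N' + 1)
    (v : {S : Finset (Fin n) // S.card = p'} × Fin N' → A) (q : ℕ) :
    toForm ((symMat x y p N p' N').mulVec v) (q + 1) =
      contrMap x (toForm v (q + 1)) + contrMap y (toForm v q) := by
  subst hp
  by_cases hq : q + 1 < N
  · refine toForm_mulVec_eq hq (((isForm_toForm v (q + 1)).contrMap x).add
      ((isForm_toForm v q).contrMap y)) fun T => ?_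
    rw [Pi.add_apply, ← sum_ite_contr_mul, ← sum_ite_contr_mul, ← Finset.sum_add_distrib,
      Matrix.mulVec, dotProduct]
    refine Finset.sum_congr rfl fun b _ => ?_
    simp [symMat, add_mul]
  · rw [toForm_of_le _ (by omega), toForm_of_le v (by omega), toForm_of_le v (by omega), map_zero,
      map_zero, add_zero]

lemma toForm_divMat (hp : p' = p + 1) {q : ℕ} (hq : q < N)
    (v : {S : Finset (Fin n) // S.card = p'} × Fin N' → A) :
    toForm ((divMat x y p N p' N').mulVec v) q =
      contrMap x (toForm v q) + contrMap y (toForm v (q + 1)) := by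
  subst hp
  refine toForm_mulVec_eq hq (((isForm_toForm v q).contrMap x).add
    ((isForm_toForm v (q + 1)).contrMap y)) fun T => ?_
  rw [Pi.add_apply, ← sum_ite_contr_mul, ← sum_ite_contr_mul, ← Finset.sum_add_distrib,
    Matrix.mulVec, dotProduct]
  refine Finset.sum_congr rfl fun b _ => ?_
  simp [divMat, add_mul]

lemma sum_splice_mul (v : {S : Finset (Fin n) // S.card = p'} × Fin 1 → A) (T : Finset (Fin n)) :
    ∑ b : {S : Finset (Fin n) // S.card = p'} × Fin 1,
      (∑ V, contr y T V * contr x V b.1.1) * v b = contrMap y (contrMap x (toForm v 0)) T := by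
  rw [contrMap_apply]
  simp only [← sum_ite_contr_mul, Finset.mul_sum, Finset.sum_mul]
  rw [Finset.sum_comm]
  refine Finset.sum_congr rfl fun V _ => Finset.sum_congr rfl fun b _ => ?_
  simp [mul_assoc]

lemma toForm_spliceMat (hp : p' = p + 2) (hN : 0 < N) (hN' : N' = 1)
    (v : {S : Finset (Fin n) // S.card = p'} × Fin N' → A) :
    toForm ((spliceMat x y p N p' N').mulVec v) 0 = contrMap y (contrMap x (toForm v 0)) := by
  subst hp hN'
  refine toForm_mulVec_eq hN (((isForm_toForm v 0).contrMap x).contrMap y) fun T => ?_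
  rw [← sum_splice_mul]
  rfl

lemma matrix_mul_eq_zero {I J L : Type*} [Fintype J] [Fintype L] [DecidableEq L] {M : Matrix I J A}
    {M' : Matrix J L A} (h : ∀ v, M.mulVec (M'.mulVec v) = 0) : M * M' = 0 := by
  apply Matrix.ext_of_mulVec_single
  intro l
  rw [← Matrix.mulVec_mulVec, h, Matrix.zero_mulVec]

lemma symMat_mul_symMat (hp : p' = p + 1) (hp' : p'' = p' + 1) (hN : N = N' + 1)
    (hN' : N' = N'' + 1) : symMat x y p N p' N' * symMat x y p' N' p'' N'' = 0 := by
  refine matrix_mul_eq_zero fun v => toForm_eq_zero_iff.2 fun q _ => ?_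
  cases q with
  | zero =>
    rw [toForm_symMat_zero hp (by omega), toForm_symMat_zero hp' (by omega), contrMap_sq]
  | succ q =>
    rw [toForm_symMat_succ hp hN, toForm_symMat_succ hp' hN', map_add, contrMap_sq, zero_add]
    cases q with
    | zero =>
      rw [toForm_symMat_zero hp' (by omega), contrMap_anticomm, neg_add_cancel]
    | succ q =>
      rw [toForm_symMat_succ hp' hN', map_add, contrMap_sq, add_zero, contrMap_anticomm,
        neg_add_cancel]

lemma symMat_mul_spliceMat (hp : p' = p + 1) (hp' : p'' = p' + 2) (hN : N = N' + 1)
    (hN' : N' = 1) (hN'' : N'' = 1) :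
    symMat x y p N p' N' * spliceMat x y p' N' p'' N'' = 0 := by
  refine matrix_mul_eq_zero fun v => toForm_eq_zero_iff.2 fun q hq => ?_
  cases q with
  | zero =>
    rw [toForm_symMat_zero hp (by omega), toForm_spliceMat hp' (by omega) hN'', contrMap_anticomm,
      contrMap_sq, map_zero, neg_zero]
  | succ q =>
    obtain rfl : q = 0 := by omega
    rw [toForm_symMat_succ hp hN, toForm_spliceMat hp' (by omega) hN'', contrMap_sq,
      toForm_of_le _ (by omega), map_zero, add_zero]

lemma spliceMat_mul_divMat (hp : p' = p + 2) (hp' : p'' = p' + 1) (hN : N = 1) (hN' : N' = 1) :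
    spliceMat x y p N p' N' * divMat x y p' N' p'' N'' = 0 := by
  refine matrix_mul_eq_zero fun v => toForm_eq_zero_iff.2 fun q hq => ?_
  obtain rfl : q = 0 := by omega
  rw [toForm_spliceMat hp (by omega) hN', toForm_divMat hp' (by omega), map_add, contrMap_sq,
    zero_add, contrMap_anticomm x y, map_neg, contrMap_sq, neg_zero]

lemma divMat_mul_divMat (hp : p' = p + 1) (hp' : p'' = p' + 1) (hN : N' = N + 1) :
    divMat x y p N p' N' * divMat x y p' N' p'' N'' = 0 := by
  refine matrix_mul_eq_zero fun v => toForm_eq_zero_iff.2 fun q hq => ?_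
  rw [toForm_divMat hp hq, toForm_divMat hp' (by omega), toForm_divMat hp' (by omega), map_add,
    map_add, contrMap_sq, contrMap_sq, zero_add, add_zero, contrMap_anticomm, neg_add_cancel]

lemma toForm_injective {v u : {S : Finset (Fin n) // S.card = p} × Fin N → A}
    (h : ∀ q < N, toForm v q = toForm u q) : v = u := by
  ext1 b
  rw [← toForm_apply v, ← toForm_apply u, h _ b.2.2]

lemma ExactPair.symMat_symMat (h : ExactPair x y) (hp : p' = p + 1) (hp' : p'' = p' + 1)
    (hN : N = N' + 1) (hN' : N' = N'' + 1) (hN'' : 0 < N'')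
    {v : {S : Finset (Fin n) // S.card = p'} × Fin N' → A}
    (hv : (symMat x y p N p' N').mulVec v = 0) :
    ∃ u, (symMat x y p' N' p'' N'').mulVec u = v := by
  have h0 := toForm_eq_zero_iff.1 hv
  obtain ⟨r, rfl⟩ : ∃ r, N'' = r + 1 := ⟨N'' - 1, by omega⟩
  subst hp
  obtain ⟨η, hη, hη0, hηs, hηr⟩ := h.exists_symm_eq (r := r) (fun q _ => isForm_toForm v q)
    ((toForm_symMat_zero (y := y) (N := N) rfl (by omega) v).symm.trans (h0 0 (by omega)))
    (fun q hq => by rw [← toForm_symMat_succ rfl hN, h0 _ (by omega)])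
    (by
      have := h0 (r + 2) (by omega)
      rwa [toForm_symMat_succ rfl hN, toForm_of_le v (by omega), map_zero, zero_add] at this)
  subst hp'
  refine ⟨fun b => η b.2 b.1.1, toForm_injective fun q hq => ?_⟩
  cases q with
  | zero => rw [toForm_symMat_zero rfl (by omega), toForm_eq (hη 0) (by omega), hη0]
  | succ q =>
    rw [toForm_symMat_succ rfl hN', toForm_eq (hη q) (by omega)]
    by_cases hqr : q < r
    · rw [toForm_eq (hη (q + 1)) (by omega), hηs q hqr]
    · obtain rfl : q = r := by omega
      rw [toForm_of_le _ (by omega), map_zero, zero_add, hηr]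

lemma ExactPair.symMat_spliceMat (h : ExactPair x y) (hp : p' = p + 1) (hp' : p'' = p' + 2)
    (hN : N = N' + 1) (hN' : N' = 1) (hN'' : N'' = 1)
    {v : {S : Finset (Fin n) // S.card = p'} × Fin N' → A}
    (hv : (symMat x y p N p' N').mulVec v = 0) :
    ∃ u, (spliceMat x y p' N' p'' N'').mulVec u = v := by
  have h0 := toForm_eq_zero_iff.1 hv
  subst hp
  obtain ⟨β, hβ, hβ'⟩ := h.exists_eq (isForm_toForm v 0)
    ((toForm_symMat_zero (y := y) (N := N) rfl (by omega) v).symm.trans (h0 0 (by omega)))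
    (by
      have := h0 1 (by omega)
      rwa [toForm_symMat_succ rfl hN, toForm_of_le v (by omega), map_zero, zero_add] at this)
  subst hp'
  refine ⟨fun b => β b.1.1, toForm_injective fun q hq => ?_⟩
  obtain rfl : q = 0 := by omega
  rw [toForm_spliceMat rfl (by omega) hN'', toForm_eq (η := fun _ => β) hβ (by omega), hβ']

/-- Exactness at `⋀^p ⊗ D_{N-1}`. -/
lemma ExactPair.exists_divMat_eq (h : ExactPair x y) (hp : 2 ≤ p) (hp' : p' = p + 1)
    (hN : N' = N + 1) {v : {S : Finset (Fin n) // S.card = p} × Fin N → A}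
    (hs : ∀ q, q + 1 < N → contrMap x (toForm v q) + contrMap y (toForm v (q + 1)) = 0)
    (h0 : N = 1 → contrMap y (contrMap x (toForm v 0)) = 0) :
    ∃ u, (divMat x y p N p' N').mulVec u = v := by
  obtain ⟨p, rfl⟩ := Nat.exists_eq_add_of_le' hp
  cases N with
  | zero => exact ⟨0, funext fun b => b.2.elim0⟩
  | succ r =>
    obtain ⟨η, hη, hη'⟩ := h.exists_div_eq (r := r) (fun q _ => isForm_toForm v q)
      (fun q hq => hs q (by omega)) (fun hr => h0 (by omega))
    subst hp'
    refine ⟨fun b => η b.2 b.1.1, toForm_injective fun q hq => ?_⟩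
    rw [toForm_divMat rfl hq, toForm_eq (hη q) (by omega), toForm_eq (hη (q + 1)) (by omega),
      hη' q (by omega)]

end StrandMatrices

/-! ### The family of complexes of the two-row matrix, and the Koszul and Eagon–Northcott complexes.
-/

open GrComplex

/-- The first row `X_0, …, X_{n-1}`. -/
noncomputable def rowX (k : Type*) [Field k] (n : ℕ) : Fin n → MvPolynomial (Fin (n + 1)) k :=
  fun j => X j.castSucc

/-- The second row `X_1, …, X_n`. -/
noncomputable def rowY (k : Type*) [Field k] (n : ℕ) : Fin n → MvPolynomial (Fin (n + 1)) k :=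
  fun j => X j.succ

variable {k : Type*} [Field k] {n : ℕ}

section Degrees

variable {m₀ d : ℕ}

lemma rowX_contr_isDegZero (T S : Finset (Fin n)) (e : ℕ) :
    IsDegZero (arithSeq n m₀ d) (∑ j ∈ T, arithSeq n m₀ d j.castSucc + e)
      (∑ j ∈ S, arithSeq n m₀ d j.castSucc + e) (contr (rowX k n) T S) := by
  refine contr_isDegZero _ _ _ _ _ fun j hj hT => ?_
  refine .of_hom (isWeightedHomogeneous_X k _ _) ?_
  rw [hT, ← Finset.add_sum_erase _ (fun j : Fin n => arithSeq n m₀ d j.castSucc) hj, add_assoc]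

/-- The basis vector with index j carries the degree of X_j, whereas the second row has X_{j+1}:
each contraction by this row costs an additional `d`. -/
lemma rowY_contr_isDegZero (T S : Finset (Fin n)) (e : ℕ) :
    IsDegZero (arithSeq n m₀ d) (∑ j ∈ T, arithSeq n m₀ d j.castSucc + e)
      (∑ j ∈ S, arithSeq n m₀ d j.castSucc + (e + d)) (contr (rowY k n) T S) := by
  refine contr_isDegZero _ _ _ _ _ fun j hj hT => ?_
  refine .of_hom (isWeightedHomogeneous_X k _ _) ?_
  rw [hT, ← Finset.add_sum_erase _ (fun j : Fin n => arithSeq n m₀ d j.castSucc) hj]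
  simp [arithSeq]
  ring

end Degrees

/-- The exterior degree in homological degree `s` of the complex `enFamily`. -/
def famCard (c s : ℕ) : ℕ := if s ≤ c then s else s + 1

/-- The number of monomials in homological degree `s` of the complex `enFamily`. -/
def famRank (c s : ℕ) : ℕ := if s ≤ c then c - s + 1 else s - c

lemma famCard_of_le {c s : ℕ} (h : s ≤ c) : famCard c s = s := if_pos h

lemma famCard_of_gt {c s : ℕ} (h : c < s) : famCard c s = s + 1 := if_neg (by omega)

lemma famRank_of_le {c s : ℕ} (h : s ≤ c) : famRank c s = c - s + 1 := if_pos h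

lemma famRank_of_gt {c s : ℕ} (h : c < s) : famRank c s = s - c := if_neg (by omega)

/-- The boundary maps of the complex `enFamily`. -/
noncomputable def famD (k : Type*) [Field k] (n c s : ℕ) :
    Matrix ({S : Finset (Fin n) // S.card = famCard c s} × Fin (famRank c s))
      ({S : Finset (Fin n) // S.card = famCard c (s + 1)} × Fin (famRank c (s + 1)))
      (MvPolynomial (Fin (n + 1)) k) :=
  if s < c then symMat (rowX k n) (rowY k n) _ _ _ _
  else if s = c then spliceMat (rowX k n) (rowY k n) _ _ _ _
  else divMat (rowX k n) (rowY k n) _ _ _ _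

lemma famD_of_lt {c s : ℕ} (h : s < c) :
    famD k n c s = symMat (rowX k n) (rowY k n) _ _ _ _ := if_pos h

lemma famD_self (c : ℕ) : famD k n c c = spliceMat (rowX k n) (rowY k n) _ _ _ _ := by
  rw [famD, if_neg (lt_irrefl c), if_pos rfl]

lemma famD_of_gt {c s : ℕ} (h : c < s) :
    famD k n c s = divMat (rowX k n) (rowY k n) _ _ _ _ := by
  rw [famD, if_neg (by omega), if_neg (by omega)]

/-- The member with index `c` of the family of complexes of the matrix `[X_0 ⋯ X_{n-1}; X_1 ⋯ X_n]`
to which the Eagon–Northcott complex (`c = 0`) and the Buchsbaum–Rim complex (`c = 1`) belong: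
`⋯ → ⋀^{c+3} ⊗ D_1 → ⋀^{c+2} ⊗ D_0 → ⋀^c ⊗ Sym_0 → ⋯ → ⋀^1 ⊗ Sym_{c-1} → Sym_c`. -/
noncomputable def enFamily (k : Type*) [Field k] (n m₀ d c : ℕ) :
    GrComplex k (arithSeq n m₀ d) where
  ι s := {S : Finset (Fin n) // S.card = famCard c s} × Fin (famRank c s)
  fin _ := inferInstance
  dec _ := inferInstance
  -- A contraction by the second row changes the index `q` by one, upwards among the symmetric
  -- powers and downwards among the divided powers, which absorbs its extra `d`. The splice uses
  -- that row once, whence the step from `c` to `c + 1`.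
  deg s b := ∑ j ∈ b.1.1, arithSeq n m₀ d j.castSucc +
    (if s ≤ c then c - (b.2 : ℕ) else c + 1 + b.2) * d
  d := famD k n c
  homog s t b := by
    rcases lt_trichotomy s c with h | rfl | h
    · have hb := b.2.2.trans_eq (famRank_of_le (show s + 1 ≤ c by omega))
      rw [if_pos (by omega), if_pos (by omega), famD_of_lt h]
      refine IsDegZero.add ?_ ?_
      · split_ifs with hq
        · rw [hq]
          exact rowX_contr_isDegZero _ _ _
        · exact isDegZero_zero
      · split_ifs with hq
        · obtain ⟨e, he⟩ : ∃ e, c - (t.2 : ℕ) = e ∧ c - (b.2 : ℕ) = e + 1 :=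
            ⟨c - t.2, rfl, by omega⟩
          rw [he.1, he.2, add_mul, one_mul]
          exact rowY_contr_isDegZero _ _ _
        · exact isDegZero_zero
    · have ht := t.2.2.trans_eq (famRank_of_le le_rfl)
      have hb := b.2.2.trans_eq (famRank_of_gt (lt_add_one s))
      rw [if_pos le_rfl, if_neg (by omega), famD_self, spliceMat, Matrix.of_apply]
      refine IsDegZero.sum fun V _ =>
        IsDegZero.mul (rowY_contr_isDegZero (k := k) _ _ _) ?_
      rw [show s - (t.2 : ℕ) = s by omega, show s + 1 + (b.2 : ℕ) = s + 1 by omega, add_mul,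
        one_mul]
      exact rowX_contr_isDegZero _ _ _
    · rw [if_neg (by omega), if_neg (by omega), famD_of_gt h]
      refine IsDegZero.add ?_ ?_
      · split_ifs with hq
        · rw [hq]
          exact rowX_contr_isDegZero _ _ _
        · exact isDegZero_zero
      · split_ifs with hq
        · rw [hq, ← add_assoc (c + 1), add_mul _ 1 d, one_mul]
          exact rowY_contr_isDegZero _ _ _
        · exact isDegZero_zero
  d_mul_d s := by
    rcases lt_trichotomy s c with h | rfl | h
    · rw [famD_of_lt h]
      by_cases h' : s + 1 = c
      · subst h'
        rw [famD_self]
        apply symMat_mul_spliceMat <;> simp [famCard, famRank]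
      · rw [famD_of_lt (by omega)]
        apply symMat_mul_symMat <;> simp only [famCard, famRank] <;> split_ifs <;> omega
    · rw [famD_self, famD_of_gt (by omega)]
      apply spliceMat_mul_divMat <;> simp [famCard, famRank]
    · rw [famD_of_gt h, famD_of_gt (by omega)]
      apply divMat_mul_divMat <;> simp only [famCard, famRank] <;> split_ifs <;> omega

/-- The vector lies in position `s + 1`. The cases are: inside the symmetric powers, at Sym_0 just
before the splice, at D_0 just after it (where being a cycle means being killed by both contractions
in turn), and inside the divided powers. -/
lemma ExactPair.exists_famD_eq (h : ExactPair (rowX k n) (rowY k n)) {c s : ℕ}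
    {v : {S : Finset (Fin n) // S.card = famCard c (s + 1)} × Fin (famRank c (s + 1)) →
      MvPolynomial (Fin (n + 1)) k} (hv : (famD k n c s).mulVec v = 0) :
    ∃ u, (famD k n c (s + 1)).mulVec u = v := by
  rcases lt_trichotomy s c with hs | rfl | hs
  · rw [famD_of_lt hs] at hv
    by_cases h' : s + 1 = c
    · subst h'
      rw [famD_self]
      refine h.symMat_spliceMat ?_ ?_ ?_ ?_ ?_ hv <;> simp [famCard, famRank]
    · rw [famD_of_lt (by omega)]
      refine h.symMat_symMat ?_ ?_ ?_ ?_ ?_ hv <;> simp only [famCard, famRank] <;> split_ifs <;>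
        omega
  · rw [famD_self] at hv
    rw [famD_of_gt (by omega)]
    have e := famRank_of_gt (lt_add_one s)
    refine h.exists_divMat_eq ?_ ?_ ?_ (fun q hq => by omega) fun _ => ?_
    · rw [famCard_of_gt (by omega)]; omega
    · rw [famCard_of_gt (by omega), famCard_of_gt (by omega)]
    · rw [famRank_of_gt (by omega), famRank_of_gt (by omega)]; omega
    · have h0 : 0 < famRank s s := by rw [famRank_of_le le_rfl]; omega
      rw [← toForm_spliceMat (p := famCard s s) (N := famRank s s)
        (by rw [famCard_of_gt (by omega), famCard_of_le le_rfl]) h0 (by omega), hv,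
        toForm_eq_zero_iff.1 rfl 0 h0]
  · rw [famD_of_gt hs] at hv
    rw [famD_of_gt (by omega)]
    have e := famRank_of_gt (show c < s + 1 by omega)
    have e' := famRank_of_gt hs
    refine h.exists_divMat_eq ?_ ?_ ?_ (fun q hq => ?_) fun _ => by omega
    · rw [famCard_of_gt (by omega)]; omega
    · rw [famCard_of_gt (by omega), famCard_of_gt (by omega)]
    · rw [famRank_of_gt (by omega), famRank_of_gt (by omega)]; omega
    · have hq' : q < famRank c s := by omega
      rw [← toForm_divMat (p := famCard c s)
        (by rw [famCard_of_gt (by omega), famCard_of_gt (by omega)]) hq', hv,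
        toForm_eq_zero_iff.1 rfl q hq']

lemma ExactPair.isExact_enFamily (h : ExactPair (rowX k n) (rowY k n)) (m₀ d c : ℕ) :
    (enFamily k n m₀ d c).IsExact := fun _ _ hv => h.exists_famD_eq hv

lemma constantCoeff_contr {τ : Type} {f : Fin n → MvPolynomial τ k}
    (hf : ∀ j, constantCoeff (f j) = 0) (T S : Finset (Fin n)) :
    constantCoeff (contr f T S) = 0 := by
  unfold contr
  rw [map_sum]
  refine Finset.sum_eq_zero fun j _ => ?_
  split_ifs
  · rw [map_mul, hf, mul_zero]
  · simp

lemma constantCoeff_rowX_contr (T S : Finset (Fin n)) :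
    constantCoeff (contr (rowX k n) T S) = 0 :=
  constantCoeff_contr (fun j => by simp [rowX]) T S

lemma constantCoeff_rowY_contr (T S : Finset (Fin n)) :
    constantCoeff (contr (rowY k n) T S) = 0 :=
  constantCoeff_contr (fun j => by simp [rowY]) T S

lemma constantCoeff_famD {c s : ℕ}
    (t : {S : Finset (Fin n) // S.card = famCard c s} × Fin (famRank c s))
    (b : {S : Finset (Fin n) // S.card = famCard c (s + 1)} × Fin (famRank c (s + 1))) :
    constantCoeff (famD k n c s t b) = 0 := by
  rcases lt_trichotomy s c with h | rfl | h
  · rw [famD_of_lt h, symMat, Matrix.of_apply, map_add]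
    split_ifs <;> simp [constantCoeff_rowX_contr, constantCoeff_rowY_contr]
  · rw [famD_self, spliceMat, Matrix.of_apply, map_sum]
    simp [constantCoeff_rowX_contr]
  · rw [famD_of_gt h, divMat, Matrix.of_apply, map_add]
    split_ifs <;> simp [constantCoeff_rowX_contr, constantCoeff_rowY_contr]

lemma isMinimal_enFamily (m₀ d c : ℕ) : (enFamily k n m₀ d c).IsMinimal :=
  fun _ t b => mem_span_X_iff.2 (constantCoeff_famD t b)

lemma isMinimal_koszul (w : Fin (n + 1) → ℕ) : (koszul k w).IsMinimal := by
  intro s t b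
  rw [mem_span_X_iff]
  exact constantCoeff_rowX_contr t.1 b.1

lemma isMinimal_eagonNorthcott (m₀ d : ℕ) : (eagonNorthcott k n m₀ d).IsMinimal := by
  intro s t b
  rw [mem_span_X_iff]
  cases s with
  | zero =>
    change constantCoeff (∑ i ∈ b.1.1, ∑ j ∈ b.1.1, _) = 0
    rw [map_sum]
    refine Finset.sum_eq_zero fun i _ => ?_
    rw [map_sum]
    refine Finset.sum_eq_zero fun j _ => ?_
    split_ifs <;> simp
  | succ s =>
    change constantCoeff ((if _ then contr (rowX k n) _ _ else 0) +
      (if _ then contr (rowY k n) _ _ else 0)) = 0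
    rw [map_add]
    split_ifs <;> simp [constantCoeff_rowX_contr, constantCoeff_rowY_contr]

/-- The first boundary map of the Eagon–Northcott complex, on vectors. -/
lemma enD_zero_mulVec (v : {S : Finset (Fin n) // S.card = 2} × Fin 1 →
      MvPolynomial (Fin (n + 1)) k) (u : Unit) :
    Matrix.mulVec (enD k n 0) v u =
      contrMap (rowY k n) (contrMap (rowX k n) (toForm v 0)) ∅ := by
  rw [← sum_splice_mul]
  refine Finset.sum_congr rfl fun b _ => ?_
  rw [contr_contr_pair _ _ _ b.1.2]
  rfl

/-- Beyond its first map, the Eagon–Northcott complex is a divided power strand, so the exactness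
results for these strands apply. -/
lemma enD_succ_eq (s : ℕ) :
    enD k n (s + 1) = divMat (rowX k n) (rowY k n) (s + 2) (s + 1) (s + 3) (s + 2) := by
  ext1 t b
  change (if _ then contr (rowX k n) _ _ else 0) + (if _ then contr (rowY k n) _ _ else 0) =
    (if _ then contr (rowX k n) _ _ else 0) + (if _ then contr (rowY k n) _ _ else 0)
  simp only [eq_comm (a := (t.2 : ℕ)), eq_comm (a := (t.2 : ℕ) + 1)]

lemma ExactPair.exists_enD_one_eq (h : ExactPair (rowX k n) (rowY k n))
    {v : {S : Finset (Fin n) // S.card = 2} × Fin 1 → MvPolynomial (Fin (n + 1)) k}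
    (hv : Matrix.mulVec (enD k n 0) v = 0) : ∃ u, Matrix.mulVec (enD k n 1) u = v := by
  rw [enD_succ_eq]
  refine h.exists_divMat_eq (p := 2) (N := 1) le_rfl rfl rfl (fun q hq => by omega) fun _ => ?_
  ext1 T
  by_cases hT : T = ∅
  · rw [hT]
    exact (enD_zero_mulVec v ()).symm.trans (congrFun hv ())
  · exact (((isForm_toForm v 0).contrMap _).contrMap _) T (by simpa using hT)

lemma ExactPair.exists_enD_succ_eq (h : ExactPair (rowX k n) (rowY k n)) {s : ℕ}
    {v : {S : Finset (Fin n) // S.card = s + 3} × Fin (s + 2) → MvPolynomial (Fin (n + 1)) k}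
    (hv : Matrix.mulVec (enD k n (s + 1)) v = 0) :
    ∃ u, Matrix.mulVec (enD k n (s + 2)) u = v := by
  rw [enD_succ_eq] at hv ⊢
  replace hv : (divMat (rowX k n) (rowY k n) (s + 2) (s + 1) (s + 3) (s + 2)).mulVec v = 0 := hv
  refine h.exists_divMat_eq (p := s + 3) (N := s + 2) (by omega) rfl rfl (fun q hq => ?_)
    fun _ => by omega
  have hq' : q < s + 1 := by omega
  rw [← toForm_divMat (p := s + 2) (p' := s + 3) (N := s + 1) rfl hq', hv, toForm_eq_zero_iff.1 rfl q hq']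

lemma ExactPair.isExact_eagonNorthcott (h : ExactPair (rowX k n) (rowY k n)) (m₀ d : ℕ) :
    (eagonNorthcott k n m₀ d).IsExact
  | 0, _, hv => h.exists_enD_one_eq hv
  | _ + 1, _, hv => h.exists_enD_succ_eq hv

lemma koszul_mulVec (w : Fin (n + 1) → ℕ) (s : ℕ)
    (v : {S : Finset (Fin n) // S.card = s + 1} → MvPolynomial (Fin (n + 1)) k)
    (T : {S : Finset (Fin n) // S.card = s}) :
    Matrix.mulVec ((koszul k w).d s) v T =
      contrMap (rowX k n) (toForm (fun b : _ × Fin 1 => v b.1) 0) T.1 := by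
  rw [← sum_ite_contr_mul, Fintype.sum_prod_type]
  simp
  rfl

lemma ExactPair.isExact_koszul (h : ExactPair (rowX k n) (rowY k n)) (w : Fin (n + 1) → ℕ) :
    (koszul k w).IsExact := by
  intro s v hv
  have h0 : contrMap (rowX k n) (toForm (fun b : _ × Fin 1 => v b.1) 0) = 0 := by
    ext1 T
    by_cases hT : T.card = s
    · exact (koszul_mulVec w s v ⟨T, hT⟩).symm.trans (congrFun hv ⟨T, hT⟩)
    · exact ((isForm_toForm _ 0).contrMap _) T hT
  obtain ⟨η, hη, hη'⟩ := h.left (isForm_toForm _ 0) h0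
  refine ⟨fun b => η b.1, funext fun T => ?_⟩
  refine (koszul_mulVec w (s + 1) _ T).trans ?_
  rw [toForm_eq (η := fun _ => η) (q := 0) hη (by omega), hη']
  exact toForm_apply (fun b : _ × Fin 1 => v b.1) (T, 0)

/-! ### The minors of the first `m` columns generate the kernel of a parametrization. -/

section Kernel

variable (k : Type*) [Field k] (n : ℕ)

lemma X_eq_xvar (i : Fin (n + 1)) : (X i : MvPolynomial (Fin (n + 1)) k) = xvar k n i := by
  rw [xvar, Fin.ofNat_eq_cast, Fin.cast_val_eq_self]

/-- The map `k[X_0, …, X_n] → k[X_0, …, X_n][s, t]` with `X_i ↦ s^{m-i} t^i` for `i ≤ m` and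
`X_i ↦ X_i` for `i > m`. -/
noncomputable def curveMap (m : ℕ) :
    MvPolynomial (Fin (n + 1)) k →ₐ[k] MvPolynomial (Fin 2) (MvPolynomial (Fin (n + 1)) k) :=
  aeval fun i => if (i : ℕ) ≤ m then X 0 ^ (m - (i : ℕ)) * X 1 ^ (i : ℕ) else C (X i)

variable {k n}

lemma curveMap_of_le {m i : ℕ} (hi : i ≤ m) (hm : m ≤ n) :
    curveMap k n m (xvar k n i) = X 0 ^ (m - i) * X 1 ^ i := by
  rw [xvar, curveMap, aeval_X]
  have : (Fin.ofNat (n + 1) i : ℕ) = i := Nat.mod_eq_of_lt (by omega)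
  rw [this, if_pos hi]

lemma curveMap_of_gt {m i : ℕ} (hi : m < i) (hin : i ≤ n) :
    curveMap k n m (xvar k n i) = C (xvar k n i) := by
  rw [xvar, curveMap, aeval_X]
  have : (Fin.ofNat (n + 1) i : ℕ) = i := Nat.mod_eq_of_lt (by omega)
  rw [this, if_neg (by omega)]

variable (k n) in
/-- The ideal of `2 × 2` minors of the first `m` columns. -/
noncomputable def minorIdeal (m : ℕ) : Ideal (MvPolynomial (Fin (n + 1)) k) :=
  Ideal.span {p | ∃ i j, i < m ∧ j < m ∧
    p = xvar k n i * xvar k n (j + 1) - xvar k n j * xvar k n (i + 1)}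

lemma minor_mem {m i j : ℕ} (hi : i < m) (hj : j < m) :
    xvar k n i * xvar k n (j + 1) - xvar k n j * xvar k n (i + 1) ∈ minorIdeal k n m :=
  Ideal.subset_span ⟨i, j, hi, hj, rfl⟩

/-- Modulo the minors a product of two variables depends only on the sum of the indices, since one
minor moves one unit from one index to the other. -/
lemma xvar_mul_xvar_shift {m i j : ℕ} (l : ℕ) (hi : i + l ≤ m) (hj : j + l ≤ m) :
    xvar k n (i + l) * xvar k n j - xvar k n i * xvar k n (j + l) ∈ minorIdeal k n m := by
  induction l generalizing j with
  | zero => simp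
  | succ l ih =>
    have h1 := ih (j := j + 1) (by omega) (by omega)
    have h2 := minor_mem (k := k) (n := n) (show j < m by omega) (show i + l < m by omega)
    have h3 := add_mem h1 h2
    rw [show j + 1 + l = j + (l + 1) by omega] at h3
    convert h3 using 1
    rw [show i + l + 1 = i + (l + 1) by omega]
    ring

variable (k n) in
/-- The subalgebra generated by the variables other than `X_1, …, X_{m-1}`. -/
noncomputable def outerAlg (m : ℕ) : Subalgebra k (MvPolynomial (Fin (n + 1)) k) :=
  Algebra.adjoin k (xvar k n '' {i | i = 0 ∨ m ≤ i ∧ i ≤ n})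

lemma xvar_mem_outerAlg {m i : ℕ} (h : i = 0 ∨ m ≤ i ∧ i ≤ n) : xvar k n i ∈ outerAlg k n m :=
  Algebra.subset_adjoin ⟨i, h, rfl⟩

variable (k n) in
/-- The representatives `1, X_1, …, X_{m-1}`. -/
noncomputable def innerVar (m : ℕ) (j : Fin m) : MvPolynomial (Fin (n + 1)) k :=
  if (j : ℕ) = 0 then 1 else xvar k n j

/-- Modulo the minors, the polynomial ring is generated by `1, X_1, …, X_{m-1}` as a module over
the subalgebra generated by the other variables. -/
lemma exists_sum_innerVar {m : ℕ} (hm : 0 < m) (hmn : m ≤ n) (r : MvPolynomial (Fin (n + 1)) k) :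
    ∃ c : Fin m → outerAlg k n m,
      r - ∑ j, (c j : MvPolynomial (Fin (n + 1)) k) * innerVar k n m j ∈ minorIdeal k n m := by
  -- `N` contains 1, and it remains to see that it is closed under multiplication by every variable.
  let N : Submodule (outerAlg k n m) (MvPolynomial (Fin (n + 1)) k) :=
    Submodule.span (outerAlg k n m) (Set.range (innerVar k n m)) ⊔
      (minorIdeal k n m).restrictScalars (outerAlg k n m)
  have hinner : ∀ j : Fin m, innerVar k n m j ∈ N := fun j =>
    Submodule.mem_sup_left (Submodule.subset_span ⟨j, rfl⟩)
  have hJ : ∀ r ∈ minorIdeal k n m, r ∈ N := fun r hr => Submodule.mem_sup_right hr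
  have hB : ∀ b ∈ outerAlg k n m, ∀ r ∈ N, b * r ∈ N := fun b hb r hr =>
    N.smul_mem (⟨b, hb⟩ : outerAlg k n m) hr
  have h1 : (1 : MvPolynomial (Fin (n + 1)) k) ∈ N := by
    simpa [innerVar] using hinner ⟨0, hm⟩
  have hx : ∀ i ≤ n, xvar k n i ∈ N := by
    intro i hi
    by_cases h : i = 0 ∨ m ≤ i ∧ i ≤ n
    · simpa using hB _ (xvar_mem_outerAlg h) 1 h1
    · have := hinner ⟨i, by omega⟩
      rwa [innerVar, if_neg (by simp; omega)] at this
  have hxx : ∀ i ≤ n, ∀ j : Fin m, xvar k n i * innerVar k n m j ∈ N := by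
    intro i hi j
    by_cases h : i = 0 ∨ m ≤ i ∧ i ≤ n
    · exact hB _ (xvar_mem_outerAlg h) _ (hinner j)
    · rw [innerVar]
      split_ifs with hj
      · simpa using hx i hi
      · have hj' := j.2
        by_cases hij : i + j ≤ m
        · have h2 := xvar_mul_xvar_shift (k := k) (n := n) (m := m) (i := 0) (j := j) i
            (by omega) (by omega)
          rw [zero_add] at h2
          rw [← sub_add_cancel (xvar k n i * xvar k n j) (xvar k n 0 * xvar k n (j + i))]
          exact N.add_mem (hJ _ h2)
            (hB _ (xvar_mem_outerAlg (.inl rfl)) _ (hx _ (by omega)))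
        · obtain ⟨l, hl⟩ : ∃ l, (j : ℕ) + l = m := ⟨m - j, by omega⟩
          obtain ⟨i', hi'⟩ : ∃ i', i' + l = i := ⟨i - l, by omega⟩
          have h2 := xvar_mul_xvar_shift (k := k) (n := n) (m := m) (i := i') (j := j) l
            (by omega) (by omega)
          rw [hi', hl] at h2
          rw [← sub_add_cancel (xvar k n i * xvar k n j) (xvar k n i' * xvar k n m)]
          refine N.add_mem (hJ _ h2) ?_
          rw [mul_comm]
          exact hB _ (xvar_mem_outerAlg (.inr ⟨le_rfl, hmn⟩)) _ (hx _ (by omega))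
  have hmul : ∀ i ≤ n, ∀ r ∈ N, xvar k n i * r ∈ N := by
    intro i hi r hr
    obtain ⟨a, ha, b, hb, rfl⟩ := Submodule.mem_sup.1 hr
    rw [mul_add]
    refine N.add_mem ?_ (hJ _ (Ideal.mul_mem_left _ _ hb))
    clear hr
    induction ha using Submodule.span_induction with
    | mem x h =>
      obtain ⟨j, rfl⟩ := h
      exact hxx i hi j
    | zero => simp
    | add x y _ _ h1 h2 => rw [mul_add]; exact N.add_mem h1 h2
    | smul c x _ h =>
      rw [Subalgebra.smul_def, smul_eq_mul, mul_left_comm]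
      exact hB _ c.2 _ h
  have htop : r ∈ N := by
    induction r using MvPolynomial.induction_on with
    | C a =>
      have := hB _ ((outerAlg k n m).algebraMap_mem a) 1 h1
      simpa using this
    | add p q hp hq => exact N.add_mem hp hq
    | mul_X p i hp =>
      rw [mul_comm, X_eq_xvar]
      exact hmul i (by omega) p hp
  obtain ⟨a, ha, b, hb, rfl⟩ := Submodule.mem_sup.1 htop
  obtain ⟨c, rfl⟩ := (Submodule.mem_span_range_iff_exists_fun _).1 ha
  refine ⟨c, ?_⟩
  simpa [Subalgebra.smul_def] using hb

variable (k n) in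
/-- The map with `X_0 ↦ s`, `X_m ↦ t` that fixes the other variables. -/
noncomputable def renameMap (m : ℕ) :
    MvPolynomial (Fin (n + 1)) k →ₐ[k] MvPolynomial (Fin 2) (MvPolynomial (Fin (n + 1)) k) :=
  aeval fun i => if (i : ℕ) = 0 then X 0 else if (i : ℕ) = m then X 1 else C (X i)

lemma renameMap_injective (m : ℕ) : Function.Injective (renameMap k n m) := by
  let g : MvPolynomial (Fin 2) (MvPolynomial (Fin (n + 1)) k) →ₐ[k]
      MvPolynomial (Fin (n + 1)) k :=
    (aeval ![xvar k n 0, xvar k n m] : _ →ₐ[MvPolynomial (Fin (n + 1)) k] _).restrictScalars k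
  have hg : g.comp (renameMap k n m) = AlgHom.id k _ := by
    ext1 i
    rw [AlgHom.comp_apply, renameMap, aeval_X, AlgHom.id_apply]
    split_ifs with h1 h2
    · simp [g, X_eq_xvar, h1]
    · simp [g, X_eq_xvar, h2]
    · simp [g]
  intro a b hab
  have := congrArg g hab
  rwa [← AlgHom.comp_apply, ← AlgHom.comp_apply, hg] at this

/-- Of the parametrized variables only X_0 and X_m are outer, and they go to s^m and t^m. So on the
outer algebra the map is injective and produces only exponents of s and t divisible by `m`. -/
lemma curveMap_eq_expand {m : ℕ} (hm : 0 < m) {p : MvPolynomial (Fin (n + 1)) k}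
    (hp : p ∈ outerAlg k n m) : curveMap k n m p = expand m (renameMap k n m p) := by
  let e : MvPolynomial (Fin (n + 1)) k →ₐ[k] MvPolynomial (Fin 2) (MvPolynomial (Fin (n + 1)) k) :=
    ((expand m).restrictScalars k).comp (renameMap k n m)
  change curveMap k n m p = e p
  refine AlgHom.eqOn_adjoin_iff.2 ?_ hp
  rintro _ ⟨i, hi, rfl⟩
  have hin : i ≤ n := by
    rcases hi with rfl | h
    · omega
    · exact h.2
  have hmod : (Fin.ofNat (n + 1) i : ℕ) = i := Nat.mod_eq_of_lt (by omega)
  change curveMap k n m (xvar k n i) = expand m (renameMap k n m (xvar k n i))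
  rw [xvar, renameMap, aeval_X, curveMap, aeval_X, hmod]
  rcases hi with rfl | h
  · simp
  · by_cases him : i = m
    · subst him
      simp [hm.ne']
    · rw [if_neg (by omega), if_neg (by omega), if_neg him, expand_C]

lemma curveMap_eq_zero_of_mem {m : ℕ} (hmn : m ≤ n) {q : MvPolynomial (Fin (n + 1)) k}
    (hq : q ∈ minorIdeal k n m) : curveMap k n m q = 0 := by
  have : minorIdeal k n m ≤ RingHom.ker (curveMap k n m) := by
    rw [minorIdeal, Ideal.span_le]
    rintro _ ⟨i, j, hi, hj, rfl⟩
    simp only [SetLike.mem_coe, RingHom.mem_ker, map_sub, map_mul]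
    rw [curveMap_of_le (by omega) hmn, curveMap_of_le (by omega) hmn,
      curveMap_of_le (by omega) hmn, curveMap_of_le (by omega) hmn, sub_eq_zero,
      show m - i = m - (i + 1) + 1 by omega, show m - j = m - (j + 1) + 1 by omega]
    ring
  exact this hq

/-- The kernel of `curveMap` is generated by the minors. -/
theorem mem_minorIdeal_of_curveMap_eq_zero {m : ℕ} (hm : 0 < m) (hmn : m ≤ n)
    {r : MvPolynomial (Fin (n + 1)) k} (hr : curveMap k n m r = 0) : r ∈ minorIdeal k n m := by
  obtain ⟨c, hc⟩ := exists_sum_innerVar hm hmn r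
  have h0 := curveMap_eq_zero_of_mem hmn hc
  rw [map_sub, hr, zero_sub, neg_eq_zero, map_sum] at h0
  -- Grading by the exponent of t modulo `m` separates the summands: the coefficient from the outer
  -- algebra has degree 0 and the j-th representative has degree j. So every summand of the
  -- vanishing sum is zero.
  let w : Fin 2 → ZMod m := ![0, 1]
  have hhom : ∀ j : Fin m, IsWeightedHomogeneous w
      (curveMap k n m (c j * innerVar k n m j)) ((j : ℕ) : ZMod m) := by
    intro j
    rw [map_mul, curveMap_eq_expand hm (c j).2, ← zero_add ((j : ℕ) : ZMod m)]
    refine IsWeightedHomogeneous.mul ?_ ?_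
    · intro e he
      have hdvd : m ∣ e 1 := by
        by_contra h
        exact he (coeff_expand_of_not_dvd _ h)
      rw [Finsupp.weight_apply, Finsupp.sum_fintype _ _ (by simp)]
      simp only [w, Fin.sum_univ_two, Matrix.cons_val_zero, Matrix.cons_val_one,
        nsmul_eq_mul, mul_one, mul_zero, zero_add]
      exact (ZMod.natCast_eq_zero_iff _ _).2 hdvd
    · rw [innerVar]
      split_ifs with hj
      · rw [map_one, hj, Nat.cast_zero]
        exact isWeightedHomogeneous_one _ _
      · rw [curveMap_of_le (by omega) hmn]
        have h1 := ((isWeightedHomogeneous_X (MvPolynomial (Fin (n + 1)) k) w 0).pow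
          (m - (j : ℕ))).mul ((isWeightedHomogeneous_X (MvPolynomial (Fin (n + 1)) k) w 1).pow j)
        convert h1 using 1
        simp [w]
  have hzero : ∀ j : Fin m, c j = 0 := by
    intro j
    have h1 := congrArg (weightedHomogeneousComponent w ((j : ℕ) : ZMod m)) h0
    rw [map_sum, map_zero, Finset.sum_eq_single j] at h1
    · rw [(hhom j).weightedHomogeneousComponent_same, map_mul, mul_eq_zero] at h1
      rcases h1 with h1 | h1
      · rw [curveMap_eq_expand hm (c j).2, expand_eq_zero hm] at h1
        exact Subtype.ext (renameMap_injective m (h1.trans (map_zero _).symm))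
      · exfalso
        rw [innerVar] at h1
        split_ifs at h1
        · simp at h1
        · rw [curveMap_of_le (by omega) hmn] at h1
          simp [X_ne_zero] at h1
    · intro i _ hij
      refine (hhom i).weightedHomogeneousComponent_ne _ ?_
      intro h
      rw [ZMod.natCast_eq_natCast_iff', Nat.mod_eq_of_lt i.2, Nat.mod_eq_of_lt j.2] at h
      exact hij (Fin.ext (by omega))
    · simp
  simpa [hzero] using hc

end Kernel

/-! ### Minors as values of the composite contraction, and the exact pair of rows. -/

section Minors

variable {A : Type*} [CommRing A] {m : ℕ}

lemma contrMap_apply_empty {f : Fin m → A} {ω : Finset (Fin m) → A} (hω : IsForm 1 ω) :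
    contrMap f ω ∅ = ∑ j, f j * ω {j} := by
  rw [contrMap_apply]
  have h : ∀ S ∉ Finset.univ.image (fun j : Fin m => ({j} : Finset (Fin m))),
      contr f ∅ S * ω S = 0 := by
    intro S hS
    rw [hω S, mul_zero]
    intro hc
    obtain ⟨j, rfl⟩ := Finset.card_eq_one.1 hc
    exact hS (by simp)
  rw [← Finset.sum_subset (Finset.subset_univ _) fun S _ hS => h S hS,
    Finset.sum_image Finset.singleton_injective.injOn]
  simp [contr_empty_singleton]

/-- The product of the contractions by `x` and `y` maps `⋀²` onto the ideal of minors. -/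
lemma exists_form_of_mem_minors {x y : Fin m → A} {p : A}
    (hp : p ∈ Ideal.span {p | ∃ i j, p = x i * y j - x j * y i}) :
    ∃ η, IsForm 2 η ∧ contrMap y (contrMap x η) ∅ = p := by
  have key : ∀ i j : Fin m, i < j →
      ∃ η, IsForm 2 η ∧ contrMap y (contrMap x η) ∅ = x i * y j - x j * y i := by
    intro i j hij
    have hc : ({i, j} : Finset (Fin m)).card = 2 := Finset.card_pair hij.ne
    refine ⟨Pi.single {i, j} 1, fun S hS => ?_, ?_⟩
    · rw [Pi.single_eq_of_ne]
      rintro rfl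
      exact hS hc
    · rw [contrMap_contrMap_apply, Finset.sum_eq_single {i, j}]
      · rw [contr_contr_pair _ _ _ hc, Pi.single_eq_same, mul_one, Finset.sum_pair hij.ne,
          Finset.sum_pair hij.ne, Finset.sum_pair hij.ne]
        simp [hij, hij.not_gt]
      · intro S _ hS
        rw [Pi.single_eq_of_ne hS, mul_zero]
      · simp
  induction hp using Submodule.span_induction with
  | mem p h =>
    obtain ⟨i, j, rfl⟩ := h
    rcases lt_trichotomy i j with hij | rfl | hij
    · exact key i j hij
    · exact ⟨0, isForm_zero, by simp⟩
    · obtain ⟨η, hη, hη'⟩ := key j i hij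
      exact ⟨-η, hη.neg, by simp [hη']⟩
  | zero => exact ⟨0, isForm_zero, by simp⟩
  | add p q _ _ hp hq =>
    obtain ⟨η, hη, rfl⟩ := hp
    obtain ⟨θ, hθ, rfl⟩ := hq
    exact ⟨η + θ, hη.add hθ, by simp⟩
  | smul c p _ hp =>
    obtain ⟨η, hη, rfl⟩ := hp
    exact ⟨c • η, hη.smul c, by simp⟩

lemma contrMap_contrMap_mem_minors {x y : Fin m → A} {η : Finset (Fin m) → A} (hη : IsForm 2 η) :
    contrMap y (contrMap x η) ∅ ∈ Ideal.span {p | ∃ i j, p = x i * y j - x j * y i} := by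
  rw [contrMap_contrMap_apply]
  refine Ideal.sum_mem _ fun S _ => ?_
  by_cases hS : S.card = 2
  · refine Ideal.mul_mem_right _ _ ?_
    rw [contr_contr_pair _ _ _ hS]
    refine Ideal.sum_mem _ fun i _ => Ideal.sum_mem _ fun j _ => ?_
    split_ifs
    · exact Ideal.subset_span ⟨i, j, rfl⟩
    · exact zero_mem _
  · rw [hη S hS, mul_zero]
    exact zero_mem _

lemma IsForm.eq_of_apply_empty {ω η : Finset (Fin m) → A} (hω : IsForm 0 ω) (hη : IsForm 0 η)
    (h : ω ∅ = η ∅) : ω = η := by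
  ext1 S
  by_cases hS : S = ∅
  · rw [hS, h]
  · rw [hω S (by simpa using hS), hη S (by simpa using hS)]

end Minors

section Rows

variable {k : Type*} [Field k] {n : ℕ}

lemma rowX_eq : rowX k n = initSeq (xvar k n) n := by
  ext1 j
  rw [rowX, X_eq_xvar]
  rfl

lemma rowY_eq : rowY k n = initSeq (fun j => xvar k n (j + 1)) n := by
  ext1 j
  rw [rowY, X_eq_xvar]
  rfl

lemma minorIdeal_eq_span (m : ℕ) : minorIdeal k n m = Ideal.span {p | ∃ i j : Fin m,
    p = initSeq (xvar k n) m i * initSeq (fun j => xvar k n (j + 1)) m j -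
      initSeq (xvar k n) m j * initSeq (fun j => xvar k n (j + 1)) m i} := by
  rw [minorIdeal]
  congr 1
  ext p
  constructor
  · rintro ⟨i, j, hi, hj, rfl⟩
    exact ⟨⟨i, hi⟩, ⟨j, hj⟩, rfl⟩
  · rintro ⟨i, j, rfl⟩
    exact ⟨i, j, i.2, j.2, rfl⟩

variable (k n) in
/-- The map that sends the first `m` variables to zero. -/
noncomputable def killMap (m : ℕ) :
    MvPolynomial (Fin (n + 1)) k →ₐ[k] MvPolynomial (Fin (n + 1)) k :=
  aeval fun i => if (i : ℕ) < m then 0 else X i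

lemma xvar_val {i : ℕ} (hi : i ≤ n) : (Fin.ofNat (n + 1) i : ℕ) = i :=
  Nat.mod_eq_of_lt (by omega)

lemma killMap_of_lt {m i : ℕ} (hi : i < m) (hm : i ≤ n) : killMap k n m (xvar k n i) = 0 := by
  rw [xvar, killMap, aeval_X, xvar_val hm, if_pos hi]

lemma killMap_of_ge {m i : ℕ} (hi : m ≤ i) (hm : i ≤ n) :
    killMap k n m (xvar k n i) = xvar k n i := by
  rw [xvar, killMap, aeval_X, xvar_val hm, if_neg (by omega)]

lemma sub_killMap_mem (m : ℕ) (p : MvPolynomial (Fin (n + 1)) k) :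
    p - killMap k n m p ∈ Ideal.span (xvar k n '' Set.Iio m) := by
  have h : (Ideal.Quotient.mkₐ k (Ideal.span (xvar k n '' Set.Iio m))) =
      (Ideal.Quotient.mkₐ k (Ideal.span (xvar k n '' Set.Iio m))).comp (killMap k n m) := by
    ext1 i
    rw [AlgHom.comp_apply, killMap, aeval_X]
    split_ifs with hi
    · rw [map_zero]
      refine Ideal.Quotient.eq_zero_iff_mem.2 (Ideal.subset_span ⟨i, hi, ?_⟩)
      rw [X_eq_xvar]
    · rfl
  exact Ideal.Quotient.eq.1 (DFunLike.congr_fun h p)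

lemma mem_span_xvar_iff {m : ℕ} (hm : m ≤ n + 1) {p : MvPolynomial (Fin (n + 1)) k} :
    p ∈ Ideal.span (xvar k n '' Set.Iio m) ↔ killMap k n m p = 0 := by
  constructor
  · intro h
    have hle : Ideal.span (xvar k n '' Set.Iio m) ≤ RingHom.ker (killMap k n m) := by
      rw [Ideal.span_le]
      rintro _ ⟨i, hi, rfl⟩
      exact killMap_of_lt hi (by simp at hi; omega)
    exact hle h
  · intro h
    simpa [h] using sub_killMap_mem m p

lemma range_initSeq {A : Type*} (f : ℕ → A) (m : ℕ) : Set.range (initSeq f m) = f '' Set.Iio m := by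
  ext p
  constructor
  · rintro ⟨i, rfl⟩
    exact ⟨i, i.2, rfl⟩
  · rintro ⟨i, hi, rfl⟩
    exact ⟨⟨i, hi⟩, rfl⟩

/-- On the curve the two rows are proportional: t X_j = s X_{j+1} for each of the first `m` columns.
-/
lemma curveMap_mul_contrMap {m : ℕ} (hm : m ≤ n)
    {β : Finset (Fin m) → MvPolynomial (Fin (n + 1)) k} (hβ : IsForm 1 β) :
    X 1 * curveMap k n m (contrMap (initSeq (xvar k n) m) β ∅) =
      X 0 * curveMap k n m (contrMap (initSeq (fun j => xvar k n (j + 1)) m) β ∅) := by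
  rw [contrMap_apply_empty hβ, contrMap_apply_empty hβ, map_sum, map_sum, Finset.mul_sum,
    Finset.mul_sum]
  refine Finset.sum_congr rfl fun j _ => ?_
  have := j.2
  rw [map_mul, map_mul, initSeq, initSeq, curveMap_of_le (by omega) hm,
    curveMap_of_le (by omega) hm, show m - (j : ℕ) = m - (j + 1) + 1 by omega]
  ring

/-- The two rows of the matrix `[X_0 ⋯ X_{n-1}; X_1 ⋯ X_n]` form an exact pair. -/
theorem exactPair_rows : ExactPair (rowX k n) (rowY k n) := by
  have left : ∀ m ≤ n, ∀ {p : ℕ} {ω : Finset (Fin m) → MvPolynomial (Fin (n + 1)) k},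
      IsForm (p + 1) ω → contrMap (initSeq (xvar k n) m) ω = 0 →
      ∃ η, IsForm (p + 2) η ∧ contrMap (initSeq (xvar k n) m) η = ω := by
    intro m hm p ω hω h0
    refine exists_contrMap_eq _ (fun j hj β hβ => ?_) hω h0
    rw [range_initSeq, mem_span_xvar_iff (by omega)] at hβ ⊢
    rw [map_mul, killMap_of_ge le_rfl (by omega)] at hβ
    exact (mul_eq_zero.1 hβ).resolve_left (X_ne_zero _)
  rw [rowX_eq, rowY_eq]
  refine ⟨left n le_rfl, fun hω h0 => exists_contrMap_add_eq _ _ ?_ hω h0⟩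
  intro m hm α β hα hβ h
  rcases Nat.eq_zero_or_pos m with rfl | hm0
  · exact ⟨0, 0, isForm_zero, isForm_zero, by
      rw [map_zero, map_zero, add_zero, hβ.eq_zero_of_lt (by omega)]⟩
  have h1 := congrArg (curveMap k n m) (congrFun h ∅)
  have h2 := curveMap_mul_contrMap hm.le hβ
  simp only [Pi.add_apply, Pi.sub_apply, Pi.smul_apply, smul_eq_mul, map_add, map_sub, map_mul,
    Pi.zero_apply, map_zero] at h1
  rw [curveMap_eq_zero_of_mem hm.le (minorIdeal_eq_span (k := k) (n := n) m ▸
    contrMap_contrMap_mem_minors hα), curveMap_of_gt (by omega) (by omega),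
    curveMap_of_le le_rfl hm.le, Nat.sub_self, pow_zero, one_mul, zero_add] at h1
  set a := curveMap k n m (contrMap (initSeq (xvar k n) m) β ∅) with ha
  set b := curveMap k n m (contrMap (initSeq (fun j => xvar k n (j + 1)) m) β ∅)
  -- After the parametrization the composite contraction of α vanishes, leaving X_{m+1} a = t^m b,
  -- while proportionality of the rows gives t a = s b. Eliminating b leaves a nonzero factor times
  -- a.
  have h3 : (C (xvar k n (m + 1)) * X 0 - X 1 ^ (m + 1)) * a = 0 := by
    linear_combination X 0 * h1 - X 1 ^ m * h2
  have h4 : a = 0 := by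
    refine (mul_eq_zero.1 h3).resolve_left fun h5 => ?_
    have h6 := congrArg (eval ![1, 0]) h5
    simp at h6
    exact X_ne_zero _ h6
  -- Hence the contraction of β by `x` lies in the ideal of minors and is the composite contraction
  -- of some η. By anticommutation β plus the `y`-contraction of η is an `x`-cycle, hence an
  -- `x`-boundary.
  obtain ⟨η, hη, hη'⟩ := exists_form_of_mem_minors
    (minorIdeal_eq_span (k := k) (n := n) m ▸ mem_minorIdeal_of_curveMap_eq_zero hm0 hm.le h4)
  have h5 : contrMap (initSeq (xvar k n) m) (β + contrMap (initSeq (fun j => xvar k n (j + 1)) m) η)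
      = 0 := by
    rw [map_add, contrMap_anticomm, add_neg_eq_zero]
    exact (hβ.contrMap _).eq_of_apply_empty ((hη.contrMap _).contrMap _) hη'.symm
  obtain ⟨γ, hγ, hγ'⟩ := left m hm.le (hβ.add (hη.contrMap _)) h5
  exact ⟨γ, -η, hγ, hη.neg, by rw [hγ', map_neg]; abel⟩

end Rows

open GrComplex

/-! ### The rational normal curve. -/

section Curve

variable (k : Type*) [Field k] (n : ℕ)

/-- The parametrization `X_i ↦ s^{n-i} t^i` of the rational normal curve. -/
noncomputable def rncMap : MvPolynomial (Fin (n + 1)) k →ₐ[k] MvPolynomial (Fin 2) k :=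
  aeval fun i : Fin (n + 1) => X 0 ^ (n - (i : ℕ)) * X 1 ^ (i : ℕ)

variable {k n}

lemma mem_rncIdeal {p : MvPolynomial (Fin (n + 1)) k} : p ∈ rncIdeal k n ↔ rncMap k n p = 0 :=
  Iff.rfl

lemma rncMap_xvar {i : ℕ} (hi : i ≤ n) : rncMap k n (xvar k n i) = X 0 ^ (n - i) * X 1 ^ i := by
  rw [xvar, rncMap, aeval_X, xvar_val hi]

lemma curveMap_eq_map (p : MvPolynomial (Fin (n + 1)) k) :
    curveMap k n n p = map C (rncMap k n p) := by
  have h : curveMap k n n = (mapAlgHom (Algebra.ofId k (MvPolynomial (Fin (n + 1)) k))).comp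
      (rncMap k n) := by
    ext1 i
    rw [AlgHom.comp_apply, rncMap, curveMap, aeval_X, aeval_X, if_pos (by omega)]
    simp
  rw [h]
  rfl

lemma rncIdeal_eq_minorIdeal (hn : 0 < n) : rncIdeal k n = minorIdeal k n n := by
  ext p
  rw [mem_rncIdeal]
  constructor
  · intro h
    refine mem_minorIdeal_of_curveMap_eq_zero hn le_rfl ?_
    rw [curveMap_eq_map, h, map_zero]
  · intro h
    have := curveMap_eq_zero_of_mem le_rfl h
    rw [curveMap_eq_map] at this
    exact map_injective _ (C_injective _ _) (this.trans (map_zero _).symm)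

lemma mem_rncIdeal_iff_exists_form (hn : 0 < n) {p : MvPolynomial (Fin (n + 1)) k} :
    p ∈ rncIdeal k n ↔ ∃ η, IsForm 2 η ∧ contrMap (rowY k n) (contrMap (rowX k n) η) ∅ = p := by
  rw [rncIdeal_eq_minorIdeal hn, minorIdeal_eq_span, ← rowX_eq, ← rowY_eq]
  constructor
  · exact exists_form_of_mem_minors
  · rintro ⟨η, hη, rfl⟩
    exact contrMap_contrMap_mem_minors hη

lemma rncMap_mul_contrMap {β : Finset (Fin n) → MvPolynomial (Fin (n + 1)) k} (hβ : IsForm 1 β) :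
    X 1 * rncMap k n (contrMap (rowX k n) β ∅) = X 0 * rncMap k n (contrMap (rowY k n) β ∅) := by
  rw [contrMap_apply_empty hβ, contrMap_apply_empty hβ, map_sum, map_sum, Finset.mul_sum,
    Finset.mul_sum]
  refine Finset.sum_congr rfl fun j _ => ?_
  have := j.2
  rw [map_mul, map_mul, rowX_eq, rowY_eq, initSeq, initSeq, rncMap_xvar (by omega),
    rncMap_xvar (by omega), show n - (j : ℕ) = n - (j + 1) + 1 by omega]
  ring

/-- The ideal `(X_0, …, X_{n-1})` is the preimage of the ideal `(s)`. -/
lemma mem_span_xvar_of_dvd (hn : 0 < n) {g : MvPolynomial (Fin (n + 1)) k} {e : ℕ}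
    (h : X 0 ∣ rncMap k n g * X 1 ^ e) : g ∈ Ideal.span (xvar k n '' Set.Iio n) := by
  let φ : MvPolynomial (Fin 2) k →ₐ[k] Polynomial k := aeval ![0, Polynomial.X]
  let χ : MvPolynomial (Fin (n + 1)) k →ₐ[k] Polynomial k :=
    aeval fun i => if (i : ℕ) < n then 0 else Polynomial.X
  let θ : Polynomial k →ₐ[k] MvPolynomial (Fin (n + 1)) k := Polynomial.aeval (xvar k n n)
  -- Setting s = 0 sends X_n to t^n and the other variables to 0. This is reduction modulo X_0, …,
  -- X_{n-1} followed by the injection X_n ↦ t^n.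
  have h1 : φ.comp (rncMap k n) = (Polynomial.expand k n).comp χ := by
    ext1 i
    simp only [AlgHom.comp_apply, rncMap, χ, aeval_X]
    split_ifs with hi
    · simp [φ, show n - (i : ℕ) ≠ 0 by omega]
    · simp [φ, show (i : ℕ) = n by omega]
  have h2 : killMap k n n = θ.comp χ := by
    ext1 i
    simp only [AlgHom.comp_apply, killMap, χ, aeval_X]
    split_ifs with hi
    · simp
    · simp [θ, X_eq_xvar, show (i : ℕ) = n by omega]
  have h3 : φ (rncMap k n g) = 0 := by
    obtain ⟨q, hq⟩ := h
    have := congrArg φ hq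
    simp only [map_mul, map_pow] at this
    simpa [φ] using this
  rw [mem_span_xvar_iff (by omega), h2, AlgHom.comp_apply]
  rw [← AlgHom.comp_apply, h1, AlgHom.comp_apply, Polynomial.expand_eq_zero hn] at h3
  rw [h3, map_zero]

lemma mem_span_xvar_iff_exists_form {p : MvPolynomial (Fin (n + 1)) k} :
    p ∈ Ideal.span (xvar k n '' Set.Iio n) ↔
      ∃ γ, IsForm 1 γ ∧ contrMap (rowX k n) γ ∅ = p := by
  rw [← range_initSeq, ← rowX_eq]
  constructor
  · intro h
    have hω : IsForm 0 (fun S : Finset (Fin n) => if S = ∅ then p else 0) :=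
      fun S hS => if_neg (by simpa using hS)
    obtain ⟨γ, hγ, hγ'⟩ := (hω.mem_span_iff (rowX k n)).1 (by simpa using h)
    exact ⟨γ, hγ, by simp [hγ']⟩
  · rintro ⟨γ, hγ, rfl⟩
    exact ((hγ.contrMap _).mem_span_iff _).2 ⟨γ, hγ, rfl⟩

end Curve

/-! ### The module resolved by a member of the family. -/

section Augmentation

lemma IsForm.congr {A : Type*} [CommRing A] {m p q : ℕ} {ω : Finset (Fin m) → A} (hω : IsForm p ω)
    (h : p = q) : IsForm q ω := h ▸ hω

variable {k : Type*} [Field k] {n : ℕ}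

variable (k n) in
/-- The augmentation `Sym_c → k[s, t]`, `(ω_0, …, ω_c) ↦ ∑_q ω_q t^{c-q} (-s)^q`. -/
noncomputable def augment (c : ℕ) (ω : ℕ → Finset (Fin n) → MvPolynomial (Fin (n + 1)) k) :
    MvPolynomial (Fin 2) k :=
  ∑ q ∈ Finset.range (c + 1), rncMap k n (ω q ∅) * (X 1 ^ (c - q) * (-X 0) ^ q)

/-- The sum telescopes because t times the `x`-contraction equals s times the `y`-contraction on the
curve. Only a term with `η c = 0` remains. -/
lemma augment_eq_zero {c : ℕ} {ω η : ℕ → Finset (Fin n) → MvPolynomial (Fin (n + 1)) k}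
    (hη : ∀ q, IsForm 1 (η q)) (hc : η c = 0) (h0 : ω 0 = contrMap (rowX k n) (η 0))
    (hs : ∀ q < c, ω (q + 1) = contrMap (rowX k n) (η (q + 1)) + contrMap (rowY k n) (η q)) :
    augment k n c ω = 0 := by
  have key : ∀ r ≤ c, ∑ q ∈ Finset.range (r + 1),
      rncMap k n (ω q ∅) * (X 1 ^ (c - q) * (-X 0) ^ q) =
        rncMap k n (contrMap (rowX k n) (η r) ∅) * (X 1 ^ (c - r) * (-X 0) ^ r) := by
    intro r hr
    induction r with
    | zero => simp [h0]
    | succ r ih =>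
      rw [Finset.sum_range_succ, ih (by omega), hs r (by omega), Pi.add_apply, map_add,
        show c - r = c - (r + 1) + 1 by omega]
      linear_combination X 1 ^ (c - (r + 1)) * (-X 0) ^ r * rncMap_mul_contrMap (hη r)
  rw [augment, key c le_rfl, hc]
  simp

/-- All terms but the first contain s, so s divides the image of ω_0 times a power of t and ω_0 lies
in (X_0, …, X_{n-1}). Removing it with the help of η and dividing by -s lowers the degree; in degree
0 the relation says membership in J, the image of the composite contraction. -/
lemma exists_of_augment_eq_zero (hn : 0 < n) (r : ℕ)
    (ω : ℕ → Finset (Fin n) → MvPolynomial (Fin (n + 1)) k) (hω : ∀ q, IsForm 0 (ω q))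
    (h : augment k n (r + 1) ω = 0) :
    ∃ η : ℕ → Finset (Fin n) → MvPolynomial (Fin (n + 1)) k, (∀ q, IsForm 1 (η q)) ∧
      contrMap (rowX k n) (η 0) = ω 0 ∧
      (∀ q < r, contrMap (rowX k n) (η (q + 1)) + contrMap (rowY k n) (η q) = ω (q + 1)) ∧
      contrMap (rowY k n) (η r) = ω (r + 1) := by
  refine exists_strand_eq (rowX k n) (rowY k n) (p := 0)
    (fun r ω => (∀ q, IsForm 0 (ω q)) ∧ augment k n r ω = 0) ?_ ?_ r ω ⟨hω, h⟩
  · rintro ω ⟨hω, h⟩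
    simp only [augment, zero_add, Finset.range_one, Finset.sum_singleton, Nat.sub_self, pow_zero,
      mul_one] at h
    obtain ⟨η, hη, hη'⟩ := (mem_rncIdeal_iff_exists_form hn).1 (mem_rncIdeal.2 h)
    exact ⟨η, hη, ((hη.contrMap _).contrMap _).eq_of_apply_empty (hω 0) hη'⟩
  · rintro r ω ⟨hω, h⟩
    rw [augment, Finset.sum_range_succ'] at h
    simp only [Nat.sub_zero, pow_zero, mul_one, Nat.add_sub_add_right] at h
    obtain ⟨η, hη, hη'⟩ := mem_span_xvar_iff_exists_form.1
      (mem_span_xvar_of_dvd hn (g := ω 0 ∅) (e := r + 1) (by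
        rw [← (neg_eq_of_add_eq_zero_right h), dvd_neg]
        refine Finset.dvd_sum fun q _ => ?_
        rw [pow_succ, ← mul_assoc, ← mul_assoc]
        exact Dvd.dvd.mul_left ((dvd_neg).2 dvd_rfl) _))
    refine ⟨η, hη, (hη.contrMap _).eq_of_apply_empty (hω 0) hη', fun q => ?_, ?_⟩
    · dsimp only
      split_ifs
      · exact (hω 1).sub (hη.contrMap _)
      · exact hω _
    · have hX : (-X 0 : MvPolynomial (Fin 2) k) ≠ 0 := neg_ne_zero.2 (X_ne_zero _)
      refine (mul_eq_zero.1 ?_).resolve_left hX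
      rw [augment, Finset.sum_range_succ']
      rw [Finset.sum_range_succ'] at h
      have hη2 := rncMap_mul_contrMap hη
      rw [hη'] at hη2
      simp only [Nat.add_eq_zero_iff, one_ne_zero, and_false, if_false, if_true, pow_zero, mul_one,
        Nat.sub_zero, Pi.sub_apply, map_sub, zero_add, pow_one] at h ⊢
      rw [mul_add, Finset.mul_sum]
      rw [Finset.sum_congr rfl fun q _ => show -X 0 * (rncMap k n (ω (q + 1 + 1) ∅) *
        (X 1 ^ (r - (q + 1)) * (-X 0) ^ (q + 1))) = rncMap k n (ω (q + 1 + 1) ∅) *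
        (X 1 ^ (r - (q + 1)) * (-X 0) ^ (q + 1 + 1)) by ring]
      linear_combination h - X 1 ^ r * hη2

lemma sum_mul_eq_sum_range {p N c : ℕ} (hp : p = 0) (hN : N = c + 1)
    (v : {S : Finset (Fin n) // S.card = p} × Fin N → MvPolynomial (Fin (n + 1)) k) :
    ∑ b, rncMap k n (v b) * (X 1 ^ (c - (b.2 : ℕ)) * (-X 0) ^ (b.2 : ℕ)) =
      augment k n c (toForm v) := by
  subst hp hN
  have : Unique {S : Finset (Fin n) // S.card = 0} :=
    ⟨⟨⟨∅, rfl⟩⟩, fun S => Subtype.ext (Finset.card_eq_zero.1 S.2)⟩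
  rw [Fintype.sum_prod_type, Fintype.sum_unique, augment, Finset.sum_range]
  refine Finset.sum_congr rfl fun q _ => ?_
  rw [show toForm v q ∅ = v (default, q) from ?_]
  rw [← toForm_apply v (default, q)]
  congr 1
  exact (Finset.card_eq_zero.1 (default : {S : Finset (Fin n) // S.card = 0}).2).symm

variable (k n) in
/-- The augmentation of the complex `enFamily k n m₀ d c`. -/
noncomputable def famAug (c : ℕ)
    (v : {S : Finset (Fin n) // S.card = famCard c 0} × Fin (famRank c 0) →
      MvPolynomial (Fin (n + 1)) k) : MvPolynomial (Fin 2) k :=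
  ∑ b, rncMap k n (v b) * (X 1 ^ (c - (b.2 : ℕ)) * (-X 0) ^ (b.2 : ℕ))

lemma famAug_famD {c : ℕ} (hc : 0 < c)
    (u : {S : Finset (Fin n) // S.card = famCard c 1} × Fin (famRank c 1) →
      MvPolynomial (Fin (n + 1)) k) : famAug k n c ((famD k n c 0).mulVec u) = 0 := by
  have e1 := famCard_of_le (show 0 ≤ c by omega)
  have e2 := famRank_of_le (show 0 ≤ c by omega)
  have e3 := famCard_of_le (show 1 ≤ c by omega)
  have e4 := famRank_of_le (show 1 ≤ c by omega)
  have hu : ∀ q, IsForm 1 (toForm u q) := by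
    intro q
    exact (isForm_toForm u q).congr e3
  rw [famAug, sum_mul_eq_sum_range e1 (by omega), famD_of_lt hc]
  refine augment_eq_zero hu (toForm_of_le u (by omega)) ?_ fun q _ => ?_
  · exact toForm_symMat_zero (by omega) (by omega) u
  · exact toForm_symMat_succ (by omega) (by omega) u q

lemma exists_famD_zero_eq (hn : 0 < n) {c : ℕ} (hc : 0 < c)
    {v : {S : Finset (Fin n) // S.card = famCard c 0} × Fin (famRank c 0) →
      MvPolynomial (Fin (n + 1)) k} (hv : famAug k n c v = 0) :
    ∃ u, (famD k n c 0).mulVec u = v := by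
  have e1 := famCard_of_le (show 0 ≤ c by omega)
  have e2 := famRank_of_le (show 0 ≤ c by omega)
  have e3 := famCard_of_le (show 0 + 1 ≤ c by omega)
  have e4 := famRank_of_le (show 0 + 1 ≤ c by omega)
  obtain ⟨r, rfl⟩ : ∃ r, c = r + 1 := ⟨c - 1, by omega⟩
  rw [famAug, sum_mul_eq_sum_range e1 (by omega)] at hv
  have hv' : ∀ q, IsForm 0 (toForm v q) := by
    intro q
    exact (isForm_toForm v q).congr e1
  obtain ⟨η, hη, hη0, hηs, hηl⟩ := exists_of_augment_eq_zero hn r _ hv' hv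
  rw [famD_of_lt (by omega)]
  have hη' : ∀ q, IsForm (famCard (r + 1) (0 + 1)) (η q) := fun q => by rw [e3]; exact hη q
  refine ⟨fun b => η b.2 b.1.1, toForm_injective fun q hq => ?_⟩
  cases q with
  | zero =>
    rw [toForm_symMat_zero (by omega) (by omega), toForm_eq (hη' 0) (by omega), hη0]
  | succ q =>
    rw [toForm_symMat_succ (by omega) (by omega), toForm_eq (hη' q) (by omega)]
    by_cases hqr : q < r
    · rw [toForm_eq (hη' (q + 1)) (by omega), hηs q hqr]
    · obtain rfl : q = r := by omega
      rw [toForm_of_le _ (by omega), map_zero, zero_add, hηl]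

end Augmentation

/-! ### The Eagon–Northcott and Koszul complexes as resolutions. -/

section Resolutions

lemma GrComplex.mem_span_row_iff {k : Type*} [Field k] {τ : Type} {w : τ → ℕ} (F : GrComplex k w)
    (x : F.ι 0) {p : MvPolynomial τ k} :
    p ∈ Ideal.span (Set.range (F.d 0 x)) ↔ ∃ v, (F.d 0).mulVec v x = p := by
  rw [Ideal.mem_span_range_iff_exists_fun]
  simp only [Matrix.mulVec, dotProduct, mul_comm]

variable {k : Type*} [Field k] {n : ℕ}

lemma isResolution_eagonNorthcott (hn : 0 < n) (m₀ d : ℕ) :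
    (eagonNorthcott k n m₀ d).IsResolution (rncIdeal k n) := by
  refine ⟨⟨(), fun _ => rfl, rfl, ?_⟩, exactPair_rows.isExact_eagonNorthcott m₀ d⟩
  ext p
  refine ((eagonNorthcott k n m₀ d).mem_span_row_iff ()).trans ?_
  rw [mem_rncIdeal_iff_exists_form hn]
  constructor
  · rintro ⟨v, rfl⟩
    exact ⟨_, isForm_toForm _ 0, (enD_zero_mulVec v ()).symm⟩
  · rintro ⟨η, hη, rfl⟩
    refine ⟨fun b => η b.1.1, (enD_zero_mulVec _ ()).trans ?_⟩
    exact congrArg (fun ω => contrMap (rowY k n) (contrMap (rowX k n) ω) ∅)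
      (toForm_eq (η := fun _ => η) (q := 0) hη zero_lt_one)

lemma isResolution_koszul (w : Fin (n + 1) → ℕ) :
    (koszul k w).IsResolution (Ideal.span (xvar k n '' Set.Iio n)) := by
  refine ⟨⟨⟨∅, rfl⟩, fun S => Subtype.ext (Finset.card_eq_zero.1 S.2), 
    Finset.sum_empty (f := fun j : Fin n => w j.castSucc), ?_⟩,
    exactPair_rows.isExact_koszul w⟩
  ext p
  refine ((koszul k w).mem_span_row_iff _).trans ?_
  rw [mem_span_xvar_iff_exists_form]
  constructor
  · rintro ⟨v, rfl⟩
    exact ⟨_, isForm_toForm _ 0, (koszul_mulVec w 0 v ⟨∅, rfl⟩).symm⟩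
  · rintro ⟨η, hη, rfl⟩
    refine ⟨fun b => η b.1, (koszul_mulVec w 0 _ ⟨∅, rfl⟩).trans ?_⟩
    rw [toForm_eq (η := fun _ => η) (q := 0) hη (by omega)]

end Resolutions

/-! ### Cones as resolutions, their minimality, and combinations of maps. -/

namespace GrComplex

variable {k : Type*} [Field k] {τ : Type} {w : τ → ℕ}

/-- The cone of a map into a resolution of `R/I` that is injective on homology in degree `0`. -/
lemma isResolution_cone {F G : GrComplex k w} (μ : Hom F G) {I I' : Ideal (MvPolynomial τ k)}
    (hF : F.IsExact) (hG : G.IsResolution I)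
    (hinj : ∀ u, (∀ x, (μ.f 0).mulVec u x ∈ I) → ∃ z, (F.d 0).mulVec z = u)
    (hI : ∀ x, I ⊔ Ideal.span (Set.range (μ.f 0 x)) = I') : (cone μ).IsResolution I' := by
  obtain ⟨x, hx, hx0, hxI⟩ := hG.zero
  refine ⟨⟨x, hx, hx0, ?_⟩, isExact_cone μ hF hG.isExact fun u v huv => hinj u fun y => ?_⟩
  · rw [← hI x, ← hxI, ← Ideal.span_union]
    change Ideal.span (Set.range (Matrix.fromCols (G.d 0) (-(μ.f 0)) x)) = _
    refine le_antisymm (Ideal.span_le.2 ?_) (Ideal.span_le.2 ?_)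
    · rintro _ ⟨j | j, rfl⟩
      · exact Ideal.subset_span (.inl ⟨j, rfl⟩)
      · exact neg_mem (Ideal.subset_span (.inr ⟨j, rfl⟩))
    · rintro _ (⟨j, rfl⟩ | ⟨j, rfl⟩)
      · exact Ideal.subset_span ⟨Sum.inl j, rfl⟩
      · rw [← neg_neg (μ.f 0 x j)]
        exact neg_mem (Ideal.subset_span ⟨Sum.inr j, rfl⟩)
  · rw [hx y, huv, ← hxI]
    exact (G.mem_span_row_iff x).2 ⟨v, rfl⟩

lemma isMinimal_cone {F G : GrComplex k w} (μ : Hom F G) (hF : F.IsMinimal) (hG : G.IsMinimal)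
    (hμ : ∀ s i j, μ.f s i j ∈ Ideal.span (Set.range (X : τ → MvPolynomial τ k))) :
    (cone μ).IsMinimal := by
  intro s i j
  cases s with
  | zero =>
    rcases j with j | j
    · exact hG 0 i j
    · exact neg_mem (hμ 0 i j)
  | succ s =>
    rcases i with i | i <;> rcases j with j | j
    · exact hG (s + 1) i j
    · exact Ideal.mul_mem_left _ _ (hμ (s + 1) i j)
    · exact zero_mem _
    · exact hF s i j

lemma scalar_mul_comm {ι κ A : Type*} [CommRing A] [Fintype ι] [DecidableEq ι] [Fintype κ]
    [DecidableEq κ] (p : A) (M : Matrix ι κ A) :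
    Matrix.scalar ι p * M = M * Matrix.scalar κ p := by
  rw [Matrix.scalar_comm_iff, op_smul_eq_smul]

/-- Multiplication by a homogeneous polynomial. -/
noncomputable def scalarHom (F : GrComplex k w) {p : MvPolynomial τ k} {e : ℕ}
    (hp : IsWeightedHomogeneous w p e) : Hom (F.shift e) F where
  f s := Matrix.scalar (F.ι s) p
  homog s i j := by
    rw [Matrix.scalar_apply]
    by_cases h : i = j
    · subst h
      rw [Matrix.diagonal_apply_eq]
      exact .of_hom hp (add_comm _ _)
    · rw [Matrix.diagonal_apply_ne _ h]
      exact isDegZero_zero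
  comm s := scalar_mul_comm p (F.d s)

/-- The matrices of a map from a shifted complex. -/
def Hom.mat {F G : GrComplex k w} {e : ℕ} (φ : Hom (F.shift e) G) (s : ℕ) :
    Matrix (G.ι s) (F.ι s) (MvPolynomial τ k) := φ.f s

lemma Hom.mat_comm {F G : GrComplex k w} {e : ℕ} (φ : Hom (F.shift e) G) (s : ℕ) :
    φ.mat s * F.d s = G.d s * φ.mat (s + 1) := φ.comm s

/-- The difference of multiples of two maps. -/
noncomputable def Hom.smulSub {F G : GrComplex k w} {e e' δ r r' : ℕ} (φ : Hom (F.shift e) G)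
    (ψ : Hom (F.shift e') G) {p q : MvPolynomial τ k} (hp : IsWeightedHomogeneous w p r)
    (hq : IsWeightedHomogeneous w q r') (hr : r + e = δ) (hr' : r' + e' = δ) :
    Hom (F.shift δ) G where
  f s := p • φ.mat s - q • ψ.mat s
  homog s i j := by
    refine IsDegZero.sub ?_ ?_
    · have h := (φ.homog s i j).mul (.of_hom hp
        (show r + (F.deg s j + e) = F.deg s j + δ by omega))
      rw [mul_comm] at h
      exact h
    · have h := (ψ.homog s i j).mul (.of_hom hq
        (show r' + (F.deg s j + e') = F.deg s j + δ by omega))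
      rw [mul_comm] at h
      exact h
  comm s := by
    change (p • φ.mat s - q • ψ.mat s) * F.d s = G.d s * (p • φ.mat (s + 1) - q • ψ.mat (s + 1))
    rw [Matrix.sub_mul, Matrix.mul_sub, Matrix.smul_mul, Matrix.smul_mul, φ.mat_comm, ψ.mat_comm,
      Matrix.mul_smul, Matrix.mul_smul]

/-- The minimal resolution is the minimized cone of any map whose cone is a resolution. -/
lemma IsMinimalResolution.isMinCone {F G M : GrComplex k w} {μ : Hom F G}
    {I : Ideal (MvPolynomial τ k)} (hM : M.IsMinimalResolution I) (hw : ∀ t, 0 < w t)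
    (hμ : (cone μ).IsResolution I) : IsMinCone μ M :=
  ⟨hM.2, hμ.exists_splitting hw hM⟩

end GrComplex

open GrComplex

/-! ### The polynomials Δ_i, the ideals I_i, and the colon ideals. -/

section Curve

variable {k : Type*} [Field k] {n m₀ d a b : ℕ}

variable (k) in
/-- The equation `t^{m₀} - s^{m₀ + n d}`. -/
noncomputable def monomialForm (n m₀ d : ℕ) : MvPolynomial (Fin 2) k :=
  X 1 ^ m₀ - X 0 ^ (m₀ + n * d)

lemma monomialForm_ne_zero (hm₀ : 0 < m₀) : monomialForm k n m₀ d ≠ 0 := by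
  intro h
  have := congrArg (eval ![0, 1]) h
  rw [monomialForm] at this
  simp [hm₀.ne'] at this

/-- The relation m₀ = an + b makes the cofactor independent of i: all Δ_i become monomial multiples
of one polynomial. Every later computation with I_i takes place in k[s,t] through this formula. -/
lemma rncMap_Delta (hm₀ : m₀ = a * n + b) {i : ℕ} (hi : b ≤ i) (hin : i ≤ n) :
    rncMap k n (Delta k n a b d i) =
      X 0 ^ (n - i) * X 1 ^ (i - b) * monomialForm k n m₀ d := by
  obtain ⟨c, rfl⟩ := Nat.exists_eq_add_of_le hi
  rw [Delta, map_sub, map_mul, map_mul, map_pow, map_pow, rncMap_xvar le_rfl, rncMap_xvar hin,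
    rncMap_xvar (Nat.zero_le n), rncMap_xvar (by omega), monomialForm, hm₀,
    show b + c - b = c by omega, show n - c = n - (b + c) + b by omega]
  simp only [Nat.sub_self, pow_zero, one_mul, mul_one, Nat.sub_zero, ← pow_mul]
  ring

lemma isWeightedHomogeneous_xvar {i : ℕ} (hi : i ≤ n) :
    IsWeightedHomogeneous (arithSeq n m₀ d) (xvar k n i) (m₀ + i * d) := by
  have := isWeightedHomogeneous_X k (arithSeq n m₀ d) (Fin.ofNat (n + 1) i)
  rwa [arithSeq, xvar_val hi] at this

lemma isWeightedHomogeneous_xvar_pow {i : ℕ} (hi : i ≤ n) (e : ℕ) :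
    IsWeightedHomogeneous (arithSeq n m₀ d) (xvar k n i ^ e) (e * (m₀ + i * d)) := by
  simpa using (isWeightedHomogeneous_xvar hi).pow e

lemma isWeightedHomogeneous_Delta (hm₀ : m₀ = a * n + b) {i : ℕ} (hi : b ≤ i) (hin : i ≤ n) :
    IsWeightedHomogeneous (arithSeq n m₀ d) (Delta k n a b d i) (delta m₀ a b d i) := by
  obtain ⟨c, rfl⟩ := Nat.exists_eq_add_of_le hi
  refine (weightedHomogeneousSubmodule k (arithSeq n m₀ d) _).sub_mem ?_ ?_
  · have := (isWeightedHomogeneous_xvar_pow (k := k) (m₀ := m₀) (d := d) (le_refl n) a).mul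
      (isWeightedHomogeneous_xvar hin)
    refine (mem_weightedHomogeneousSubmodule ..).2 ?_
    convert this using 1
    simp only [delta, hm₀, Nat.add_sub_cancel_left]
    ring
  · have := (isWeightedHomogeneous_xvar_pow (k := k) (m₀ := m₀) (d := d) (Nat.zero_le n)
      (a + d)).mul (isWeightedHomogeneous_xvar (show b + c - b ≤ n by omega))
    refine (mem_weightedHomogeneousSubmodule ..).2 ?_
    convert this using 1
    simp only [delta, Nat.add_sub_cancel_left]
    ring

lemma Delta_ne_zero (hb : 1 ≤ b) (hm₀ : m₀ = a * n + b) {i : ℕ} (hi : b ≤ i) (hin : i ≤ n) :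
    Delta k n a b d i ≠ 0 := by
  intro h
  have h1 := rncMap_Delta (k := k) (d := d) hm₀ hi hin
  rw [h, map_zero] at h1
  exact mul_ne_zero (mul_ne_zero (pow_ne_zero _ (X_ne_zero _)) (pow_ne_zero _ (X_ne_zero _)))
    (monomialForm_ne_zero (by omega)) h1.symm

lemma xvar_pow_mem {e : ℕ} (he : 1 ≤ e) (i : ℕ) :
    xvar k n i ^ e ∈ Ideal.span (Set.range (X : Fin (n + 1) → MvPolynomial (Fin (n + 1)) k)) :=
  Ideal.pow_mem_of_mem _ (Ideal.subset_span (Set.mem_range_self _)) _ he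

lemma Delta_mem (ha : 1 ≤ a) (i : ℕ) : Delta k n a b d i ∈
    Ideal.span (Set.range (X : Fin (n + 1) → MvPolynomial (Fin (n + 1)) k)) :=
  sub_mem (Ideal.mul_mem_right _ _ (xvar_pow_mem ha n))
    (Ideal.mul_mem_right _ _ (xvar_pow_mem (by omega) 0))

/-- Elements of `I_i` map to multiples of `s^{n-i} (t^{m₀} - s^{m₀ + n d})`. -/
lemma dvd_rncMap_of_mem_idealI (hm₀ : m₀ = a * n + b) {i : ℕ} (hin : i ≤ n)
    {r : MvPolynomial (Fin (n + 1)) k} (hr : r ∈ idealI k n a b d i) :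
    X 0 ^ (n - i) * monomialForm k n m₀ d ∣ rncMap k n r := by
  have hle : idealI k n a b d i ≤ (Ideal.span {X 0 ^ (n - i) * monomialForm k n m₀ d}).comap
      (rncMap k n) := by
    refine sup_le (fun p hp => ?_) (Ideal.span_le.2 ?_)
    · rw [Ideal.mem_comap, mem_rncIdeal.1 hp]
      exact zero_mem _
    · rintro _ ⟨j, ⟨hj, hji⟩, rfl⟩
      rw [SetLike.mem_coe, Ideal.mem_comap, Ideal.mem_span_singleton, rncMap_Delta hm₀ hj
        (hji.trans hin), show n - j = n - i + (i - j) by omega]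
      exact ⟨X 0 ^ (i - j) * X 1 ^ (j - b), by ring⟩
  exact Ideal.mem_span_singleton.1 (hle hr)

lemma rncIdeal_le_idealI (i : ℕ) : rncIdeal k n ≤ idealI k n a b d i := le_sup_left

lemma Delta_mem_idealI {i j : ℕ} (hj : b ≤ j) (hji : j ≤ i) :
    Delta k n a b d j ∈ idealI k n a b d i :=
  Submodule.mem_sup_right (Ideal.subset_span ⟨j, ⟨hj, hji⟩, rfl⟩)

lemma idealI_self : idealI k n a b d b = rncIdeal k n ⊔ Ideal.span {Delta k n a b d b} := by
  rw [idealI, Set.Icc_self, Set.image_singleton]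

lemma idealI_sup {i : ℕ} (hi : b + 1 ≤ i) :
    idealI k n a b d (i - 1) ⊔ Ideal.span {Delta k n a b d i} = idealI k n a b d i := by
  obtain ⟨j, rfl⟩ : ∃ j, i = j + 1 := ⟨i - 1, by omega⟩
  rw [idealI, idealI, sup_assoc, ← Ideal.span_union, Nat.add_sub_cancel,
    ← Set.image_singleton (f := Delta k n a b d), ← Set.image_union]
  congr 3
  ext x
  simp
  omega

/-- The colon ideal `I_{i-1} : Δ_i` is contained in `(X_0, …, X_{n-1})`. -/
lemma mem_span_xvar_of_Delta_mul_mem (hb : 1 ≤ b) (hm₀ : m₀ = a * n + b) {i : ℕ} (hi : b + 1 ≤ i)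
    (hin : i ≤ n) {u : MvPolynomial (Fin (n + 1)) k}
    (hu : Delta k n a b d i * u ∈ idealI k n a b d (i - 1)) :
    u ∈ Ideal.span (xvar k n '' Set.Iio n) := by
  refine mem_span_xvar_of_dvd (by omega) (e := i - b) ?_
  have h := dvd_rncMap_of_mem_idealI hm₀ (by omega) hu
  rw [map_mul, rncMap_Delta hm₀ (by omega) hin, show n - (i - 1) = n - i + 1 by omega] at h
  have h0 : X 0 ^ (n - i) * monomialForm k n m₀ d ≠ 0 :=
    mul_ne_zero (pow_ne_zero _ (X_ne_zero _)) (monomialForm_ne_zero (by omega))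
  -- The image of Δ_i contains one factor s less than the common divisor of the images of elements
  -- of I_{i-1}. After cancellation, s divides t^{i-b} times the image of `u`.
  refine (mul_dvd_mul_iff_left h0).1 ?_
  convert h using 1 <;> ring

/-- Δ_i X_j and Δ_{i-1} X_{j+1} have the same image on the curve, so they are congruent modulo J.
This is the other inclusion for the colon ideal. -/
lemma Delta_mul_xvar_mem (hb : 1 ≤ b) (hm₀ : m₀ = a * n + b) {i : ℕ} (hi : b + 1 ≤ i) (hin : i ≤ n)
    {j : ℕ} (hj : j < n) :
    Delta k n a b d i * xvar k n j ∈ idealI k n a b d (i - 1) := by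
  have h : Delta k n a b d i * xvar k n j - Delta k n a b d (i - 1) * xvar k n (j + 1) ∈
      rncIdeal k n := by
    rw [mem_rncIdeal, map_sub, map_mul, map_mul, rncMap_Delta hm₀ (by omega) hin,
      rncMap_Delta hm₀ (by omega) (by omega), rncMap_xvar (by omega), rncMap_xvar (by omega),
      show n - (i - 1) = n - i + 1 by omega, show i - b = i - 1 - b + 1 by omega,
      show n - j = n - (j + 1) + 1 by omega]
    ring
  rw [← sub_add_cancel (Delta k n a b d i * xvar k n j)
    (Delta k n a b d (i - 1) * xvar k n (j + 1))]
  exact add_mem (rncIdeal_le_idealI _ h)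
    (Ideal.mul_mem_right _ _ (Delta_mem_idealI (by omega) le_rfl))

end Curve

open GrComplex

/-! ### Maps into the Eagon–Northcott complex, and the resolutions of R/I_i. -/

section Lifts

variable {k : Type*} [Field k] {n m₀ d a b : ℕ}

variable (k n) in
/-- The row `((-1)^q X_{e+c-q})_{0 ≤ q ≤ c}`. -/
noncomputable def genRow (e c : ℕ) (y : {S : Finset (Fin n) // S.card = famCard c 0} ×
    Fin (famRank c 0)) : MvPolynomial (Fin (n + 1)) k :=
  (-1) ^ (y.2 : ℕ) * xvar k n (e + c - y.2)

lemma val_le_of_famRank {c : ℕ} (q : Fin (famRank c 0)) : (q : ℕ) ≤ c := by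
  have := q.2.trans_eq (famRank_of_le (Nat.zero_le c))
  omega

/-- On the curve X_{e+c-q} is the fixed monomial s^{n-e-c} t^e times t^{c-q} s^q. So a row of
consecutive variables with alternating signs is the augmentation up to a monomial factor, and it
kills boundaries modulo J. -/
lemma rncMap_sum_genRow {e c : ℕ} (hec : e + c ≤ n)
    (v : {S : Finset (Fin n) // S.card = famCard c 0} × Fin (famRank c 0) →
      MvPolynomial (Fin (n + 1)) k) :
    rncMap k n (∑ y, genRow k n e c y * v y) = X 0 ^ (n - (e + c)) * X 1 ^ e * famAug k n c v := by
  rw [map_sum, famAug, Finset.mul_sum]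
  refine Finset.sum_congr rfl fun y _ => ?_
  have := val_le_of_famRank y.2
  rw [map_mul, genRow, map_mul, map_pow, map_neg, map_one, rncMap_xvar (by omega),
    show n - (e + c - (y.2 : ℕ)) = n - (e + c) + y.2 by omega,
    show e + c - (y.2 : ℕ) = e + (c - y.2) by omega, neg_pow (X 0 : MvPolynomial (Fin 2) k)]
  ring

lemma famCard_zero_sum {c : ℕ} (f : Fin n → ℕ)
    (S : {S : Finset (Fin n) // S.card = famCard c 0}) : ∑ j ∈ S.1, f j = 0 := by
  rw [Finset.card_eq_zero.1 (S.2.trans (famCard_of_le (Nat.zero_le c))), Finset.sum_empty]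

lemma sum_genRow_famD_mem {e c : ℕ} (hc : 0 < c) (hec : e + c ≤ n)
    (l : {S : Finset (Fin n) // S.card = famCard c 1} × Fin (famRank c 1)) :
    ∑ y, genRow k n e c y * famD k n c 0 y l ∈ rncIdeal k n := by
  have h1 := famAug_famD (k := k) (n := n) hc (Pi.single l 1)
  rw [Matrix.mulVec_single_one] at h1
  rw [mem_rncIdeal]
  refine (rncMap_sum_genRow hec _).trans ?_
  rw [show famAug k n c (fun y => famD k n c 0 y l) = 0 from h1, mul_zero]

/-- The map from `enFamily` to the Eagon–Northcott complex given by `X_{e+c}, …, X_e`. -/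
lemma exists_hom_genRow (m₀ d : ℕ) {e c : ℕ} (hc : 0 < c) (hec : e + c ≤ n) :
    ∃ φ : Hom ((enFamily k n m₀ d c).shift (m₀ + e * d)) (eagonNorthcott k n m₀ d),
      ∀ x y, φ.mat 0 x y = genRow k n e c y := by
  suffices h : ∃ φ : Hom ((enFamily k n m₀ d c).shift (m₀ + e * d)) (eagonNorthcott k n m₀ d),
      φ.f 0 = Matrix.of fun _ y => genRow k n e c y by
    obtain ⟨φ, hφ⟩ := h
    exact ⟨φ, fun x y => congrFun (congrFun hφ x) y⟩
  refine exists_hom (exactPair_rows.isExact_eagonNorthcott m₀ d) _ (fun x y => ?_) fun l => ?_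
  · refine IsDegZero.sign_mul (.of_hom (isWeightedHomogeneous_xvar ?_) ?_) _
    · omega
    · have h1 := famCard_zero_sum (fun j => arithSeq n m₀ d j.castSucc) y.1
      have h2 := val_le_of_famRank y.2
      change m₀ + (e + c - (y.2 : ℕ)) * d + 0 = ∑ j ∈ y.1.1, arithSeq n m₀ d j.castSucc +
        (if 0 ≤ c then c - (y.2 : ℕ) else c + 1 + y.2) * d + (m₀ + e * d)
      rw [h1, if_pos (Nat.zero_le c), show e + c - (y.2 : ℕ) = e + (c - y.2) by omega]
      ring
  · have h := sum_genRow_famD_mem (k := k) hc hec l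
    rcases Nat.eq_zero_or_pos n with rfl | hn
    · omega
    obtain ⟨x, hx, -, hxI⟩ := (isResolution_eagonNorthcott (k := k) hn m₀ d).zero
    rw [← hxI] at h
    obtain ⟨v, hv⟩ := ((eagonNorthcott k n m₀ d).mem_span_row_iff x).1 h
    refine ⟨v, funext fun y => ?_⟩
    rw [hx y, hv]
    rfl

/-- The two monomials of Δ_{b+c-q} belong to the rows with offsets b and 0. This permits lifting
them separately, with the powers of X_n and X_0 kept outside. -/
lemma sum_genRow_eq_Delta {c : ℕ} (y : {S : Finset (Fin n) // S.card = famCard c 0} ×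
    Fin (famRank c 0)) :
    xvar k n n ^ a * genRow k n b c y - xvar k n 0 ^ (a + d) * genRow k n 0 c y =
      (-1) ^ (y.2 : ℕ) * Delta k n a b d (b + c - y.2) := by
  have := val_le_of_famRank y.2
  rw [genRow, genRow, Delta, show 0 + c - (y.2 : ℕ) = b + c - y.2 - b by omega]
  ring

lemma span_range_Delta {c : ℕ} {f : {S : Finset (Fin n) // S.card = famCard c 0} ×
      Fin (famRank c 0) → MvPolynomial (Fin (n + 1)) k}
    (hf : ∀ y, f y = (-1) ^ (y.2 : ℕ) * Delta k n a b d (b + c - y.2)) :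
    Ideal.span (Set.range f) = Ideal.span (Delta k n a b d '' Set.Icc b (b + c)) := by
  refine le_antisymm (Ideal.span_le.2 ?_) (Ideal.span_le.2 ?_)
  · rintro _ ⟨y, rfl⟩
    have := val_le_of_famRank y.2
    rw [hf]
    exact Ideal.mul_mem_left _ _ (Ideal.subset_span ⟨_, ⟨by omega, by omega⟩, rfl⟩)
  · rintro _ ⟨j, ⟨hj, hjc⟩, rfl⟩
    let y : {S : Finset (Fin n) // S.card = famCard c 0} × Fin (famRank c 0) :=
      (⟨∅, (famCard_of_le (Nat.zero_le c)).symm⟩,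
        ⟨b + c - j, by rw [famRank_of_le (Nat.zero_le c)]; omega⟩)
    have h : Delta k n a b d j = (-1) ^ (y.2 : ℕ) * f y := by
      rw [hf, ← mul_assoc, ← pow_add, ← two_mul, pow_mul, neg_one_sq, one_pow, one_mul,
        show b + c - (y.2 : ℕ) = j by change b + c - (b + c - j) = j; omega]
    rw [SetLike.mem_coe, h]
    exact Ideal.mul_mem_left _ _ (Ideal.subset_span ⟨y, rfl⟩)

lemma isHomogeneous_shift_eq (hm₀ : m₀ = a * n + b) :
    a * (m₀ + n * d) + (m₀ + b * d) = delta m₀ a b d b := by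
  simp only [delta, hm₀, Nat.sub_self]
  ring

/-- The image of the sum on the curve is s^{n-b-c} (t^{m₀} - s^{m₀+nd}) times the augmentation, in a
domain. This is injectivity on homology in degree 0 for the cone. -/
lemma famAug_eq_zero_of_mem (hb : 1 ≤ b) (hm₀ : m₀ = a * n + b) {c : ℕ} (hcn : b + c ≤ n)
    {u : {S : Finset (Fin n) // S.card = famCard c 0} × Fin (famRank c 0) →
      MvPolynomial (Fin (n + 1)) k}
    (h : ∑ y, (xvar k n n ^ a * genRow k n b c y - xvar k n 0 ^ (a + d) * genRow k n 0 c y) * u y ∈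
      rncIdeal k n) : famAug k n c u = 0 := by
  simp only [sub_mul, Finset.sum_sub_distrib, mul_assoc, ← Finset.mul_sum] at h
  rw [mem_rncIdeal, map_sub, map_mul, map_mul, rncMap_sum_genRow hcn,
    rncMap_sum_genRow (by omega), map_pow, map_pow, rncMap_xvar le_rfl,
    rncMap_xvar (Nat.zero_le n)] at h
  have h1 : X 0 ^ (n - (b + c)) * monomialForm k n m₀ d * famAug k n c u = 0 := by
    rw [← h, monomialForm, hm₀, show n - (0 + c) = n - (b + c) + b by omega]
    simp only [Nat.sub_self, pow_zero, one_mul, mul_one, Nat.sub_zero, ← pow_mul]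
    ring
  exact (mul_eq_zero.1 h1).resolve_left
    (mul_ne_zero (pow_ne_zero _ (X_ne_zero _)) (monomialForm_ne_zero (by omega)))

/-- The resolution of `R/I_i` for `i > b`. -/
lemma exists_isMinimalResolution_of_lt (ha : 1 ≤ a) (hb : 1 ≤ b) (hm₀ : m₀ = a * n + b) {c : ℕ}
    (hc : 0 < c) (hcn : b + c ≤ n) :
    ∃ μ : Hom ((enFamily k n m₀ d c).shift (delta m₀ a b d b)) (eagonNorthcott k n m₀ d),
      (cone μ).IsMinimalResolution (idealI k n a b d (b + c)) := by
  obtain ⟨φ, hφ⟩ := exists_hom_genRow (k := k) m₀ d hc hcn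
  obtain ⟨ψ, hψ⟩ := exists_hom_genRow (k := k) (n := n) m₀ d hc (show 0 + c ≤ n by omega)
  -- In every homological degree the entries lie in (X_n^a, X_0^{a+d}), even if those of the two
  -- lifts are units. This is what makes the cone minimal.
  let μ := φ.smulSub ψ (δ := delta m₀ a b d b)
    (isWeightedHomogeneous_xvar_pow (k := k) (m₀ := m₀) (d := d) (le_refl n) a)
    (isWeightedHomogeneous_xvar_pow (k := k) (m₀ := m₀) (d := d) (Nat.zero_le n) (a + d))
    (isHomogeneous_shift_eq hm₀) (by simp only [delta, Nat.sub_self]; ring)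
  have hμ : ∀ x y, μ.mat 0 x y =
      xvar k n n ^ a * genRow k n b c y - xvar k n 0 ^ (a + d) * genRow k n 0 c y := by
    intro x y
    change xvar k n n ^ a * φ.mat 0 x y - xvar k n 0 ^ (a + d) * ψ.mat 0 x y = _
    rw [hφ, hψ]
  refine ⟨μ, isResolution_cone μ (exactPair_rows.isExact_enFamily m₀ d c)
    (isResolution_eagonNorthcott (by omega) m₀ d) (fun u hu => ?_) fun x => ?_,
    isMinimal_cone μ (isMinimal_enFamily m₀ d c) (isMinimal_eagonNorthcott m₀ d) fun s x y => ?_⟩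
  · refine exists_famD_zero_eq (by omega) hc ?_
    have h : (μ.f 0).mulVec u () = ∑ y, (xvar k n n ^ a * genRow k n b c y -
        xvar k n 0 ^ (a + d) * genRow k n 0 c y) * u y :=
      Finset.sum_congr rfl fun y _ => congrArg (· * u y) (hμ () y)
    exact famAug_eq_zero_of_mem hb hm₀ hcn (h ▸ hu ())
  · rw [idealI, ← span_range_Delta fun y => (hμ x y).trans (sum_genRow_eq_Delta y)]
    rfl
  · exact sub_mem (Ideal.mul_mem_right _ _ (xvar_pow_mem ha n))
      (Ideal.mul_mem_right _ _ (xvar_pow_mem (by omega) 0))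

lemma scalar_mulVec {ι A : Type*} [CommRing A] [Fintype ι] [DecidableEq ι] (p : A) (u : ι → A) :
    (Matrix.scalar ι p).mulVec u = fun i => p * u i := by
  ext1 i
  rw [Matrix.scalar_apply, Matrix.mulVec_diagonal]

lemma scalar_mem {ι A : Type*} [CommRing A] [Fintype ι] [DecidableEq ι] {p : A} {I : Ideal A}
    (hp : p ∈ I) (i j : ι) : Matrix.scalar ι p i j ∈ I := by
  rw [Matrix.scalar_apply, Matrix.diagonal_apply]
  split_ifs
  · exact hp
  · exact zero_mem _

/-- The resolution of `R/I_b`. -/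
lemma isMinimalResolution_cone_scalarHom (ha : 1 ≤ a) (hb : 1 ≤ b) (hbn : b ≤ n)
    (hm₀ : m₀ = a * n + b) :
    (cone (scalarHom (eagonNorthcott k n m₀ d) (isWeightedHomogeneous_Delta hm₀ le_rfl
      hbn))).IsMinimalResolution (idealI k n a b d b) := by
  have hE := isResolution_eagonNorthcott (k := k) (n := n) (by omega) m₀ d
  have h0 : ∀ x y, (scalarHom (eagonNorthcott k n m₀ d) (isWeightedHomogeneous_Delta (k := k)
      (d := d) hm₀ le_rfl hbn)).mat 0 x y = Delta k n a b d b := fun _ _ =>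
    Matrix.diagonal_apply_eq (n := Unit) _ _
  refine ⟨isResolution_cone _ hE.isExact hE (fun u hu => ?_) fun x => ?_,
    isMinimal_cone _ (isMinimal_eagonNorthcott m₀ d) (isMinimal_eagonNorthcott m₀ d)
      fun s x y => ?_⟩
  · obtain ⟨x, hx, -, hxI⟩ := hE.zero
    have h1 : u x ∈ rncIdeal k n := by
      have h : Delta k n a b d b * u x ∈ rncIdeal k n :=
        congrFun (scalar_mulVec (Delta k n a b d b) u) x ▸ hu x
      rw [mem_rncIdeal, map_mul, rncMap_Delta hm₀ le_rfl hbn] at h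
      rw [mem_rncIdeal]
      exact (mul_eq_zero.1 h).resolve_left (mul_ne_zero (mul_ne_zero (pow_ne_zero _ (X_ne_zero _))
        (pow_ne_zero _ (X_ne_zero _))) (monomialForm_ne_zero (by omega)))
    rw [← hxI] at h1
    obtain ⟨v, hv⟩ := ((eagonNorthcott k n m₀ d).mem_span_row_iff x).1 h1
    exact ⟨v, funext fun y => (hx y) ▸ hv⟩
  · rw [idealI_self]
    congr 2
    ext p
    constructor
    · rintro ⟨y, rfl⟩
      exact h0 x y
    · rintro rfl
      exact ⟨x, h0 x x⟩
  · exact scalar_mem (Delta_mem ha b) x y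

/-- Multiplication by `Δ_i` lifts to a map from the Koszul complex to a resolution of
`R/I_{i-1}`. -/
lemma exists_isInducedBy_Delta (hb : 1 ≤ b) (hm₀ : m₀ = a * n + b) {i : ℕ} (hi : b + 1 ≤ i)
    (hin : i ≤ n) {M : GrComplex k (arithSeq n m₀ d)}
    (hM : M.IsResolution (idealI k n a b d (i - 1))) :
    ∃ μ : Hom ((koszul k (arithSeq n m₀ d)).shift (delta m₀ a b d i)) M,
      μ.IsInducedBy (Delta k n a b d i) := by
  obtain ⟨x, hx, hx0, hxI⟩ := hM.zero
  obtain ⟨y, hy, hy0, hyI⟩ := (isResolution_koszul (k := k) (arithSeq n m₀ d)).zero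
  suffices h : ∃ μ : Hom ((koszul k (arithSeq n m₀ d)).shift (delta m₀ a b d i)) M,
      μ.f 0 = Matrix.of fun _ _ => Delta k n a b d i by
    obtain ⟨μ, hμ⟩ := h
    exact ⟨μ, fun x y => congrFun (congrFun hμ x) y⟩
  refine exists_hom hM.isExact _ (fun x' y' => ?_) fun l => ?_
  · refine .of_hom (isWeightedHomogeneous_Delta hm₀ (by omega) hin) ?_
    change _ = (koszul k (arithSeq n m₀ d)).deg 0 y' + delta m₀ a b d i
    rw [hx x', hx0, hy y', hy0, add_comm]
  · have h : (koszul k (arithSeq n m₀ d)).d 0 y l ∈ Ideal.span (xvar k n '' Set.Iio n) := by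
      rw [← hyI]
      exact Ideal.subset_span ⟨l, rfl⟩
    have h1 : Delta k n a b d i * (koszul k (arithSeq n m₀ d)).d 0 y l ∈
        idealI k n a b d (i - 1) := by
      have hle : Ideal.span (xvar k n '' Set.Iio n) ≤
          Submodule.comap (LinearMap.mulLeft (MvPolynomial (Fin (n + 1)) k) (Delta k n a b d i))
            (idealI k n a b d (i - 1)) := by
        rw [Ideal.span, Submodule.span_le]
        rintro _ ⟨j, hj, rfl⟩
        exact Delta_mul_xvar_mem hb hm₀ hi hin hj
      exact hle h
    rw [← hxI] at h1
    obtain ⟨v, hv⟩ := (M.mem_span_row_iff x).1 h1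
    refine ⟨v, funext fun x' => ?_⟩
    rw [hx x', hv]
    let _ : Unique ((koszul k (arithSeq n m₀ d)).ι 0) := ⟨⟨y⟩, hy⟩
    refine Eq.trans ?_ (Fintype.sum_unique (M := MvPolynomial (Fin (n + 1)) k)
      (fun z => Delta k n a b d i * (koszul k (arithSeq n m₀ d)).d 0 z l)).symm
    rfl

/-- The colon ideal I_{i-1} : Δ_i is the ideal resolved by the Koszul complex, so μ is injective on
homology in degree 0. Only `μ.f 0` matters, hence any lift is covered. -/
lemma isResolution_cone_of_isInducedBy (hb : 1 ≤ b) (hm₀ : m₀ = a * n + b) {i : ℕ}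
    (hi : b + 1 ≤ i) (hin : i ≤ n) {M : GrComplex k (arithSeq n m₀ d)}
    (hM : M.IsResolution (idealI k n a b d (i - 1)))
    (μ : Hom ((koszul k (arithSeq n m₀ d)).shift (delta m₀ a b d i)) M)
    (hμ : μ.IsInducedBy (Delta k n a b d i)) : (cone μ).IsResolution (idealI k n a b d i) := by
  obtain ⟨x, hx, hx0, hxI⟩ := hM.zero
  have hK := isResolution_koszul (k := k) (arithSeq n m₀ d)
  obtain ⟨y, hy, hy0, hyI⟩ := hK.zero
  let _ : Unique ((koszul k (arithSeq n m₀ d)).ι 0) := ⟨⟨y⟩, hy⟩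
  refine isResolution_cone μ hK.isExact hM (fun u hu => ?_) fun x' => ?_
  · have h1 : (μ.f 0).mulVec u x = Delta k n a b d i * u y := by
      refine (Fintype.sum_unique (ι := (koszul k (arithSeq n m₀ d)).ι 0)
        (M := MvPolynomial (Fin (n + 1)) k) (fun z => μ.f 0 x z * u z)).trans ?_
      exact congrArg (· * u y) (hμ x y)
    have h2 := mem_span_xvar_of_Delta_mul_mem hb hm₀ hi hin (h1 ▸ hu x)
    rw [← hyI] at h2
    obtain ⟨v, hv⟩ := ((koszul k (arithSeq n m₀ d)).mem_span_row_iff y).1 h2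
    exact ⟨v, funext fun z => (hy z) ▸ hv⟩
  · rw [← idealI_sup hi]
    congr 2
    ext p
    constructor
    · rintro ⟨z, rfl⟩
      exact hμ x' z
    · rintro rfl
      exact ⟨y, hμ x' y⟩

end Lifts

/-! ### Degrees of the free modules. -/

open GrComplex

lemma map_val_eq_sum {α β : Type*} (s : Finset α) (f : α → β) :
    s.val.map f = ∑ a ∈ s, ({f a} : Multiset β) := by
  rw [Finset.sum]
  change _ = (Multiset.map ((fun b => ({b} : Multiset β)) ∘ f) s.val).sum
  rw [← Multiset.map_map, Multiset.sum_map_singleton]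

namespace GrComplex

variable {k : Type*} [Field k] {τ : Type} {w : τ → ℕ}

lemma degrees_shift (F : GrComplex k w) (e s : ℕ) :
    (F.shift e).degrees s = (F.degrees s).map (· + e) :=
  (Multiset.map_map (· + e) (F.deg s) _).symm

lemma degrees_cone_succ {F G : GrComplex k w} (μ : Hom F G) (s : ℕ) :
    (cone μ).degrees (s + 1) = G.degrees (s + 1) + F.degrees s := by
  change (Finset.univ : Finset (G.ι (s + 1) ⊕ F.ι s)).val.map
    (Sum.elim (G.deg (s + 1)) (F.deg s)) = _
  rw [map_val_eq_sum, Fintype.sum_sum_type, degrees, degrees, map_val_eq_sum, map_val_eq_sum]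
  rfl

end GrComplex

lemma sum_card_eq_sum_sigma {β : Type*} (n t : ℕ) (f : ℕ → β) :
    ∑ S : {S : Finset (Fin n) // S.card = t}, ({f (∑ j ∈ S.1, (j : ℕ))} : Multiset β) =
      (sigma n t).map f := by
  rw [sigma, Multiset.map_map, map_val_eq_sum, ← Nat.Iio_eq_range, ← Fin.map_valEmbedding_univ,
    Finset.powersetCard_map, Finset.sum_map,
    Finset.sum_subtype (F := Subtype.fintype _) (p := fun S : Finset (Fin n) => S.card = t)
      (Finset.powersetCard t (Finset.univ : Finset (Fin n))) (by simp [Finset.mem_powersetCard])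
      (fun S => ({(f ∘ fun S => ∑ r ∈ S, r) ((Finset.mapEmbedding Fin.valEmbedding).toEmbedding S)}
        : Multiset β))]
  refine Finset.sum_congr rfl fun S _ => ?_
  simp [Finset.mapEmbedding_apply]

/-- The degrees of a basis indexed by pairs `(S, q)`. -/
lemma map_deg_eq_sum {n m₀ d t N : ℕ} (g : ℕ → ℕ) :
    (Finset.univ : Finset ({S : Finset (Fin n) // S.card = t} × Fin N)).val.map
      (fun b => ∑ j ∈ b.1.1, arithSeq n m₀ d j.castSucc + g b.2) =
      ∑ q ∈ Finset.range N, (sigma n t).map fun r => t * m₀ + r * d + g q := by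
  rw [map_val_eq_sum, Fintype.sum_prod_type_right, Finset.sum_range]
  refine Finset.sum_congr rfl fun q _ => ?_
  rw [← sum_card_eq_sum_sigma]
  refine Finset.sum_congr rfl fun S _ => ?_
  simp [arithSeq, Finset.sum_add_distrib, Finset.sum_mul, S.2]

section Degrees

variable (k : Type*) [Field k] {n m₀ d a b : ℕ}

lemma degrees_eagonNorthcott_zero : (eagonNorthcott k n m₀ d).degrees 0 = {0} := rfl

lemma degrees_eagonNorthcott {s : ℕ} (hs : 1 ≤ s) :
    (eagonNorthcott k n m₀ d).degrees s = degE n m₀ d s := by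
  obtain ⟨s, rfl⟩ : ∃ t, s = t + 1 := ⟨s - 1, by omega⟩
  refine (map_deg_eq_sum (n := n) (t := s + 2) (N := s + 1) fun q => (q + 1) * d).trans ?_
  rw [degE]
  refine Finset.sum_nbij' (· + 1) (· - 1) ?_ ?_ ?_ ?_ ?_
  · intro q hq
    simp at hq ⊢
    omega
  · intro q hq
    simp at hq ⊢
    omega
  · simp
  · intro q hq
    simp at hq ⊢
    omega
  · intro q hq
    refine Multiset.map_congr rfl fun r _ => ?_
    ring

/-- The indices correspond by j = c - q among the symmetric powers. Past the splice they correspond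
by j = c + 1 + q, and the exterior degree is one higher. -/
lemma degrees_enFamily_of_le {c s : ℕ} (hs : s ≤ c) :
    ((enFamily k n m₀ d c).degrees s).map (· + delta m₀ a b d b) =
      ∑ j ∈ Finset.Icc s c, degL n m₀ a d s j := by
  have h : (enFamily k n m₀ d c).degrees s = _ :=
    map_deg_eq_sum (n := n) (m₀ := m₀) (d := d) (t := famCard c s) (N := famRank c s)
      fun q => (if s ≤ c then c - q else c + 1 + q) * d
  rw [h, famCard_of_le hs, famRank_of_le hs, ← Multiset.coe_mapAddMonoidHom, map_sum]
  refine Finset.sum_nbij' (c - ·) (c - ·) ?_ ?_ ?_ ?_ ?_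
  · intro q hq
    simp at hq ⊢
    omega
  · intro q hq
    simp at hq ⊢
    omega
  · intro q hq
    simp at hq ⊢
    omega
  · intro q hq
    simp at hq ⊢
    omega
  · intro q hq
    rw [Multiset.coe_mapAddMonoidHom, Multiset.map_map, degL, if_pos hs]
    refine Multiset.map_congr rfl fun r _ => ?_
    simp only [Function.comp_apply, delta, Nat.sub_self]
    ring

lemma degrees_enFamily_of_gt {c s : ℕ} (hs : c < s) :
    ((enFamily k n m₀ d c).degrees s).map (· + delta m₀ a b d b) =
      ∑ j ∈ Finset.Icc (c + 1) s, degL n m₀ a d (s + 1) j := by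
  have h : (enFamily k n m₀ d c).degrees s = _ :=
    map_deg_eq_sum (n := n) (m₀ := m₀) (d := d) (t := famCard c s) (N := famRank c s)
      fun q => (if s ≤ c then c - q else c + 1 + q) * d
  rw [h, famCard_of_gt hs, famRank_of_gt hs, ← Multiset.coe_mapAddMonoidHom, map_sum]
  refine Finset.sum_nbij' (c + 1 + ·) (· - (c + 1)) ?_ ?_ ?_ ?_ ?_
  · intro q hq
    simp at hq ⊢
    omega
  · intro q hq
    simp at hq ⊢
    omega
  · intro q hq
    simp
  · intro q hq
    simp at hq ⊢
    omega
  · intro q hq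
    rw [Multiset.coe_mapAddMonoidHom, Multiset.map_map, degL, if_neg (by omega)]
    refine Multiset.map_congr rfl fun r _ => ?_
    simp only [Function.comp_apply, delta, Nat.sub_self]
    ring

lemma sigma_of_lt {m t : ℕ} (h : m < t) : sigma m t = 0 := by
  rw [sigma, Finset.powersetCard_eq_empty.2 (by simpa using h)]
  rfl

lemma degE_of_le {s : ℕ} (h : n ≤ s) : degE n m₀ d s = 0 := by
  simp [degE, sigma_of_lt (Nat.lt_succ_of_le h)]

lemma degL_zero (j : ℕ) : degL n m₀ a d 0 j = {m₀ * (a + d + 1) + j * d} := by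
  simp [degL, sigma]

/-- These are the degrees predicted by the two formulas for `enFamily` with `c = 0`, so the case i =
b obeys the same description as the others. -/
lemma degrees_eagonNorthcott_shift (s : ℕ) :
    ((eagonNorthcott k n m₀ d).degrees s).map (· + delta m₀ a b d b) =
      if s = 0 then ∑ j ∈ Finset.Icc 0 0, degL n m₀ a d 0 j
      else ∑ j ∈ Finset.Icc 1 s, degL n m₀ a d (s + 1) j := by
  split_ifs with hs
  · subst hs
    rw [degrees_eagonNorthcott_zero]
    simp [degL_zero, delta]
  · rw [degrees_eagonNorthcott k (by omega), degE, ← Multiset.coe_mapAddMonoidHom, map_sum]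
    refine Finset.sum_congr rfl fun j _ => ?_
    rw [Multiset.coe_mapAddMonoidHom, Multiset.map_map, degL]
    refine Multiset.map_congr rfl fun r _ => ?_
    simp only [Function.comp_apply, delta, Nat.sub_self]
    ring

end Degrees

section Family

variable (k : Type*) [Field k] {n m₀ d a b : ℕ}

/-- The resolutions of the rings `R/I_i`, and the degrees of their generators. -/
lemma exists_isMinimalResolution (ha : 1 ≤ a) (hb : 1 ≤ b) (hbn : b ≤ n) (hm₀ : m₀ = a * n + b)
    {i : ℕ} (hi : b ≤ i) (hin : i ≤ n) :
    ∃ M : GrComplex k (arithSeq n m₀ d), M.IsMinimalResolution (idealI k n a b d i) ∧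
      (i = b → M = cone (scalarHom (eagonNorthcott k n m₀ d)
        (isWeightedHomogeneous_Delta (k := k) (d := d) hm₀ le_rfl hbn))) ∧
      M.degrees 0 = {0} ∧
      (∀ s ≤ i - b, M.degrees (s + 1) = degE n m₀ d (s + 1) +
        ∑ j ∈ Finset.Icc s (i - b), degL n m₀ a d s j) ∧
      ∀ s, i - b < s → M.degrees (s + 1) = degE n m₀ d (s + 1) +
        ∑ j ∈ Finset.Icc (i - b + 1) s, degL n m₀ a d (s + 1) j := by
  obtain ⟨c, rfl⟩ := Nat.exists_eq_add_of_le hi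
  rw [Nat.add_sub_cancel_left]
  rcases Nat.eq_zero_or_pos c with rfl | hc
  -- For i = b the cone of multiplication on E is chosen, so that M_b is this cone on the nose.
  · refine ⟨_, isMinimalResolution_cone_scalarHom ha hb hbn hm₀, fun _ => rfl, rfl,
      fun s hs => ?_, fun s hs => ?_⟩
    · obtain rfl : s = 0 := by omega
      rw [degrees_cone_succ, degrees_shift, degrees_eagonNorthcott k le_add_self,
        degrees_eagonNorthcott_shift, if_pos rfl]
    · rw [degrees_cone_succ, degrees_shift, degrees_eagonNorthcott k le_add_self,
        degrees_eagonNorthcott_shift, if_neg (by omega)]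
  · obtain ⟨μ, hμ⟩ := exists_isMinimalResolution_of_lt (k := k) (d := d) ha hb hm₀ hc hin
    refine ⟨cone μ, hμ, by omega, rfl, fun s hs => ?_, fun s hs => ?_⟩
    · rw [degrees_cone_succ, degrees_shift, degrees_eagonNorthcott k le_add_self,
        degrees_enFamily_of_le k hs]
    · rw [degrees_cone_succ, degrees_shift, degrees_eagonNorthcott k le_add_self,
        degrees_enFamily_of_gt k hs]

end Family

/-! ### Heights and the Cohen–Macaulay property for one-dimensional quotients. -/

section DimensionOne

variable {R : Type*} [CommRing R] {I : Ideal R} {n : ℕ}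

lemma comap_mk_lt {q p : Ideal (R ⧸ I)} (h : q < p) :
    q.comap (Ideal.Quotient.mk I) < p.comap (Ideal.Quotient.mk I) :=
  lt_of_le_of_ne (Ideal.comap_mono h.le) fun e =>
    h.ne (Ideal.comap_injective_of_surjective _ Ideal.Quotient.mk_surjective e)

lemma le_comap_mk (q : Ideal (R ⧸ I)) : I ≤ q.comap (Ideal.Quotient.mk I) := by
  intro x hx
  rw [Ideal.mem_comap, Ideal.Quotient.eq_zero_iff_mem.2 hx]
  exact zero_mem _

/-- A chain of three primes in the quotient would pull back to primes over I, the largest of height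
at least n + 2. -/
lemma height_quotient_le_one (hlow : ∀ P : Ideal R, P.IsPrime → I ≤ P → (n : ℕ∞) ≤ P.height)
    (hhigh : ∀ P : Ideal R, P.IsPrime → P.height ≤ (n + 1 : ℕ)) (p : Ideal (R ⧸ I))
    [p.IsPrime] : p.height ≤ (1 : ℕ) := by
  rw [Ideal.height_le_iff]
  intro q hq hqp
  suffices h : q.height ≤ (0 : ℕ) by
    refine lt_of_le_of_lt h ?_
    norm_num
  rw [Ideal.height_le_iff]
  intro q' hq' hqq'
  exfalso
  have h1 := Ideal.height_add_one_le_of_lt_of_isPrime (comap_mk_lt hqq')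
  have h2 := Ideal.height_add_one_le_of_lt_of_isPrime (comap_mk_lt hqp)
  have h3 := hlow _ (Ideal.comap_isPrime (Ideal.Quotient.mk I) q') (le_comap_mk q')
  have h4 := hhigh _ (Ideal.comap_isPrime (Ideal.Quotient.mk I) p)
  have h5 : (n : ℕ∞) + 1 + 1 ≤ (n + 1 : ℕ) :=
    (add_le_add_left ((add_le_add_left h3 1).trans h1) 1).trans (h2.trans h4)
  norm_cast at h5
  omega

lemma mk_mem_nonZeroDivisors {x : R} (hx : ∀ r, x * r ∈ I → r ∈ I) :
    Ideal.Quotient.mk I x ∈ nonZeroDivisors (R ⧸ I) := by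
  rw [mem_nonZeroDivisors_iff_right]
  intro y hy
  obtain ⟨r, rfl⟩ := Ideal.Quotient.mk_surjective y
  rw [← map_mul, Ideal.Quotient.eq_zero_iff_mem, mul_comm] at hy
  exact Ideal.Quotient.eq_zero_iff_mem.2 (hx r hy)

lemma one_le_height_of_mem {A : Type*} [CommRing A] {p : Ideal A} {x : A}
    (hx : x ∈ nonZeroDivisors A) (hxp : x ∈ p) : 1 ≤ p.height :=
  (Ideal.one_le_height_span_singleton_of_mem_nonZeroDivisors hx).trans
    (Ideal.height_mono ((Ideal.span_singleton_le_iff_mem _).2 hxp))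

/-- A criterion for a quotient to be Cohen–Macaulay of dimension one. -/
lemma isCohenMacaulay_quotient [IsNoetherianRing R]
    (hlow : ∀ P : Ideal R, P.IsPrime → I ≤ P → (n : ℕ∞) ≤ P.height)
    (hhigh : ∀ P : Ideal R, P.IsPrime → P.height ≤ (n + 1 : ℕ))
    (hnzd : ∀ P : Ideal R, P.IsMaximal → ∃ x ∈ P, ∀ r, x * r ∈ I → r ∈ I) :
    IsCohenMacaulay (R ⧸ I) := by
  refine ⟨inferInstance, fun p hp => ?_⟩
  obtain ⟨x, hxp, hx⟩ := hnzd _ (Ideal.comap_isMaximal_of_surjective (Ideal.Quotient.mk I)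
    Ideal.Quotient.mk_surjective (K := p))
  have hx' := mk_mem_nonZeroDivisors hx
  have hreg : algebraMap (R ⧸ I) (Localization.AtPrime p) (Ideal.Quotient.mk I x) ∈
      nonZeroDivisors (Localization.AtPrime p) :=
    IsLocalization.map_nonZeroDivisors_le p.primeCompl (Localization.AtPrime p) ⟨_, hx', rfl⟩
  have hmem : algebraMap (R ⧸ I) (Localization.AtPrime p) (Ideal.Quotient.mk I x) ∈
      IsLocalRing.maximalIdeal (Localization.AtPrime p) :=
    (IsLocalization.AtPrime.to_map_mem_maximal_iff (Localization.AtPrime p) p _).2 hxp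
  refine ⟨[_], fun r hr => List.mem_singleton.1 hr ▸ hmem, ?_, ?_⟩
  · rw [IsLocalRing.isRegular_iff_isWeaklyRegular_of_subset_maximalIdeal
      fun r hr => List.mem_singleton.1 hr ▸ hmem,
      RingTheory.Sequence.isWeaklyRegular_singleton_iff, isSMulRegular_iff_right_eq_zero_of_smul]
    intro y hy
    exact (mem_nonZeroDivisors_iff_right.1 hreg) y (by rw [mul_comm]; exact hy)
  · rw [IsLocalization.AtPrime.ringKrullDim_eq_height p]
    have h1 := height_quotient_le_one hlow hhigh p
    have h2 : 1 ≤ p.height := one_le_height_of_mem hx' hxp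
    have h3 : p.height = 1 := le_antisymm h1 h2
    rw [h3]
    rfl

/-- A maximal ideal of the quotient contains a nonzerodivisor, hence is not a minimal prime. The
prime strictly below it pulls back to a prime over I of height at most n. -/
lemma height_eq_of_exists_nonZeroDivisor (hI : I ≠ ⊤)
    (hlow : ∀ P : Ideal R, P.IsPrime → I ≤ P → (n : ℕ∞) ≤ P.height)
    (hhigh : ∀ P : Ideal R, P.IsPrime → P.height ≤ (n + 1 : ℕ))
    (hnzd : ∀ P : Ideal R, P.IsMaximal → ∃ x ∈ P, ∀ r, x * r ∈ I → r ∈ I) : I.height = n := by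
  refine le_antisymm ?_ ?_
  · have : Nontrivial (R ⧸ I) := Ideal.Quotient.nontrivial_iff.2 hI
    obtain ⟨p, hp⟩ := Ideal.exists_maximal (R ⧸ I)
    obtain ⟨x, hxp, hx⟩ := hnzd _ (Ideal.comap_isMaximal_of_surjective (Ideal.Quotient.mk I)
      Ideal.Quotient.mk_surjective (K := p))
    have h1 : 1 ≤ p.height := one_le_height_of_mem (mk_mem_nonZeroDivisors hx) hxp
    have h2 : ¬ p.height ≤ (0 : ℕ) := fun h => by
      have := h1.trans h
      norm_num at this
    rw [Ideal.height_le_iff] at h2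
    push Not at h2
    obtain ⟨q, hq, hqp, -⟩ := h2
    have h3 := Ideal.height_add_one_le_of_lt_of_isPrime (comap_mk_lt hqp)
    have h4 := h3.trans (hhigh _ (Ideal.comap_isPrime (Ideal.Quotient.mk I) p))
    push_cast at h4
    exact (Ideal.height_mono (le_comap_mk q)).trans
      ((ENat.add_le_add_iff_right ENat.one_ne_top).1 h4)
  · rw [Ideal.height_eq_inf_minimalPrimes]
    exact le_iInf₂ fun P hP => hlow P hP.isPrime hP.le

end DimensionOne

/-! ### Heights of the ideals of minors, and the Nullstellensatz. -/

section Heights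

variable {k : Type*} [Field k] {n : ℕ}

lemma height_le_of_isPrime (P : Ideal (MvPolynomial (Fin (n + 1)) k)) (hP : P.IsPrime) :
    P.height ≤ (n + 1 : ℕ) := by
  have h := Ideal.height_le_ringKrullDim_of_isPrime (I := P)
  rw [MvPolynomial.ringKrullDim_of_isNoetherianRing, ringKrullDim_eq_zero_of_field, Nat.card_fin,
    zero_add] at h
  exact_mod_cast h

lemma minorIdeal_eq_ker {m : ℕ} (hm : 0 < m) (hmn : m ≤ n) :
    minorIdeal k n m = RingHom.ker (curveMap k n m) :=
  le_antisymm (fun _ h => curveMap_eq_zero_of_mem hmn h)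
    fun _ h => mem_minorIdeal_of_curveMap_eq_zero hm hmn h

lemma isPrime_minorIdeal {m : ℕ} (hm : 0 < m) (hmn : m ≤ n) : (minorIdeal k n m).IsPrime := by
  rw [minorIdeal_eq_ker hm hmn]
  exact RingHom.ker_isPrime _

/-- The new minor X_{m-1} X_{m+1} - X_m² is not in the kernel of the parametrization for `m`, which
leaves X_{m+1} free: at s = 0, t = 1 it becomes -1. -/
lemma minorIdeal_lt {m : ℕ} (hm : 0 < m) (hmn : m + 1 ≤ n) :
    minorIdeal k n m < minorIdeal k n (m + 1) := by
  refine lt_of_le_of_ne (Ideal.span_mono ?_) fun h => ?_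
  · rintro _ ⟨i, j, hi, hj, rfl⟩
    exact ⟨i, j, by omega, by omega, rfl⟩
  · have h1 := minor_mem (k := k) (n := n) (show m - 1 < m + 1 by omega) (show m < m + 1 by omega)
    rw [← h] at h1
    have h2 := curveMap_eq_zero_of_mem (by omega) h1
    rw [map_sub, map_mul, map_mul, Nat.sub_add_cancel hm, curveMap_of_le (by omega) (by omega),
      curveMap_of_le le_rfl (by omega), curveMap_of_gt (by omega) (by omega)] at h2
    have h3 := congrArg (eval ![0, 1]) h2
    simp [show m - (m - 1) ≠ 0 by omega] at h3

/-- The ideals of minors of the first 1, 2, …, m + 1 columns form a strictly increasing chain of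
primes. -/
lemma le_height_minorIdeal {m : ℕ} (hmn : m + 1 ≤ n) : (m : ℕ∞) ≤ (minorIdeal k n (m + 1)).height := by
  induction m with
  | zero => simp
  | succ m ih =>
    have := isPrime_minorIdeal (k := k) (n := n) (m := m + 1) (by omega) (by omega)
    have := isPrime_minorIdeal (k := k) (n := n) (m := m + 1 + 1) (by omega) (by omega)
    refine le_trans ?_ (Ideal.height_add_one_le_of_lt_of_isPrime
      (minorIdeal_lt (k := k) (n := n) (m := m + 1) (by omega) (by omega)))
    push_cast
    exact add_le_add_left (ih (by omega)) 1

/-- Maximal ideals contain nonzero polynomials in any given variable. -/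
lemma exists_aeval_mem {τ : Type*} [Finite τ] (P : Ideal (MvPolynomial τ k)) [hP : P.IsMaximal]
    (z : MvPolynomial τ k) : ∃ g : Polynomial k, g ≠ 0 ∧ Polynomial.aeval z g ∈ P := by
  let _ : Field (MvPolynomial τ k ⧸ P) := Ideal.Quotient.field P
  -- By the Nullstellensatz the residue field is finite over `k`, so the residue class of `z` has a
  -- minimal polynomial.
  have hfin : Module.Finite k (MvPolynomial τ k ⧸ P) := finite_of_finite_type_of_isJacobsonRing k _
  have hz_int : IsIntegral k (Ideal.Quotient.mk P z) := Algebra.IsIntegral.isIntegral _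
  refine ⟨minpoly k (Ideal.Quotient.mk P z), minpoly.ne_zero hz_int, ?_⟩
  rw [← Ideal.Quotient.eq_zero_iff_mem]
  have h1 := minpoly.aeval k (Ideal.Quotient.mk P z)
  have h2 := Polynomial.aeval_algHom_apply (Ideal.Quotient.mkₐ k P) z
    (minpoly k (Ideal.Quotient.mk P z))
  exact h2.symm.trans h1

end Heights

/-! ### I_i as the preimage of a principal ideal, and regularity of polynomials in X_n. -/

section Regular

variable {k : Type*} [Field k] {n m₀ d a b : ℕ}

/-- A polynomial in `t` is a nonzerodivisor modulo `s^e (t^{m₀} - s^{m₀ + n d})`. -/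
lemma dvd_of_dvd_aeval_mul (hm₀ : 0 < m₀) {e l : ℕ} (hl : 0 < l) {g : Polynomial k} (hg : g ≠ 0)
    {u : MvPolynomial (Fin 2) k}
    (h : X 0 ^ e * monomialForm k n m₀ d ∣ Polynomial.aeval (X 1 ^ l) g * u) :
    X 0 ^ e * monomialForm k n m₀ d ∣ u := by
  -- In k[t][s] the divisor is monic in s up to sign. Taking remainders is then linear over k[t], so
  -- a nonzero factor from k[t] can be cancelled.
  let φ := MvPolynomial.finSuccEquiv k 1
  let H : Polynomial (MvPolynomial (Fin 1) k) :=
    Polynomial.X ^ e * (Polynomial.X ^ (m₀ + n * d) - Polynomial.C (X 0 ^ m₀))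
  have hH : H.Monic := (Polynomial.monic_X_pow e).mul (Polynomial.monic_X_pow_sub_C _ (by omega))
  have hX1 : φ (X 1) = Polynomial.C (X 0) := finSuccEquiv_X_succ (j := 0)
  have hφ : φ (X 0 ^ e * monomialForm k n m₀ d) = -H := by
    simp only [monomialForm, map_mul, map_sub, map_pow, hX1, H]
    rw [show φ (X 0) = Polynomial.X from finSuccEquiv_X_zero]
    ring
  let c : MvPolynomial (Fin 1) k := Polynomial.aeval (X 0 ^ l) g
  have hc : c ≠ 0 := by
    have h1 : Polynomial.aeval (X 0 : MvPolynomial (Fin 1) k) (Polynomial.expand k l g) = c := by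
      rw [Polynomial.expand_aeval]
    have h2 : aeval (fun _ : Fin 1 => (Polynomial.X : Polynomial k)) c = Polynomial.expand k l g := by
      rw [← h1, ← Polynomial.aeval_algHom_apply, aeval_X, Polynomial.aeval_X_left_apply]
    intro h3
    rw [h3, map_zero] at h2
    exact hg ((Polynomial.expand_eq_zero hl).1 h2.symm)
  have hφg : φ (Polynomial.aeval (X 1 ^ l) g) = Polynomial.C c := by
    have h1 := Polynomial.aeval_algHom_apply φ.toAlgHom (X 1 ^ l) g
    have h2 := Polynomial.aeval_algHom_apply
      (IsScalarTower.toAlgHom k (MvPolynomial (Fin 1) k) (Polynomial (MvPolynomial (Fin 1) k)))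
      (X 0 ^ l) g
    refine h1.symm.trans (Eq.trans ?_ h2)
    congr 2
    change φ (X 1 ^ l) = Polynomial.C (X 0 ^ l)
    rw [map_pow, hX1, map_pow]
  have h1 : H ∣ φ (Polynomial.aeval (X 1 ^ l) g * u) := by
    obtain ⟨z, hz⟩ := h
    exact ⟨-φ z, by rw [hz, map_mul, hφ]; ring⟩
  rw [map_mul, hφg, ← Polynomial.smul_eq_C_mul,
    ← Polynomial.modByMonic_eq_zero_iff_dvd hH, Polynomial.smul_modByMonic, smul_eq_zero] at h1
  obtain ⟨z, hz⟩ := (Polynomial.modByMonic_eq_zero_iff_dvd hH).1 (h1.resolve_left hc)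
  refine ⟨-φ.symm z, φ.injective ?_⟩
  rw [hz, map_mul, hφ, map_neg, AlgEquiv.apply_symm_apply]
  ring

/-- The monomials of degree divisible by `n` are in the image of the parametrization. -/
lemma exists_rncMap_eq (l : ℕ) {α β : ℕ} (h : α + β = n * l) :
    ∃ r, rncMap k n r = X 0 ^ α * X 1 ^ β := by
  induction l generalizing α β with
  | zero =>
    obtain rfl : α = 0 := by simp at h; omega
    obtain rfl : β = 0 := by simp at h; omega
    exact ⟨1, by simp⟩
  | succ l ih =>
    rw [Nat.mul_succ] at h
    obtain ⟨j, α', β', hj, rfl, rfl, h'⟩ : ∃ j α' β', j ≤ n ∧ α = n - j + α' ∧ β = j + β' ∧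
        α' + β' = n * l :=
      ⟨min n β, α - (n - min n β), β - min n β, by omega, by omega, by omega, by omega⟩
    obtain ⟨r, hr⟩ := ih h'
    refine ⟨xvar k n j * r, ?_⟩
    rw [map_mul, hr, rncMap_xvar hj]
    ring

/-- Only monomials of total degree divisible by `n` occur in the image of the parametrization. This
allows cofactors to be chosen homogeneous modulo `n`. -/
lemma isWeightedHomogeneous_rncMap (r : MvPolynomial (Fin (n + 1)) k) :
    IsWeightedHomogeneous (fun _ : Fin 2 => (1 : ZMod n)) (rncMap k n r) 0 := by
  induction r using MvPolynomial.induction_on with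
  | C c =>
    rw [rncMap, aeval_C]
    exact isWeightedHomogeneous_C _ _
  | add p q hp hq =>
    rw [map_add]
    exact hp.add hq
  | mul_X p i hp =>
    rw [map_mul, ← add_zero (0 : ZMod n)]
    refine hp.mul ?_
    rw [rncMap, aeval_X]
    have h := ((isWeightedHomogeneous_X k (fun _ : Fin 2 => (1 : ZMod n)) 0).pow
      (n - (i : ℕ))).mul ((isWeightedHomogeneous_X k (fun _ : Fin 2 => (1 : ZMod n)) 1).pow i)
    convert h using 1
    have := i.2
    rw [nsmul_one, nsmul_one, ← Nat.cast_add, Nat.sub_add_cancel (by omega), ZMod.natCast_self]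

/-- The cofactor in a product with a homogeneous polynomial can be taken homogeneous. -/
lemma exists_homogeneous_cofactor {σ M : Type*} [AddCommGroup M] [Finite M] {w : σ → M}
    {p h g : MvPolynomial σ k} {e : M} (hh : IsWeightedHomogeneous w h e)
    (hp : IsWeightedHomogeneous w p 0) (hpg : p = h * g) :
    ∃ g', IsWeightedHomogeneous w g' (-e) ∧ p = h * g' := by
  classical
  have := Fintype.ofFinite M
  refine ⟨weightedHomogeneousComponent w (-e) g,
    weightedHomogeneousComponent_isWeightedHomogeneous _ _, ?_⟩
  have h1 : g = ∑ m, weightedHomogeneousComponent w m g := by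
    rw [← finsum_eq_sum_of_fintype, sum_weightedHomogeneousComponent]
  have h2 := congrArg (weightedHomogeneousComponent w (0 : M)) hpg
  rw [hp.weightedHomogeneousComponent_same] at h2
  rw [h2]
  conv_lhs => rw [h1, Finset.mul_sum, map_sum]
  have h3 : ∀ m, IsWeightedHomogeneous w (h * weightedHomogeneousComponent w m g) (e + m) :=
    fun m => hh.mul (weightedHomogeneousComponent_isWeightedHomogeneous _ _)
  rw [Finset.sum_eq_single (-e)]
  · have := h3 (-e)
    rw [add_neg_cancel] at this
    exact this.weightedHomogeneousComponent_same
  · intro m _ hm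
    refine (h3 m).weightedHomogeneousComponent_ne _ fun h0 => hm ?_
    exact (neg_eq_of_add_eq_zero_right h0.symm).symm
  · simp

/-- The ideal `I_i` is the preimage of the ideal of `s^{n-i} (t^{m₀} - s^{m₀ + n d})`. -/
lemma mem_idealI_of_dvd (hb : 1 ≤ b) (hm₀ : m₀ = a * n + b) {i : ℕ} (hi : b ≤ i) (hin : i ≤ n)
    {r : MvPolynomial (Fin (n + 1)) k}
    (hr : X 0 ^ (n - i) * monomialForm k n m₀ d ∣ rncMap k n r) : r ∈ idealI k n a b d i := by
  have : NeZero n := ⟨by omega⟩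
  set h := X 0 ^ (n - i) * monomialForm k n m₀ d with hh
  have hX : ∀ (x : Fin 2) (l : ℕ), IsWeightedHomogeneous (fun _ : Fin 2 => (1 : ZMod n))
      (X x ^ l : MvPolynomial (Fin 2) k) (l : ZMod n) := fun x l => by
    simpa using (isWeightedHomogeneous_X k (fun _ : Fin 2 => (1 : ZMod n)) x).pow l
  have hhom : IsWeightedHomogeneous (fun _ : Fin 2 => (1 : ZMod n)) h
      (((n - i : ℕ) : ZMod n) + (m₀ : ZMod n)) := by
    refine (hX 0 _).mul ((weightedHomogeneousSubmodule k _ _).sub_mem (hX 1 m₀) ?_)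
    have := hX 0 (m₀ + n * d)
    simpa using this
  obtain ⟨g, hg⟩ := hr
  obtain ⟨g', hg', hrg⟩ := exists_homogeneous_cofactor hhom (isWeightedHomogeneous_rncMap r) hg
  let N : Submodule k (MvPolynomial (Fin 2) k) :=
    (((idealI k n a b d i).restrictScalars k).map (rncMap k n).toLinearMap).comap
      (LinearMap.mulLeft k h)
  -- Such a monomial is s^q t^{i-b-q} times a monomial of degree nl. The first factor times `h` is
  -- the image of Δ_{i-q}, and the second is in the image of the parametrization.
  have hmon : ∀ α β l : ℕ, α + β = (i - b) + n * l → X 0 ^ α * X 1 ^ β ∈ N := by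
    intro α β l hl
    obtain ⟨q, α', β', hq, rfl, rfl, h'⟩ : ∃ q α' β', q ≤ i - b ∧ α = q + α' ∧
        β = i - b - q + β' ∧ α' + β' = n * l :=
      ⟨min (i - b) α, α - min (i - b) α, β - (i - b - min (i - b) α), by omega, by omega,
        by omega, by omega⟩
    obtain ⟨r', hr'⟩ := exists_rncMap_eq (k := k) l h'
    refine ⟨Delta k n a b d (i - q) * r', Ideal.mul_mem_right _ _
      (Delta_mem_idealI (by omega) (by omega)), ?_⟩
    change rncMap k n (Delta k n a b d (i - q) * r') = h * _
    rw [map_mul, hr', rncMap_Delta hm₀ (by omega) (by omega), hh,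
      show n - (i - q) = n - i + q by omega, show i - q - b = i - b - q by omega]
    ring
  have hN : g' ∈ N := by
    rw [g'.as_sum]
    refine N.sum_mem fun c hc => ?_
    have h1 := hg' (mem_support_iff.1 hc)
    rw [Finsupp.weight_apply, Finsupp.sum_fintype _ _ (by simp), Fin.sum_univ_two] at h1
    simp only [nsmul_one] at h1
    -- The total degree of `g'` is minus that of `h` modulo n, and (n - i) + m₀ + (i - b) = n(a +
    -- 1). As b ≥ 1, i - b is the remainder itself, so each monomial has degree i - b + nl with l a
    -- natural number.
    have h2 : ((c 0 + c 1 : ℕ) : ZMod n) = ((i - b : ℕ) : ZMod n) := by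
      rw [Nat.cast_add, h1, neg_eq_iff_add_eq_zero, ← Nat.cast_add, ← Nat.cast_add,
        ZMod.natCast_eq_zero_iff]
      refine ⟨a + 1, ?_⟩
      rw [hm₀, mul_add, mul_comm n a]
      omega
    rw [ZMod.natCast_eq_natCast_iff', Nat.mod_eq_of_lt (show i - b < n by omega)] at h2
    have h3 := hmon (c 0) (c 1) ((c 0 + c 1) / n) (by rw [← h2, Nat.mod_add_div])
    have h4 : monomial c (coeff c g') = coeff c g' • (X 0 ^ c 0 * X 1 ^ c 1) := by
      rw [monomial_eq, Finsupp.prod_fintype _ _ (by simp), Fin.prod_univ_two, smul_eq_C_mul]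
    rw [h4]
    exact N.smul_mem _ h3
  obtain ⟨r', hr', hr''⟩ := hN
  rw [← sub_add_cancel r r']
  refine add_mem (rncIdeal_le_idealI i (mem_rncIdeal.2 ?_)) hr'
  rw [map_sub, hrg, sub_eq_zero]
  exact hr''.symm

lemma rncMap_aeval_xvar (g : Polynomial k) :
    rncMap k n (Polynomial.aeval (xvar k n n) g) = Polynomial.aeval (X 1 ^ n) g := by
  rw [← Polynomial.aeval_algHom_apply, rncMap_xvar le_rfl, Nat.sub_self, pow_zero, one_mul]

/-- Polynomials in `X_n` are nonzerodivisors modulo `I_i`. -/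
lemma mem_idealI_of_aeval_mul_mem (hb : 1 ≤ b) (hm₀ : m₀ = a * n + b) {i : ℕ} (hi : b ≤ i)
    (hin : i ≤ n) {g : Polynomial k} (hg : g ≠ 0) {r : MvPolynomial (Fin (n + 1)) k}
    (hr : Polynomial.aeval (xvar k n n) g * r ∈ idealI k n a b d i) : r ∈ idealI k n a b d i := by
  refine mem_idealI_of_dvd hb hm₀ hi hin
    (dvd_of_dvd_aeval_mul (l := n) (by omega) (by omega) hg ?_)
  have := dvd_rncMap_of_mem_idealI hm₀ hin hr
  rwa [map_mul, rncMap_aeval_xvar] at this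

lemma exists_mem_isMaximal (hb : 1 ≤ b) (hm₀ : m₀ = a * n + b) {i : ℕ} (hi : b ≤ i) (hin : i ≤ n)
    (P : Ideal (MvPolynomial (Fin (n + 1)) k)) (_ : P.IsMaximal) :
    ∃ x ∈ P, ∀ r, x * r ∈ idealI k n a b d i → r ∈ idealI k n a b d i := by
  obtain ⟨g, hg, hgP⟩ := exists_aeval_mem P (xvar k n n)
  exact ⟨_, hgP, fun _ hr => mem_idealI_of_aeval_mul_mem hb hm₀ hi hin hg hr⟩

/-- The ideal J is a prime of height at least n - 1, and P contains it strictly because Δ_i is not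
in J. -/
lemma le_height_of_idealI_le (hb : 1 ≤ b) (hm₀ : m₀ = a * n + b) {i : ℕ} (hi : b ≤ i)
    (hin : i ≤ n) (P : Ideal (MvPolynomial (Fin (n + 1)) k)) (hP : P.IsPrime)
    (hI : idealI k n a b d i ≤ P) : (n : ℕ∞) ≤ P.height := by
  obtain ⟨m, rfl⟩ : ∃ m, n = m + 1 := ⟨n - 1, by omega⟩
  have hJ := rncIdeal_eq_minorIdeal (k := k) (Nat.succ_pos m)
  have := isPrime_minorIdeal (k := k) (Nat.succ_pos m) le_rfl
  have hlt : minorIdeal k (m + 1) (m + 1) < P := by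
    rw [← hJ]
    refine lt_of_le_of_ne ((rncIdeal_le_idealI i).trans hI) fun h => ?_
    have h1 : Delta k (m + 1) a b d i ∈ rncIdeal k (m + 1) := h ▸ hI (Delta_mem_idealI hi le_rfl)
    rw [mem_rncIdeal, rncMap_Delta hm₀ hi hin] at h1
    exact mul_ne_zero (mul_ne_zero (pow_ne_zero _ (X_ne_zero _)) (pow_ne_zero _ (X_ne_zero _)))
      (monomialForm_ne_zero (by omega)) h1
  refine le_trans ?_ (Ideal.height_add_one_le_of_lt_of_isPrime hlt)
  push_cast
  exact add_le_add_left (le_height_minorIdeal le_rfl) 1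

lemma idealI_ne_top (hb : 1 ≤ b) (hm₀ : m₀ = a * n + b) {i : ℕ} (hin : i ≤ n) :
    idealI k n a b d i ≠ ⊤ := by
  intro h
  have h1 := dvd_rncMap_of_mem_idealI (r := 1) hm₀ hin (h ▸ Submodule.mem_top)
  rw [map_one] at h1
  have h2 := map_dvd (constantCoeff : MvPolynomial (Fin 2) k →+* k) h1
  simp [monomialForm, show m₀ ≠ 0 by omega] at h2

lemma isCohenMacaulay_quotient_idealI (hb : 1 ≤ b) (hm₀ : m₀ = a * n + b) {i : ℕ} (hi : b ≤ i)
    (hin : i ≤ n) : IsCohenMacaulay (MvPolynomial (Fin (n + 1)) k ⧸ idealI k n a b d i) :=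
  isCohenMacaulay_quotient (le_height_of_idealI_le hb hm₀ hi hin) height_le_of_isPrime
    (exists_mem_isMaximal hb hm₀ hi hin)

lemma height_idealI (hb : 1 ≤ b) (hm₀ : m₀ = a * n + b) {i : ℕ} (hi : b ≤ i)
    (hin : i ≤ n) : (idealI k n a b d i).height = n :=
  height_eq_of_exists_nonZeroDivisor (idealI_ne_top hb hm₀ hin)
    (le_height_of_idealI_le hb hm₀ hi hin) height_le_of_isPrime
    (exists_mem_isMaximal hb hm₀ hi hin)

end Regular

end ArithCurve

end

/-! ### Assembly of the theorem. -/

open ArithCurve ArithCurve.GrComplex in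
theorem theorem3p2 {k : Type*} [Field k] (n m₀ d a b : ℕ)
    -- `m_i = m₀ + i d` is an arithmetic sequence: relatively prime integers that minimally
    -- generate a numerical semigroup
    (hd : 1 ≤ d)
    (hgcd : Finset.univ.gcd (arithSeq n m₀ d) = 1)
    (hmin : ∀ i, arithSeq n m₀ d i ∉ AddSubmonoid.closure (arithSeq n m₀ d '' {i}ᶜ))
    (ha : 1 ≤ a) (hb : 1 ≤ b) (hbn : b ≤ n) (hm₀ : m₀ = a * n + b) :
    -- `E` and `K` are the minimal graded free resolutions of `R/J` and `R/(X_0, …, X_{n-1})`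
    (eagonNorthcott k n m₀ d).IsMinimalResolution (rncIdeal k n) ∧
    (∀ s, 1 ≤ s → (eagonNorthcott k n m₀ d).degrees s = degE n m₀ d s) ∧
    (koszul k (arithSeq n m₀ d)).IsMinimalResolution
      (Ideal.span (xvar k n '' Set.Iio n)) ∧
    -- `Δ_i` is homogeneous of degree `δ_i`
    (∀ i, b ≤ i → i ≤ n → Delta k n a b d i ≠ 0 ∧
      (Delta k n a b d i).IsWeightedHomogeneous (arithSeq n m₀ d) (delta m₀ a b d i)) ∧
    -- `R/I_i` is Cohen–Macaulay of codimension `n`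
    (∀ i, b ≤ i → i ≤ n →
      IsCohenMacaulay (MvPolynomial (Fin (n + 1)) k ⧸ idealI k n a b d i) ∧
      (idealI k n a b d i).height = n) ∧
    ∃ M : ℕ → GrComplex k (arithSeq n m₀ d),
      -- `M_i` is a minimal graded free resolution of `R/I_i`
      (∀ i, b ≤ i → i ≤ n → (M i).IsMinimalResolution (idealI k n a b d i)) ∧
      -- `M_b` is the cone, and also the minimized cone, of multiplication by `Δ_b` on `E`
      (∃ μ : Hom ((eagonNorthcott k n m₀ d).shift (delta m₀ a b d b)) (eagonNorthcott k n m₀ d),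
        (∀ s, μ.f s = Matrix.scalar ((eagonNorthcott k n m₀ d).ι s) (Delta k n a b d b)) ∧
        M b = cone μ ∧ IsMinCone μ (M b)) ∧
      -- `M_i` is the minimized cone of any map `K(-δ_i) → M_{i-1}` induced by `Δ_i`, and such
      -- maps exist
      (∀ i, b + 1 ≤ i → i ≤ n →
        (∃ μ : Hom ((koszul k (arithSeq n m₀ d)).shift (delta m₀ a b d i)) (M (i - 1)),
          μ.IsInducedBy (Delta k n a b d i)) ∧
        ∀ μ : Hom ((koszul k (arithSeq n m₀ d)).shift (delta m₀ a b d i)) (M (i - 1)),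
          μ.IsInducedBy (Delta k n a b d i) → IsMinCone μ (M i)) ∧
      -- the free modules in `M_i`
      (∀ i, b ≤ i → i ≤ n →
        (M i).degrees 0 = {0} ∧
        (M i).degrees 1 = degE n m₀ d 1 +
          ∑ j ∈ Finset.Icc 0 (i - b), {m₀ * (a + d + 1) + j * d} ∧
        (∀ s, 2 ≤ s → s ≤ i - b + 1 → (M i).degrees s = degE n m₀ d s +
          ∑ j ∈ Finset.Icc (s - 1) (i - b), degL n m₀ a d (s - 1) j) ∧
        (∀ s, i - b + 2 ≤ s → s ≤ n → (M i).degrees s = degE n m₀ d s +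
          ∑ j ∈ Finset.Icc (i - b + 1) (s - 1), degL n m₀ a d s j) ∧
        (∀ s, n < s → (M i).degrees s = 0) ∧
        (M i).degrees n = if i = n ∧ b = 1 then degL n m₀ a d (n - 1) (n - 1)
          else ∑ j ∈ Finset.Icc (i - b + 1) (n - 1), degL n m₀ a d n j) := by
  have hw : ∀ t, 0 < arithSeq n m₀ d t := fun t => by
    rw [arithSeq]
    omega
  refine ⟨⟨isResolution_eagonNorthcott (by omega) m₀ d, isMinimal_eagonNorthcott m₀ d⟩,
    fun s hs => degrees_eagonNorthcott k hs, ⟨isResolution_koszul _, isMinimal_koszul _⟩,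
    fun i hi hin => ⟨Delta_ne_zero hb hm₀ hi hin, isWeightedHomogeneous_Delta hm₀ hi hin⟩,
    fun i hi hin => ⟨isCohenMacaulay_quotient_idealI hb hm₀ hi hin,
      height_idealI hb hm₀ hi hin⟩, ?_⟩
  have key : ∀ i, ∃ M : GrComplex k (arithSeq n m₀ d), b ≤ i → i ≤ n → _ := fun i => by
    by_cases h : b ≤ i ∧ i ≤ n
    · obtain ⟨M, hM⟩ := exists_isMinimalResolution k (d := d) ha hb hbn hm₀ h.1 h.2
      exact ⟨M, fun _ _ => hM⟩
    · exact ⟨eagonNorthcott k n m₀ d, fun h1 h2 => (h ⟨h1, h2⟩).elim⟩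
  choose M hM using key
  have hM' : ∀ i, b ≤ i → i ≤ n → (M i).IsMinimalResolution (idealI k n a b d i) :=
    fun i hi hin => (hM i hi hin).1
  refine ⟨M, hM', ?_, fun i hi hin => ⟨?_, fun μ hμ => ?_⟩, fun i hi hin => ?_⟩
  · have hMb := (hM b le_rfl hbn).2.1 rfl
    refine ⟨_, fun s => rfl, hMb, (hM' b le_rfl hbn).isMinCone hw ?_⟩
    rw [← hMb]
    exact (hM' b le_rfl hbn).1
  · exact exists_isInducedBy_Delta hb hm₀ hi hin (hM' (i - 1) (by omega) (by omega)).1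
  · exact (hM' i (by omega) hin).isMinCone hw (isResolution_cone_of_isInducedBy hb hm₀ hi hin
      (hM' (i - 1) (by omega) (by omega)).1 μ hμ)
  · obtain ⟨-, -, h0, hle, hgt⟩ := hM i hi hin
    refine ⟨h0, ?_, fun s hs hs' => ?_, fun s hs hsn => ?_, fun s hs => ?_, ?_⟩
    · rw [hle 0 (Nat.zero_le _)]
      simp only [degL_zero]
    · obtain ⟨s, rfl⟩ : ∃ t, s = t + 1 := ⟨s - 1, by omega⟩
      exact hle s (by omega)
    · obtain ⟨s, rfl⟩ : ∃ t, s = t + 1 := ⟨s - 1, by omega⟩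
      exact hgt s (by omega)
    · obtain ⟨s, rfl⟩ : ∃ t, s = t + 1 := ⟨s - 1, by omega⟩
      rw [hgt s (by omega), degE_of_le (by omega), zero_add]
      exact Finset.sum_eq_zero fun j _ => by rw [degL, sigma_of_lt hs, Multiset.map_zero]
    · obtain ⟨t, rfl⟩ : ∃ t, n = t + 1 := ⟨n - 1, by omega⟩
      -- Here E_n = 0, and n - 1 ≤ i - b holds only for i = n and b = 1. This decides which of the
      -- two formulas describes the last module.
      split_ifs with h
      · rw [hle t (by omega), degE_of_le le_rfl, zero_add, h.1, h.2, Nat.add_sub_cancel,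
          Finset.Icc_self, Finset.sum_singleton]
      · rw [hgt t (by omega), degE_of_le le_rfl, zero_add, Nat.add_sub_cancel]
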